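/- Let $d\in\{1,2,3\}$ and consider, on the box $\mathbb T^d=(0,\pi)^d$ with homogeneous Neumann boundary conditions $\partial_{x_i}u=\partial_{x_i}v=0$ at $x_i=0,\pi$, the system $$u_t=\nabla\cdot\big(D_1(u+\bar U,v+\bar V)\nabla u\big)+f(u+\bar U,v+\bar V),\qquad v_t=\nabla\cdot\big(D_2(u+\bar U,v+\bar V)\nabla v\big)+g(u+\bar U,v+\bar V)$$ for the perturbation $\mathbf w=[u,v]$ of a constant steady state $\bar W=[\bar U,\bar V]$, $f(\bar W)=g(\bar W)=0$. Write $\bar D_i=D_i(\bar W)$, and $\bar f_u,\bar f_v,\bar g_u,\bar g_v$ for the partial derivatives of $f,g$ at $\bar W$. Assume: * $\bar D_1,\bar D_2>0$; * $\bar f_u+\bar g_v<0$ and $\bar f_u\bar g_v-\bar f_v\bar g_u>0$; * there is $\mathbf q\in(\mathbb N\cup\{0\})^d$ such that, with $q^2=\sum_i q_i^2$, $(\bar f_u-\bar D_1q^2)(\bar g_v-\bar D_2q^2)-\bar f_v\bar g_u<0$; * $\bar g_v<0$ (i.e. the first species is the activator); * $\eta>0$ is such that $D_1,D_2,f,g$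 are $C^2$ near every point of the closed disc $|p-\bar W|\le\eta$. Let $$C_\eta=\max_{|p-\bar W|\le\eta}\ \sum_{h\in\{D_1,D_2,f,g\}}\ \sum_{k=0}^{2}\|D^kh(p)\|,$$ and let $\lambda_{\max}$ be the largest real $\lambda$ that solves, for some $\mathbf q\in(\mathbb N\cup\{0\})^d$, $$\lambda^2+\{-\bar f_u+\bar D_1q^2-\bar g_v+\bar D_2q^2\}\lambda+\{(\bar f_u-\bar D_1q^2)(\bar g_v-\bar D_2q^2)-\bar f_v\bar g_u\}=0 .$$ Let $\|\cdot\|$ be the $L^2(\mathbb T^d)$ norm and $\|\mathbf w\|_{H^2}^2=\sum_{|\alpha|\le2}(\|\partial^\alpha u\|^2+\|\partial^\alpha v\|^2)$. There is a universal constant $C_0>0$ (independent of $d$ and of all the data above) such that the following holds. Put $$C_1=C_0C_\eta(1+\eta),\qquad C_2=\frac{1}{\bar D_1^2}\Big(\frac{(\bar f_v+\bar g_u)^2}{2|\bar g_v|}+\bar f_u\Big)^3,$$ let $M>0$, and put $C_3=M^2\max\{4C_2/\lambda_{\max},1\}$. Let $\mathbf w\in C([0,T];H^2(\mathbb T^d))$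 satisfy the Neumann conditions (in the sense of traces) and solve the system on $(0,T)$ in the sense of distributions, and suppose that for $0\le t\le T$ $$\|\mathbf w(\cdot,t)\|_{H^2}\le\min\Big\{\eta,\frac{\bar D_1}{2C_0C_1},\frac{\bar D_2}{C_0C_1}\Big\}\qquad\text{and}\qquad \|\mathbf w(\cdot,t)\|\le 2M e^{\lambda_{\max}t}\|\mathbf w(\cdot,0)\| .$$ Then for $0\le t\le T$ $$\|\mathbf w(t)\|_{H^2}^2\le C_3\big\{\|\mathbf w(0)\|_{H^2}^2+e^{2\lambda_{\max}t}\|\mathbf w(\cdot,0)\|^2\big\},$$ and $C_3\ge1$ whenever $M\ge1$. -/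

import Mathlib

open MeasureTheory Set Filter Topology
open scoped ContDiff

noncomputable section

/-! ### Sobolev functions on the box `(0,π)^d` -/

/-- The box `(0,π)^d`. -/
def box (d : ℕ) : Set (Fin d → ℝ) := Set.pi Set.univ (fun _ => Set.Ioo 0 Real.pi)

/-- The classical partial derivative `∂φ/∂xᵢ` (used for smooth test functions). -/
def partialDeriv {d : ℕ} (i : Fin d) (φ : (Fin d → ℝ) → ℝ) (x : Fin d → ℝ) : ℝ :=
  fderiv ℝ φ x (Pi.single i 1)

/-- Test functions `C_c^∞((0,π)^d)`. -/
def IsTestFunction {d : ℕ} (φ : (Fin d → ℝ) → ℝ) : Prop :=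
  ContDiff ℝ ∞ φ ∧ HasCompactSupport φ ∧ tsupport φ ⊆ box d

/-- `u ∈ L²((0,π)^d)`. -/
def MemL2 {d : ℕ} (u : (Fin d → ℝ) → ℝ) : Prop :=
  MemLp u 2 (volume.restrict (box d))

/-- `g ∈ L²((0,π)^d)` is the weak (distributional) derivative `∂u/∂xᵢ` on the box. -/
def HasWeakPartial {d : ℕ} (i : Fin d) (u g : (Fin d → ℝ) → ℝ) : Prop :=
  MemL2 g ∧ ∀ φ : (Fin d → ℝ) → ℝ, IsTestFunction φ →
    ∫ x in box d, u x * partialDeriv i φ x = - ∫ x in box d, g x * φ x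

open Classical in
/-- The weak derivative `∂u/∂xᵢ` if there is one in `L²` (it is unique up to null sets). -/
def weakPartial {d : ℕ} (i : Fin d) (u : (Fin d → ℝ) → ℝ) : (Fin d → ℝ) → ℝ :=
  if h : ∃ g, HasWeakPartial i u g then Classical.choose h else 0

/-- `u ∈ H²((0,π)^d)`. -/
def MemH2 {d : ℕ} (u : (Fin d → ℝ) → ℝ) : Prop :=
  MemL2 u ∧ (∀ i, ∃ g, HasWeakPartial i u g) ∧
    ∀ i j, ∃ g, HasWeakPartial j (weakPartial i u) g

/-- The homogeneous Neumann condition `∂u/∂xᵢ = 0` at `xᵢ = 0, π`, `1 ≤ i ≤ d`, for `u ∈ H²`: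
the trace of `∂u/∂xᵢ` on the faces `xᵢ = 0, π` vanishes, that is, the integration by parts of
`∂ᵢ∂ᵢu` against functions that are smooth up to the boundary has no boundary term. -/
def NeumannBC {d : ℕ} (u : (Fin d → ℝ) → ℝ) : Prop :=
  ∀ (i : Fin d) (φ : (Fin d → ℝ) → ℝ), ContDiff ℝ ∞ φ →
    ∫ x in box d, weakPartial i (weakPartial i u) x * φ x
      = - ∫ x in box d, weakPartial i u x * partialDeriv i φ x

/-- `‖u‖²` in `L²((0,π)^d)`. -/
def l2NormSq {d : ℕ} (u : (Fin d → ℝ) → ℝ) : ℝ := ∫ x in box d, u x ^ 2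

/-- `‖u‖²_{H²} = ∑_{|α| ≤ 2} ‖∂^α u‖²` (multi-indices of order 2 are the pairs `i ≤ j`). -/
def h2NormSq {d : ℕ} (u : (Fin d → ℝ) → ℝ) : ℝ :=
  l2NormSq u + ∑ i, l2NormSq (weakPartial i u)
    + ∑ i, ∑ j ∈ Finset.Ici i, l2NormSq (weakPartial j (weakPartial i u))

/-- The `L²` norm of the vector function `[u, v]`. -/
def l2Norm {d : ℕ} (u v : (Fin d → ℝ) → ℝ) : ℝ := Real.sqrt (l2NormSq u + l2NormSq v)

/-- The `H²` norm of the vector function `[u, v]`. -/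
def h2Norm {d : ℕ} (u v : (Fin d → ℝ) → ℝ) : ℝ := Real.sqrt (h2NormSq u + h2NormSq v)

/-! ### The reaction-diffusion system -/

/-- Diffusion coefficients `D₁, D₂`, reaction terms `f, g`, and a constant state `[Ū, V̄]`. -/
structure RDSystem where
  D₁ : ℝ × ℝ → ℝ
  D₂ : ℝ × ℝ → ℝ
  f : ℝ × ℝ → ℝ
  g : ℝ × ℝ → ℝ
  Ubar : ℝ
  Vbar : ℝ

namespace RDSystem

/-- `W̄ = [Ū, V̄]`. -/
def Wbar (S : RDSystem) : ℝ × ℝ := (S.Ubar, S.Vbar)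

def Dbar₁ (S : RDSystem) : ℝ := S.D₁ S.Wbar
def Dbar₂ (S : RDSystem) : ℝ := S.D₂ S.Wbar
def fu (S : RDSystem) : ℝ := fderiv ℝ S.f S.Wbar (1, 0)
def fv (S : RDSystem) : ℝ := fderiv ℝ S.f S.Wbar (0, 1)
def gu (S : RDSystem) : ℝ := fderiv ℝ S.g S.Wbar (1, 0)
def gv (S : RDSystem) : ℝ := fderiv ℝ S.g S.Wbar (0, 1)

/-- `q² = q₁² + ⋯ + q_d²`. -/
def qSq {d : ℕ} (q : Fin d → ℕ) : ℝ := ∑ i, (q i : ℝ) ^ 2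

/-- The determinant of the linearized symbol `A - q² diag(D̄₁, D̄₂)`. -/
def symbolDet (S : RDSystem) {d : ℕ} (q : Fin d → ℕ) : ℝ :=
  (S.fu - S.Dbar₁ * qSq q) * (S.gv - S.Dbar₂ * qSq q) - S.fv * S.gu

/-- The homogeneous steady state is stable without diffusion, but some mode `q` is
linearly unstable with diffusion. -/
def TuringUnstable (S : RDSystem) (d : ℕ) : Prop :=
  S.fu + S.gv < 0 ∧ 0 < S.fu * S.gv - S.fv * S.gu ∧ ∃ q : Fin d → ℕ, S.symbolDet q < 0

/-- `λ` is a root of the dispersion formula of the mode `q`. -/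
def Dispersion (S : RDSystem) {d : ℕ} (q : Fin d → ℕ) (lam : ℝ) : Prop :=
  lam ^ 2 + (-S.fu + S.Dbar₁ * qSq q - S.gv + S.Dbar₂ * qSq q) * lam + S.symbolDet q = 0

/-- `λ_max`, the largest eigenvalue over all modes `q ∈ (ℕ ∪ {0})^d`. -/
def lamMax (S : RDSystem) (d : ℕ) : ℝ :=
  sSup {lam : ℝ | ∃ q : Fin d → ℕ, S.Dispersion q lam}

/-- The closed disc of radius `η` about `W̄`, for the Euclidean distance. -/
def disc (S : RDSystem) (η : ℝ) : Set (ℝ × ℝ) :=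
  {p | (p.1 - S.Ubar) ^ 2 + (p.2 - S.Vbar) ^ 2 ≤ η ^ 2}

/-- `D₁, D₂, f, g` are `C²` near every point of the closed disc of radius `η` about `W̄`. -/
def SmoothNear (S : RDSystem) (η : ℝ) : Prop :=
  ∀ p ∈ S.disc η, ContDiffAt ℝ 2 S.D₁ p ∧ ContDiffAt ℝ 2 S.D₂ p ∧
    ContDiffAt ℝ 2 S.f p ∧ ContDiffAt ℝ 2 S.g p

/-- The size at `p` of a function and its derivatives up to order 2. -/
def c2Size (h : ℝ × ℝ → ℝ) (p : ℝ × ℝ) : ℝ :=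
  ∑ k ∈ Finset.range 3, ‖iteratedFDeriv ℝ k h p‖

/-- `C_η`, the maximum over `|w| ≤ η` of the sum of the `C²` sizes of `D₁, D₂, f, g`
at `W̄ + w`. -/
def Ceta (S : RDSystem) (η : ℝ) : ℝ :=
  sSup ((fun p => c2Size S.D₁ p + c2Size S.D₂ p + c2Size S.f p + c2Size S.g p) '' S.disc η)

/-- `C₁ = C₀ C_η (1 + η)`. -/
def C1 (S : RDSystem) (C₀ η : ℝ) : ℝ := C₀ * S.Ceta η * (1 + η)

/-- `C₂ = ((f̄_v + ḡ_u)² / (2|ḡ_v|) + f̄_u)³ / D̄₁²`. -/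
def C2 (S : RDSystem) : ℝ :=
  ((S.fv + S.gu) ^ 2 / (2 * |S.gv|) + S.fu) ^ 3 / S.Dbar₁ ^ 2

/-- `C₃ = M² max {4 C₂ / λ_max, 1}`, where `2 M` is the constant in the `L²` growth bound. -/
def C3 (S : RDSystem) (d : ℕ) (M : ℝ) : ℝ := M ^ 2 * max (4 * S.C2 / S.lamMax d) 1

/-- `∂_t z = ∇·(D(w + W̄)∇z) + F(w + W̄)` in the sense of distributions on the box, for
`0 < t < T`, where `w = [u, v]`. -/
def SolvesEquation (S : RDSystem) {d : ℕ} (D F : ℝ × ℝ → ℝ) (T : ℝ)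
    (u v z : ℝ → (Fin d → ℝ) → ℝ) : Prop :=
  ∀ t ∈ Set.Ioo 0 T,
    (∀ i, IntegrableOn
      (fun x => D (u t x + S.Ubar, v t x + S.Vbar) * weakPartial i (z t) x) (box d)) ∧
    IntegrableOn (fun x => F (u t x + S.Ubar, v t x + S.Vbar)) (box d) ∧
    ∀ φ : (Fin d → ℝ) → ℝ, IsTestFunction φ →
      HasDerivAt (fun s => ∫ x in box d, z s x * φ x)
        (-(∑ i, ∫ x in box d,
            D (u t x + S.Ubar, v t x + S.Vbar) * weakPartial i (z t) x * partialDeriv i φ x)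
          + ∫ x in box d, F (u t x + S.Ubar, v t x + S.Vbar) * φ x) t

/-- `w = [u, v]` is an `H²` solution on `[0,T]` of the full nonlinear system
`u_t = ∇·(D₁(w + W̄)∇u) + f(w + W̄)`, `v_t = ∇·(D₂(w + W̄)∇v) + g(w + W̄)`
with Neumann boundary conditions: `w ∈ C([0,T]; H²)`. -/
def IsSolution (S : RDSystem) (d : ℕ) (T : ℝ) (u v : ℝ → (Fin d → ℝ) → ℝ) : Prop :=
  (∀ t ∈ Set.Icc 0 T, MemH2 (u t) ∧ MemH2 (v t) ∧ NeumannBC (u t) ∧ NeumannBC (v t)) ∧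
  (∀ t ∈ Set.Icc 0 T,
    Tendsto (fun s => h2Norm (u s - u t) (v s - v t)) (𝓝[Set.Icc 0 T] t) (𝓝 0)) ∧
  S.SolvesEquation S.D₁ S.f T u v u ∧ S.SolvesEquation S.D₂ S.g T u v v

end RDSystem

end

/-!
The proof is an energy estimate for the cosine coefficients of the solution. On `H²` functions with
Neumann conditions all norms involved are diagonal in the cosine basis: by Parseval's identity
(`hasSum_coef_sq`) and the formulas for the coefficients of weak derivatives, `‖u‖²_{H²}` is `π^d`
times the sum of `(1 + |k|² + ∑_{i ≤ j} kᵢ² kⱼ²) û(k)²` (`hasSum_h2NormSq`). Frequencies range over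
`ℤ^d` rather than `ℕ^d`, the coefficients being even; this makes products convolutions.

*Coefficients of the nonlinear terms.* In dimension at most three `H²` embeds into `L^∞` with
constant at most one (`sum_abs_cosCoef_sq_le`), so the values of the solution stay in the disc
where `C_η` controls `D₁, D₂, f, g`. With `r = ‖w‖_{H²} ≤ η`, the functions `Dᵢ(w + W̄) - D̄ᵢ` are
small in `H²`, hence have coefficients of small `ℓ¹` norm, both linearly in `C_η (1 + η) r`
(`SmallState.sum_normSq_sq_mul_cosCoef_sq_le`, `SmallState.sum_abs_cosCoef_comp_le`), and the
gradients of the Taylor remainders of `f` and `g` are at most `C_η r` times `∇w` in `L²`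
(`SmallState.sum_normSq_mul_taylorRem_sq_le`). These bounds are proved for the partial sums of the
cosine series, where the chain rule is classical, and passed to the limit.

*Ordinary differential equations.* The weak formulation only allows test functions with compact
support. It extends to cosine modes (`hasDerivAt_integral_mul_cosMode`) because the normal
derivative vanishes on the boundary: by a Hardy inequality the error made by a cutoff tends to zero
uniformly in time. This gives one equation for each coefficient (`hasDerivAt_cosCoef`).

*Energy inequality.* The second derivatives of a solution in `H²` have no dissipation that is known
to be finite, so the weight `|k|² + ∑_{i ≤ j} kᵢ² kⱼ²` of the energy is divided by `(1 + ε |k|²)²`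
and the frequencies are restricted to a cube; all estimates are uniform in `ε` and the size of the
cube. The nonlinear terms are dominated by the dissipation (`abs_flux_sum_le`, `abs_rem_sum_le`):
this is a convolution estimate in which the damped weight of the output frequency is controlled by
those of the input frequencies. The inhibitor is absorbed by `ḡ_v < 0` (`cross_le`), and
interpolation between the `L²` norm and the dissipation of the activator, one mode at a time,
produces `C₂` (`weight_mul_linear_le`). Thus the energy grows at a rate of at most `(4/3) C₂ ‖w‖²`
up to errors that disappear in the limit; integrating the growth bound of the `L²` norm gives
`h2NormSq_le_of_isSolution`.

*Constants.* Positive eigenvalues satisfy `λ ≤ K - D̄₁` with `K = (f̄_v + ḡ_u)² / (2 |ḡ_v|) + f̄_u`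
(`dispersion_le`), so that `λ_max ≤ C₂ / 3`; this lets the `L²` part of the norm be absorbed into
`C₃`.
-/

noncomputable section

namespace NeumannBox

variable {d : ℕ}

/-! ### Trigonometric modes on the box -/

/-- `sin (k x)` for `s = true`, `cos (k x)` for `s = false`. -/
def trig : Bool → ℤ → ℝ → ℝ
  | true, k, x => Real.sin (k * x)
  | false, k, x => Real.cos (k * x)

/-- The parity of `k ↦ trig s k x`: `-1` for the sine, `1` for the cosine. -/
def parity : Bool → ℝ
  | true => -1
  | false => 1

/-- `∏ⱼ trig (τ j) (k j) (x j)`: a product of sines (where `τ` is `true`) and cosines. Frequencies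
range over `ℤ^d`, so that products of modes are convolutions without case distinctions. -/
def mode (τ : Fin d → Bool) (k : Fin d → ℤ) (x : Fin d → ℝ) : ℝ :=
  ∏ j, trig (τ j) (k j) (x j)

/-- The coefficient `π^{-d} ∫ u · mode τ k` over the box. -/
def coef (τ : Fin d → Bool) (u : (Fin d → ℝ) → ℝ) (k : Fin d → ℤ) : ℝ :=
  (Real.pi ^ d)⁻¹ * ∫ x in box d, u x * mode τ k x

/-- The cube `[-N, N]^d` of frequencies. -/
def cube (d N : ℕ) : Finset (Fin d → ℤ) :=
  Fintype.piFinset fun _ => Finset.Icc (-(N : ℤ)) N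

/-- `∑_{k ∈ Q} α k · mode τ k`. -/
def trigPoly (τ : Fin d → Bool) (Q : Finset (Fin d → ℤ)) (α : (Fin d → ℤ) → ℝ)
    (x : Fin d → ℝ) : ℝ :=
  ∑ k ∈ Q, α k * mode τ k x

/-- The partial sum of the Fourier series of `u` over `[-N, N]^d`. -/
def proj (τ : Fin d → Bool) (N : ℕ) (u : (Fin d → ℝ) → ℝ) : (Fin d → ℝ) → ℝ :=
  trigPoly τ (cube d N) (coef τ u)

lemma mem_cube {N : ℕ} {k : Fin d → ℤ} : k ∈ cube d N ↔ ∀ j, -(N : ℤ) ≤ k j ∧ k j ≤ N := by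
  simp [cube, Fintype.mem_piFinset]

lemma cube_mono {M N : ℕ} (h : M ≤ N) : cube d M ⊆ cube d N := by
  intro k hk
  rw [mem_cube] at hk ⊢
  intro j
  have := hk j
  omega

lemma exists_subset_cube (F : Finset (Fin d → ℤ)) : ∃ N, F ⊆ cube d N := by
  refine ⟨∑ k ∈ F, ∑ j, (k j).natAbs, fun k hk => mem_cube.2 fun j => ?_⟩
  have h1 : (k j).natAbs ≤ ∑ j, (k j).natAbs :=
    Finset.single_le_sum (f := fun j => (k j).natAbs) (fun _ _ => Nat.zero_le _)
      (Finset.mem_univ j)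
  have h2 : ∑ j, (k j).natAbs ≤ ∑ k ∈ F, ∑ j, (k j).natAbs :=
    Finset.single_le_sum (f := fun k : Fin d → ℤ => ∑ j, (k j).natAbs)
      (fun _ _ => Nat.zero_le _) hk
  omega

lemma tendsto_cube : Tendsto (cube d) atTop atTop := by
  refine tendsto_atTop_finset_of_monotone (fun M N h => cube_mono h) fun k => ?_
  obtain ⟨N, hN⟩ := exists_subset_cube {k}
  exact ⟨N, hN (by simp)⟩

lemma abs_trig_le (s : Bool) (k : ℤ) (x : ℝ) : |trig s k x| ≤ 1 := by
  cases s
  · exact Real.abs_cos_le_one _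
  · exact Real.abs_sin_le_one _

lemma trig_neg (s : Bool) (k : ℤ) (x : ℝ) : trig s (-k) x = parity s * trig s k x := by
  cases s <;> simp [trig, parity]

lemma contDiff_trig (s : Bool) (k : ℤ) : ContDiff ℝ ∞ (trig s k) := by
  cases s
  · exact Real.contDiff_cos.comp (contDiff_const.mul contDiff_id)
  · exact Real.contDiff_sin.comp (contDiff_const.mul contDiff_id)

lemma hasDerivAt_trig (s : Bool) (k : ℤ) (x : ℝ) :
    HasDerivAt (trig s k) (-parity s * k * trig (!s) k x) x := by
  have h : HasDerivAt (fun x : ℝ => (k : ℝ) * x) k x := by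
    simpa using (hasDerivAt_id x).const_mul (k : ℝ)
  cases s
  · change HasDerivAt (fun x : ℝ => Real.cos (k * x)) _ x
    convert h.cos using 1
    simp only [trig, parity, Bool.not_false]
    ring
  · change HasDerivAt (fun x : ℝ => Real.sin (k * x)) _ x
    convert h.sin using 1
    simp only [trig, parity, Bool.not_true]
    ring

lemma abs_mode_le (τ : Fin d → Bool) (k : Fin d → ℤ) (x : Fin d → ℝ) : |mode τ k x| ≤ 1 := by
  rw [mode, Finset.abs_prod]
  exact Finset.prod_le_one (fun _ _ => abs_nonneg _) fun j _ => abs_trig_le _ _ _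

lemma contDiff_mode (τ : Fin d → Bool) (k : Fin d → ℤ) : ContDiff ℝ ∞ (mode τ k) := by
  unfold mode
  refine contDiff_prod fun j _ => ?_
  exact (contDiff_trig _ _).comp (contDiff_apply ℝ ℝ j)

lemma continuous_mode (τ : Fin d → Bool) (k : Fin d → ℤ) : Continuous (mode τ k) :=
  (contDiff_mode τ k).continuous

lemma hasDerivAt_update_of_differentiableAt {F : (Fin d → ℝ) → ℝ} {x : Fin d → ℝ}
    (hF : DifferentiableAt ℝ F x) (i : Fin d) :
    HasDerivAt (fun s => F (Function.update x i s)) (partialDeriv i F x) (x i) := by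
  have h := hasDerivAt_update x i (x i)
  have h2 : HasFDerivAt F (fderiv ℝ F x) (Function.update x i (x i)) := by
    simpa using hF.hasFDerivAt
  exact h2.comp_hasDerivAt (x i) h

lemma partialDeriv_mode (τ : Fin d → Bool) (k : Fin d → ℤ) (i : Fin d) (x : Fin d → ℝ) :
    partialDeriv i (mode τ k) x
      = -parity (τ i) * k i * mode (Function.update τ i (!τ i)) k x := by
  have h1 := hasDerivAt_update_of_differentiableAt
    ((contDiff_mode τ k).differentiable (by simp) x) i
  have h2 : HasDerivAt (fun s => mode τ k (Function.update x i s))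
      ((-parity (τ i) * k i * trig (!τ i) (k i) (x i)) *
        ∏ j ∈ Finset.univ.erase i, trig (τ j) (k j) (x j)) (x i) := by
    have : (fun s => mode τ k (Function.update x i s)) = fun s =>
        trig (τ i) (k i) s * ∏ j ∈ Finset.univ.erase i, trig (τ j) (k j) (x j) := by
      funext s
      rw [mode, ← Finset.mul_prod_erase _ _ (Finset.mem_univ i)]
      congr 1
      · simp
      · refine Finset.prod_congr rfl fun j hj => ?_
        rw [Function.update_of_ne (Finset.ne_of_mem_erase hj)]
    rw [this]
    exact (hasDerivAt_trig _ _ _).mul_const _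
  rw [h1.unique h2, mode, ← Finset.mul_prod_erase _ _ (Finset.mem_univ i), Function.update_self,
    mul_assoc]
  congr 2
  refine Finset.prod_congr rfl fun j hj => ?_
  rw [Function.update_of_ne (Finset.ne_of_mem_erase hj)]

lemma contDiff_trigPoly (τ : Fin d → Bool) (Q : Finset (Fin d → ℤ)) (α : (Fin d → ℤ) → ℝ) :
    ContDiff ℝ ∞ (trigPoly τ Q α) := by
  unfold trigPoly
  exact ContDiff.sum fun k _ => contDiff_const.mul (contDiff_mode τ k)

lemma partialDeriv_trigPoly (τ : Fin d → Bool) (Q : Finset (Fin d → ℤ)) (α : (Fin d → ℤ) → ℝ)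
    (i : Fin d) :
    partialDeriv i (trigPoly τ Q α)
      = trigPoly (Function.update τ i (!τ i)) Q (fun k => -parity (τ i) * k i * α k) := by
  funext x
  have hd : ∀ k, DifferentiableAt ℝ (mode τ k) x := fun k =>
    (contDiff_mode τ k).differentiable (by simp) x
  have : partialDeriv i (trigPoly τ Q α) x = ∑ k ∈ Q, α k * partialDeriv i (mode τ k) x := by
    unfold partialDeriv trigPoly
    rw [fderiv_fun_sum fun k _ => (hd k).const_mul (α k)]
    simp only [_root_.sum_apply]
    refine Finset.sum_congr rfl fun k _ => ?_
    rw [fderiv_const_mul (hd k)]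
    simp
  rw [this]
  refine Finset.sum_congr rfl fun k _ => ?_
  rw [partialDeriv_mode]
  ring

/-! ### The box as a measure space -/

lemma measurableSet_box : MeasurableSet (box d) :=
  MeasurableSet.univ_pi fun _ => measurableSet_Ioo

lemma restrict_box :
    (volume : Measure (Fin d → ℝ)).restrict (box d)
      = Measure.pi fun _ => (volume : Measure ℝ).restrict (Set.Ioo 0 Real.pi) := by
  rw [box, volume_pi, Measure.restrict_pi_pi]

lemma volume_box : volume (box d) = ENNReal.ofReal (Real.pi ^ d) := by
  rw [box, volume_pi_pi]
  simp [ENNReal.ofReal_pow Real.pi_pos.le]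

instance isFiniteMeasure_box : IsFiniteMeasure ((volume : Measure (Fin d → ℝ)).restrict (box d)) :=
  ⟨by rw [Measure.restrict_apply_univ, volume_box]; exact ENNReal.ofReal_lt_top⟩

lemma integral_box_const (c : ℝ) : ∫ _ in box d, c = Real.pi ^ d * c := by
  rw [setIntegral_const, Measure.real, volume_box, ENNReal.toReal_ofReal (by positivity),
    smul_eq_mul]

lemma integral_box_prod (f : Fin d → ℝ → ℝ) :
    ∫ x in box d, ∏ j, f j (x j) = ∏ j, ∫ s in Set.Ioo 0 Real.pi, f j s := by
  rw [restrict_box]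
  exact integral_fintype_prod_eq_prod (μ := fun _ => volume.restrict (Set.Ioo 0 Real.pi)) f

lemma memLp_of_bound {f : (Fin d → ℝ) → ℝ}
    (hf : AEStronglyMeasurable f (volume.restrict (box d))) {C : ℝ}
    (hC : ∀ᵐ x ∂(volume.restrict (box d)), |f x| ≤ C) : MemL2 f :=
  MemLp.of_bound hf C hC

/-- The closed box. -/
def cbox (d : ℕ) : Set (Fin d → ℝ) := Set.Icc 0 (fun _ => Real.pi)

lemma box_subset_cbox : box d ⊆ cbox d := by
  intro x hx
  have h := fun j => hx j (Set.mem_univ j)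
  exact ⟨fun j => (h j).1.le, fun j => (h j).2.le⟩

lemma isCompact_cbox : IsCompact (cbox d) := isCompact_Icc

lemma memL2_of_continuousOn {f : (Fin d → ℝ) → ℝ} (hf : ContinuousOn f (cbox d)) : MemL2 f := by
  obtain ⟨C, hC⟩ := isCompact_cbox.exists_bound_of_continuousOn hf
  refine memLp_of_bound (C := C)
    ((hf.mono box_subset_cbox).aestronglyMeasurable measurableSet_box) ?_
  filter_upwards [ae_restrict_mem measurableSet_box] with x hx
  exact hC x (box_subset_cbox hx)

lemma memL2_of_continuous {f : (Fin d → ℝ) → ℝ} (hf : Continuous f) : MemL2 f :=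
  memL2_of_continuousOn hf.continuousOn

lemma memL2_mode (τ : Fin d → Bool) (k : Fin d → ℤ) : MemL2 (mode τ k) :=
  memL2_of_continuous (continuous_mode τ k)

lemma memL2_trigPoly (τ : Fin d → Bool) (Q : Finset (Fin d → ℤ)) (α : (Fin d → ℤ) → ℝ) :
    MemL2 (trigPoly τ Q α) :=
  memL2_of_continuous (contDiff_trigPoly τ Q α).continuous

lemma memL2_proj (τ : Fin d → Bool) (N : ℕ) (u : (Fin d → ℝ) → ℝ) : MemL2 (proj τ N u) :=
  memL2_trigPoly _ _ _

lemma _root_.MemL2.mul_integrable {u v : (Fin d → ℝ) → ℝ} (hu : MemL2 u) (hv : MemL2 v) :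
    IntegrableOn (fun x => u x * v x) (box d) := by
  exact MemLp.integrable_mul hu hv

lemma _root_.MemL2.sq_integrable {u : (Fin d → ℝ) → ℝ} (hu : MemL2 u) :
    IntegrableOn (fun x => u x ^ 2) (box d) := MemLp.integrable_sq hu

lemma _root_.MemL2.integrableOn {u : (Fin d → ℝ) → ℝ} (hu : MemL2 u) : IntegrableOn u (box d) :=
  MemLp.integrable (by norm_num) hu

lemma l2NormSq_nonneg (u : (Fin d → ℝ) → ℝ) : 0 ≤ l2NormSq u :=
  integral_nonneg fun _ => sq_nonneg _

/-- The Cauchy–Schwarz inequality in `L²` of the box. -/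
lemma abs_integral_mul_le {u v : (Fin d → ℝ) → ℝ} (hu : MemL2 u) (hv : MemL2 v) :
    |∫ x in box d, u x * v x| ≤ Real.sqrt (l2NormSq u) * Real.sqrt (l2NormSq v) := by
  have key : ∀ t : ℝ, 0 ≤ l2NormSq v * (t * t) + 2 * (∫ x in box d, u x * v x) * t
      + l2NormSq u := by
    intro t
    have h : ∫ x in box d, (u x + t * v x) ^ 2 = l2NormSq u + 2 * t * (∫ x in box d, u x * v x)
        + t ^ 2 * l2NormSq v := by
      have e : ∀ x, (u x + t * v x) ^ 2 = u x ^ 2 + 2 * t * (u x * v x) + t ^ 2 * v x ^ 2 :=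
        fun x => by ring
      simp_rw [e]
      rw [integral_add, integral_add, integral_const_mul, integral_const_mul]
      · rfl
      · exact hu.sq_integrable
      · exact (hu.mul_integrable hv).const_mul _
      · exact hu.sq_integrable.add ((hu.mul_integrable hv).const_mul _)
      · exact hv.sq_integrable.const_mul _
    have h0 : 0 ≤ ∫ x in box d, (u x + t * v x) ^ 2 := integral_nonneg fun _ => sq_nonneg _
    rw [h] at h0
    linarith
  have hd := discrim_le_zero key
  rw [discrim] at hd
  rw [← Real.sqrt_mul (l2NormSq_nonneg u)]
  apply Real.abs_le_sqrt
  linarith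

/-! ### Orthogonality and Bessel's inequality -/

/-- The normalized Gram matrix of the modes in one variable. -/
def gram (s : Bool) (k l : ℤ) : ℝ :=
  ((if k = l then 1 else 0) + parity s * (if k = -l then 1 else 0)) / 2

lemma integral_cos_int (n : ℤ) :
    ∫ x in Set.Ioo 0 Real.pi, Real.cos (n * x) = if n = 0 then Real.pi else 0 := by
  rw [← integral_Ioc_eq_integral_Ioo, ← intervalIntegral.integral_of_le Real.pi_pos.le]
  split_ifs with h
  · simp [h]
  · have h' : (n : ℝ) ≠ 0 := by exact_mod_cast h
    rw [intervalIntegral.integral_comp_mul_left _ h']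
    simp [Real.sin_int_mul_pi]

lemma integral_trig_mul_trig (s : Bool) (k l : ℤ) :
    ∫ x in Set.Ioo 0 Real.pi, trig s k x * trig s l x = Real.pi * gram s k l := by
  have e : ∀ x, trig s k x * trig s l x
      = (Real.cos ((k - l : ℤ) * x) + parity s * Real.cos ((k + l : ℤ) * x)) / 2 := by
    intro x
    have h1 : ((k - l : ℤ) : ℝ) * x = k * x - l * x := by push_cast; ring
    have h2 : ((k + l : ℤ) : ℝ) * x = k * x + l * x := by push_cast; ring
    rw [h1, h2, Real.cos_sub, Real.cos_add]
    cases s <;> simp only [trig, parity] <;> ring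
  have hi : ∀ n : ℤ, IntegrableOn (fun x : ℝ => Real.cos (n * x)) (Set.Ioo 0 Real.pi) := by
    intro n
    have : Continuous fun x : ℝ => Real.cos (n * x) := by fun_prop
    exact (this.continuousOn.integrableOn_compact isCompact_Icc).mono_set Set.Ioo_subset_Icc_self
  simp_rw [e]
  rw [integral_div, integral_add (hi _) ((hi _).const_mul _), integral_const_mul,
    integral_cos_int, integral_cos_int, gram]
  have h1 : (k - l = 0) = (k = l) := by rw [sub_eq_zero]
  have h2 : (k + l = 0) = (k = -l) := by rw [add_eq_zero_iff_eq_neg]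
  simp only [h1, h2]
  split_ifs <;> ring

lemma integral_mode_mul_mode (τ : Fin d → Bool) (k l : Fin d → ℤ) :
    ∫ x in box d, mode τ k x * mode τ l x = Real.pi ^ d * ∏ j, gram (τ j) (k j) (l j) := by
  simp_rw [mode, ← Finset.prod_mul_distrib]
  rw [integral_box_prod fun j s => trig (τ j) (k j) s * trig (τ j) (l j) s]
  simp_rw [integral_trig_mul_trig, Finset.prod_mul_distrib]
  simp

lemma sum_trig_mul_gram (s : Bool) {N : ℕ} {l : ℤ} (hl : -(N : ℤ) ≤ l ∧ l ≤ N) (x : ℝ) :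
    ∑ k ∈ Finset.Icc (-(N : ℤ)) N, trig s k x * gram s k l = trig s l x := by
  have hl1 : l ∈ Finset.Icc (-(N : ℤ)) N := by simpa using hl
  have hl2 : -l ∈ Finset.Icc (-(N : ℤ)) N := by rw [Finset.mem_Icc]; omega
  have e : ∀ k, trig s k x * gram s k l = ((if k = l then trig s k x else 0)
      + parity s * (if k = -l then trig s k x else 0)) / 2 := by
    intro k
    rw [gram]
    split_ifs <;> ring
  simp_rw [e]
  rw [← Finset.sum_div, Finset.sum_add_distrib, ← Finset.mul_sum, Finset.sum_ite_eq' ,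
    Finset.sum_ite_eq', if_pos hl1, if_pos hl2, trig_neg]
  cases s <;> simp [parity]

/-- The Gram matrix reproduces the modes of a cube. -/
lemma sum_mode_mul_gram (τ : Fin d → Bool) {N : ℕ} {l : Fin d → ℤ} (hl : l ∈ cube d N)
    (x : Fin d → ℝ) :
    ∑ k ∈ cube d N, mode τ k x * ∏ j, gram (τ j) (k j) (l j) = mode τ l x := by
  rw [mem_cube] at hl
  simp_rw [mode, ← Finset.prod_mul_distrib, cube]
  rw [← Finset.prod_univ_sum (fun _ => Finset.Icc (-(N : ℤ)) N)
    fun j k => trig (τ j) k (x j) * gram (τ j) k (l j)]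
  exact Finset.prod_congr rfl fun j _ => sum_trig_mul_gram _ (hl j) _

lemma integral_trigPoly_mul {Q : Finset (Fin d → ℤ)} {α : (Fin d → ℤ) → ℝ}
    {u : (Fin d → ℝ) → ℝ} (hu : MemL2 u) (σ : Fin d → Bool) :
    ∫ x in box d, u x * trigPoly σ Q α x = Real.pi ^ d * ∑ k ∈ Q, α k * coef σ u k := by
  simp_rw [trigPoly, Finset.mul_sum]
  rw [integral_finsetSum]
  · refine Finset.sum_congr rfl fun k _ => ?_
    rw [coef]
    have : ∀ x, u x * (α k * mode σ k x) = α k * (u x * mode σ k x) := fun x => by ring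
    simp_rw [this, integral_const_mul]
    field_simp
  · intro k _
    exact hu.mul_integrable ((memL2_mode σ k).const_mul (α k))

lemma coef_proj {τ : Fin d → Bool} {N : ℕ} {u : (Fin d → ℝ) → ℝ} (hu : MemL2 u)
    {l : Fin d → ℤ} (hl : l ∈ cube d N) : coef τ (proj τ N u) l = coef τ u l := by
  have h1 : ∫ x in box d, proj τ N u x * mode τ l x
      = ∑ k ∈ cube d N, coef τ u k * (Real.pi ^ d * ∏ j, gram (τ j) (k j) (l j)) := by
    simp_rw [proj, trigPoly, Finset.sum_mul]
    rw [integral_finsetSum]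
    · refine Finset.sum_congr rfl fun k _ => ?_
      rw [← integral_mode_mul_mode, ← integral_const_mul]
      simp_rw [mul_assoc]
    · intro k _
      exact MemL2.mul_integrable ((memL2_mode τ k).const_mul _) (memL2_mode τ l)
  have h2 : ∫ x in box d, u x * mode τ l x
      = ∑ k ∈ cube d N, (∏ j, gram (τ j) (k j) (l j)) * ∫ x in box d, u x * mode τ k x := by
    simp_rw [← integral_const_mul]
    rw [← integral_finsetSum]
    · refine integral_congr_ae (Eventually.of_forall fun x => ?_)
      simp only
      rw [← sum_mode_mul_gram τ hl x, Finset.mul_sum]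
      exact Finset.sum_congr rfl fun k _ => by ring
    · intro k _
      exact (hu.mul_integrable (memL2_mode τ k)).const_mul _
  rw [coef, coef, h1, h2]
  congr 1
  refine Finset.sum_congr rfl fun k _ => ?_
  rw [coef]
  field_simp

/-- Projection identity: the partial sum is the best approximation among the trigonometric
polynomials with frequencies in the cube. -/
lemma integral_sub_trigPoly_sq {τ : Fin d → Bool} {N : ℕ} {u : (Fin d → ℝ) → ℝ} (hu : MemL2 u)
    (α : (Fin d → ℤ) → ℝ) :
    l2NormSq (u - trigPoly τ (cube d N) α)
      = (l2NormSq u - Real.pi ^ d * ∑ k ∈ cube d N, coef τ u k ^ 2)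
        + l2NormSq (proj τ N u - trigPoly τ (cube d N) α) := by
  set P := trigPoly τ (cube d N) α with hP
  have mP : MemL2 P := memL2_trigPoly _ _ _
  have mq : MemL2 (proj τ N u) := memL2_proj _ _ _
  have ex : ∀ {f : (Fin d → ℝ) → ℝ}, MemL2 f → l2NormSq (f - P)
      = l2NormSq f - 2 * (∫ x in box d, f x * P x) + l2NormSq P := by
    intro f hf
    have e : ∀ x, (f - P) x ^ 2 = f x ^ 2 - 2 * (f x * P x) + P x ^ 2 := fun x => by
      simp only [Pi.sub_apply]; ring
    unfold l2NormSq
    simp_rw [e]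
    rw [integral_add, integral_sub, integral_const_mul]
    · exact hf.sq_integrable
    · exact (hf.mul_integrable mP).const_mul _
    · exact hf.sq_integrable.sub ((hf.mul_integrable mP).const_mul _)
    · exact mP.sq_integrable
  have h1 : ∫ x in box d, u x * P x = ∫ x in box d, proj τ N u x * P x := by
    rw [hP, integral_trigPoly_mul hu, integral_trigPoly_mul mq]
    congr 1
    exact Finset.sum_congr rfl fun k hk => by rw [coef_proj hu hk]
  have h2 : l2NormSq (proj τ N u) = Real.pi ^ d * ∑ k ∈ cube d N, coef τ u k ^ 2 := by
    have : l2NormSq (proj τ N u) = ∫ x in box d, proj τ N u x * trigPoly τ (cube d N) (coef τ u) x := by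
      unfold l2NormSq
      simp_rw [sq]
      rfl
    rw [this, integral_trigPoly_mul mq]
    congr 1
    exact Finset.sum_congr rfl fun k hk => by rw [coef_proj hu hk, sq]
  rw [ex hu, ex mq, h1, h2]
  ring

lemma l2NormSq_sub_proj {τ : Fin d → Bool} {N : ℕ} {u : (Fin d → ℝ) → ℝ} (hu : MemL2 u) :
    l2NormSq (u - proj τ N u)
      = l2NormSq u - Real.pi ^ d * ∑ k ∈ cube d N, coef τ u k ^ 2 := by
  have h := integral_sub_trigPoly_sq (τ := τ) (N := N) hu (coef τ u)
  rw [show trigPoly τ (cube d N) (coef τ u) = proj τ N u from rfl] at h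
  rw [h]
  simp [l2NormSq]

/-- Bessel's inequality. -/
lemma sum_coef_sq_le {τ : Fin d → Bool} {u : (Fin d → ℝ) → ℝ} (hu : MemL2 u)
    (F : Finset (Fin d → ℤ)) : Real.pi ^ d * ∑ k ∈ F, coef τ u k ^ 2 ≤ l2NormSq u := by
  obtain ⟨N, hN⟩ := exists_subset_cube F
  have h1 := l2NormSq_sub_proj (τ := τ) (N := N) hu
  have h2 := l2NormSq_nonneg (u - proj τ N u)
  have h3 : ∑ k ∈ F, coef τ u k ^ 2 ≤ ∑ k ∈ cube d N, coef τ u k ^ 2 :=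
    Finset.sum_le_sum_of_subset_of_nonneg hN fun _ _ _ => sq_nonneg _
  have h4 := mul_le_mul_of_nonneg_left h3 (by positivity : 0 ≤ Real.pi ^ d)
  linarith

/-! ### Completeness of the modes and Parseval's identity -/

/-- The choices of signs `σ ∈ {1, -1}^d`. -/
def signs (d : ℕ) : Finset (Fin d → ℤ) := Fintype.piFinset fun _ => {1, -1}

lemma card_signs : (signs d).card = 2 ^ d := by
  simp [signs, Fintype.card_piFinset]

lemma cos_mul_trig (s : Bool) (p k : ℤ) (x : ℝ) :
    trig false p x * trig s k x = ∑ σ ∈ ({1, -1} : Finset ℤ), 2⁻¹ * trig s (k + σ * p) x := by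
  rw [Finset.sum_pair (by norm_num)]
  have h1 : ((k + 1 * p : ℤ) : ℝ) * x = k * x + p * x := by push_cast; ring
  have h2 : ((k + -1 * p : ℤ) : ℝ) * x = k * x - p * x := by push_cast; ring
  cases s <;> simp only [trig, h1, h2, Real.cos_sub, Real.cos_add, Real.sin_sub, Real.sin_add] <;>
    ring

/-- `∏ⱼ cos (kⱼ xⱼ)`. -/
abbrev cosMode : (Fin d → ℤ) → (Fin d → ℝ) → ℝ := mode fun _ => false

lemma cosMode_mul_mode (τ : Fin d → Bool) (p k : Fin d → ℤ) (x : Fin d → ℝ) :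
    cosMode p x * mode τ k x = ∑ σ ∈ signs d, (2 ^ d)⁻¹ * mode τ (k + σ * p) x := by
  simp_rw [cosMode, mode, ← Finset.prod_mul_distrib, cos_mul_trig, signs, Finset.prod_univ_sum]
  refine Finset.sum_congr rfl fun σ _ => ?_
  rw [Finset.prod_mul_distrib]
  simp

/-- The trigonometric polynomials of type `τ`. -/
def trigSpan (τ : Fin d → Bool) : Submodule ℝ ((Fin d → ℝ) → ℝ) :=
  Submodule.span ℝ (Set.range (mode τ))

lemma exists_eq_trigPoly {τ : Fin d → Bool} {P : (Fin d → ℝ) → ℝ} (hP : P ∈ trigSpan τ) :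
    ∃ N, ∀ M, N ≤ M → ∃ α, P = trigPoly τ (cube d M) α := by
  obtain ⟨c, rfl⟩ := Finsupp.mem_span_range_iff_exists_finsupp.1 hP
  obtain ⟨N, hN⟩ := exists_subset_cube c.support
  refine ⟨N, fun M hM => ⟨c, ?_⟩⟩
  funext x
  rw [Finsupp.sum, Finset.sum_apply, trigPoly]
  simp only [Pi.smul_apply, smul_eq_mul]
  refine Finset.sum_subset (hN.trans (cube_mono hM)) fun k _ hk => ?_
  rw [Finsupp.notMem_support_iff.1 hk, zero_mul]

lemma memL2_of_mem_trigSpan {τ : Fin d → Bool} {P : (Fin d → ℝ) → ℝ} (hP : P ∈ trigSpan τ) :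
    MemL2 P := by
  obtain ⟨N, hN⟩ := exists_eq_trigPoly hP
  obtain ⟨α, rfl⟩ := hN N le_rfl
  exact memL2_trigPoly _ _ _

lemma mul_mode_mem_trigSpan {τ : Fin d → Bool} {P : (Fin d → ℝ) → ℝ}
    (hP : P ∈ trigSpan fun _ => false) (k : Fin d → ℤ) : P * mode τ k ∈ trigSpan τ := by
  refine Submodule.span_induction (p := fun P _ => P * mode τ k ∈ trigSpan τ) ?_ ?_ ?_ ?_ hP
  · rintro _ ⟨p, rfl⟩
    have : (mode (fun _ => false) p * mode τ k : (Fin d → ℝ) → ℝ)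
        = ∑ σ ∈ signs d, ((2 : ℝ) ^ d)⁻¹ • mode τ (k + σ * p) := by
      funext x
      rw [Pi.mul_apply, cosMode_mul_mode, Finset.sum_apply]
      simp
    rw [this]
    exact Submodule.sum_mem _ fun σ _ => Submodule.smul_mem _ _ (Submodule.subset_span ⟨_, rfl⟩)
  · rw [zero_mul]; exact Submodule.zero_mem _
  · intro a b _ _ ha hb
    rw [add_mul]; exact Submodule.add_mem _ ha hb
  · intro c a _ ha
    rw [smul_mul_assoc]; exact Submodule.smul_mem _ _ ha

lemma mul_mem_trigSpan {P Q : (Fin d → ℝ) → ℝ} (hP : P ∈ trigSpan fun _ => false)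
    (hQ : Q ∈ trigSpan fun _ => false) : P * Q ∈ trigSpan fun _ => false := by
  refine Submodule.span_induction (p := fun Q _ => P * Q ∈ trigSpan fun _ => false) ?_ ?_ ?_ ?_ hQ
  · rintro _ ⟨k, rfl⟩
    exact mul_mode_mem_trigSpan hP k
  · rw [mul_zero]; exact Submodule.zero_mem _
  · intro a b _ _ ha hb
    rw [mul_add]; exact Submodule.add_mem _ ha hb
  · intro c a _ ha
    rw [mul_smul_comm]; exact Submodule.smul_mem _ _ ha

/-- The algebra of cosine polynomials, as continuous functions on the closed box. -/
def cosAlgebra (d : ℕ) : Subalgebra ℝ C(cbox d, ℝ) where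
  carrier := {f | ∃ P ∈ trigSpan (d := d) fun _ => false, ∀ x : cbox d, f x = P x}
  mul_mem' := by
    rintro f g ⟨P, hP, hf⟩ ⟨Q, hQ, hg⟩
    exact ⟨P * Q, mul_mem_trigSpan hP hQ, fun x => by simp [hf, hg]⟩
  add_mem' := by
    rintro f g ⟨P, hP, hf⟩ ⟨Q, hQ, hg⟩
    exact ⟨P + Q, Submodule.add_mem _ hP hQ, fun x => by simp [hf, hg]⟩
  algebraMap_mem' := by
    intro r
    refine ⟨r • mode (fun _ => false) 0, Submodule.smul_mem _ _ (Submodule.subset_span ⟨_, rfl⟩),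
      fun x => ?_⟩
    simp [mode, trig]

lemma cosAlgebra_separatesPoints : (cosAlgebra d).SeparatesPoints := by
  intro x y hxy
  obtain ⟨j, hj⟩ : ∃ j, x.1 j ≠ y.1 j := by
    by_contra! h
    exact hxy (Subtype.ext (funext h))
  have hm : ∀ z : Fin d → ℝ, mode (fun _ => false) (Pi.single j 1) z = Real.cos (z j) := by
    intro z
    rw [mode, Finset.prod_eq_single j]
    · simp [trig]
    · intro b _ hb
      simp [trig, Pi.single_eq_of_ne hb]
    · simp
  refine ⟨fun z => Real.cos (z.1 j), ⟨⟨fun z => Real.cos (z.1 j),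
    Real.continuous_cos.comp ((continuous_apply j).comp continuous_subtype_val)⟩,
    ⟨mode (fun _ => false) (Pi.single j 1), Submodule.subset_span ⟨_, rfl⟩, fun z => ?_⟩, rfl⟩, ?_⟩
  · rw [hm]; rfl
  · intro h
    exact hj (Real.injOn_cos ⟨x.2.1 j, x.2.2 j⟩ ⟨y.2.1 j, y.2.2 j⟩ h)

lemma _root_.MemL2.sub' {u v : (Fin d → ℝ) → ℝ} (hu : MemL2 u) (hv : MemL2 v) : MemL2 (u - v) :=
  MemLp.sub hu hv

lemma l2NormSq_sub_le {u v w : (Fin d → ℝ) → ℝ} (hu : MemL2 u) (hv : MemL2 v) (hw : MemL2 w) :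
    l2NormSq (u - w) ≤ 2 * l2NormSq (u - v) + 2 * l2NormSq (v - w) := by
  unfold l2NormSq
  rw [← integral_const_mul, ← integral_const_mul, ← integral_add]
  · refine integral_mono (hu.sub' hw).sq_integrable
      (((hu.sub' hv).sq_integrable.const_mul 2).add ((hv.sub' hw).sq_integrable.const_mul 2))
      fun x => ?_
    simp only [Pi.sub_apply]
    nlinarith [sq_nonneg ((u x - v x) - (v x - w x))]
  · exact (hu.sub' hv).sq_integrable.const_mul 2
  · exact (hv.sub' hw).sq_integrable.const_mul 2

lemma l2NormSq_le_of_bound {f : (Fin d → ℝ) → ℝ} (hf : MemL2 f) {c : ℝ}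
    (h : ∀ x ∈ box d, |f x| ≤ c) : l2NormSq f ≤ Real.pi ^ d * c ^ 2 := by
  rw [← integral_box_const]
  refine setIntegral_mono_on hf.sq_integrable (integrable_const _) measurableSet_box
    fun x hx => ?_
  rw [← sq_abs]
  have := abs_nonneg (f x)
  have := h x hx
  gcongr

/-- Cosine polynomials are dense in `L²`, by the Stone–Weierstrass theorem on the closed box. -/
lemma exists_cosPoly_near {u : (Fin d → ℝ) → ℝ} (hu : MemL2 u) {ε : ℝ} (hε : 0 < ε) :
    ∃ P ∈ trigSpan (d := d) fun _ => false, l2NormSq (u - P) ≤ ε := by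
  obtain ⟨g, -, hg, gc, gm⟩ := MemLp.exists_hasCompactSupport_integral_rpow_sub_le
    (p := 2) (by norm_num) (by simpa [MemL2] using hu) (show 0 < ε / 4 by linarith)
  have gm' : MemL2 g := memL2_of_continuous gc
  have hg' : l2NormSq (u - g) ≤ ε / 4 := by
    refine le_trans (le_of_eq ?_) hg
    refine integral_congr_ae (Eventually.of_forall fun x => ?_)
    simp
  set δ := Real.sqrt (ε / 4 / Real.pi ^ d) with hδ
  have hδ0 : 0 < δ := Real.sqrt_pos.2 (by positivity)
  have : CompactSpace (cbox d) := isCompact_iff_compactSpace.1 isCompact_cbox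
  obtain ⟨⟨h, P, hP, hPh⟩, hh⟩ :=
    ContinuousMap.exists_mem_subalgebra_near_continuous_of_separatesPoints (cosAlgebra d)
    cosAlgebra_separatesPoints (fun x => g x.1) (by fun_prop) δ hδ0
  refine ⟨P, hP, ?_⟩
  have mP := memL2_of_mem_trigSpan hP
  have h1 : l2NormSq (g - P) ≤ Real.pi ^ d * δ ^ 2 := by
    refine l2NormSq_le_of_bound (gm'.sub' mP) fun x hx => ?_
    have := hh ⟨x, box_subset_cbox hx⟩
    simp only [hPh, Real.norm_eq_abs] at this
    rw [Pi.sub_apply, abs_sub_comm]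
    exact this.le
  rw [hδ, Real.sq_sqrt (by positivity), mul_div_cancel₀ _ (by positivity)] at h1
  have := l2NormSq_sub_le hu gm' mP
  linarith

lemma mode_pos_on_box (τ : Fin d → Bool) {x : Fin d → ℝ} (hx : x ∈ box d) :
    0 < mode τ (fun j => if τ j then 1 else 0) x := by
  refine Finset.prod_pos fun j _ => ?_
  have := hx j (Set.mem_univ j)
  cases h : τ j
  · simp [trig, h]
  · simpa [trig, h] using Real.sin_pos_of_pos_of_lt_pi this.1 this.2

/-- Trigonometric polynomials of every type are dense in `L²`: `u / ∏ sin xⱼ`, cut off near the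
boundary, is approximated by a cosine polynomial. -/
lemma exists_trigPoly_near (τ : Fin d → Bool) {u : (Fin d → ℝ) → ℝ} (hu : MemL2 u) {ε : ℝ}
    (hε : 0 < ε) : ∃ P ∈ trigSpan τ, l2NormSq (u - P) ≤ ε := by
  set s : (Fin d → ℝ) → ℝ := mode τ (fun j => if τ j then 1 else 0) with hs
  have sc : Continuous s := continuous_mode _ _
  have hn0 : ∀ n : ℕ, (0 : ℝ) < 1 / ((n : ℝ) + 1) := fun n => by positivity
  let A : ℕ → Set (Fin d → ℝ) := fun n => {x | 1 / ((n : ℝ) + 1) < s x}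
  have hA : ∀ n, MeasurableSet (A n) := fun n => measurableSet_lt measurable_const sc.measurable
  have hlim : Tendsto (fun n => l2NormSq (u - (A n).indicator u)) atTop (𝓝 0) := by
    have : (0 : ℝ) = ∫ x in box d, (0 : ℝ) := by simp
    rw [this]
    refine tendsto_integral_of_dominated_convergence (fun x => u x ^ 2) ?_ hu.sq_integrable ?_ ?_
    · intro n
      exact (hu.sub' (MemLp.indicator (hA n) hu)).sq_integrable.aestronglyMeasurable
    · intro n
      refine Eventually.of_forall fun x => ?_
      by_cases h : x ∈ A n
      · simp [h]; positivity
      · simp [h]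
    · filter_upwards [ae_restrict_mem measurableSet_box] with x hx
      have hx0 := mode_pos_on_box τ hx
      have ht := (tendsto_one_div_add_atTop_nhds_zero_nat (𝕜 := ℝ)).eventually
        (gt_mem_nhds hx0)
      refine tendsto_const_nhds.congr' ?_
      filter_upwards [ht] with n hn
      have : x ∈ A n := hn
      simp [this]
  obtain ⟨n, hn⟩ := (hlim.eventually (gt_mem_nhds (show 0 < ε / 4 by linarith))).exists
  let h : (Fin d → ℝ) → ℝ := (A n).indicator fun x => u x / s x
  have mh : MemL2 h := by
    refine MemLp.of_le_mul (c := (n : ℝ) + 1) hu ?_ ?_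
    · have : AEMeasurable h (volume.restrict (box d)) :=
        (hu.1.aemeasurable.div sc.measurable.aemeasurable).indicator (hA n)
      exact this.aestronglyMeasurable
    · refine Eventually.of_forall fun x => ?_
      by_cases hx : x ∈ A n
      · have hx' : 1 / ((n : ℝ) + 1) < s x := hx
        have h0 : 0 < s x := (hn0 n).trans hx'
        have h1 : h x = u x / s x := Set.indicator_of_mem hx _
        rw [h1, norm_div, Real.norm_eq_abs (s x), abs_of_pos h0, div_le_iff₀ h0]
        rw [div_lt_iff₀ (by positivity)] at hx'
        have := norm_nonneg (u x)
        nlinarith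
      · have h1 : h x = 0 := Set.indicator_of_notMem hx _
        rw [h1, norm_zero]
        positivity
  obtain ⟨P, hP, hPh⟩ := exists_cosPoly_near mh (show 0 < ε / 4 by linarith)
  have mP := memL2_of_mem_trigSpan hP
  have hPs := mul_mode_mem_trigSpan (τ := τ) hP (fun j => if τ j then 1 else 0)
  have mPs := memL2_of_mem_trigSpan hPs
  have mI : MemL2 ((A n).indicator u) := MemLp.indicator (hA n) hu
  refine ⟨_, hPs, ?_⟩
  have h2 : l2NormSq ((A n).indicator u - P * s) ≤ l2NormSq (h - P) := by
    refine integral_mono (mI.sub' mPs).sq_integrable (mh.sub' mP).sq_integrable fun x => ?_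
    have e : ((A n).indicator u - P * s) x = (h - P) x * s x := by
      simp only [Pi.sub_apply, Pi.mul_apply, h, Set.indicator_apply]
      split_ifs with hx
      · have h0 : 0 < s x := (hn0 n).trans hx
        field_simp
      · ring
    simp only [e, mul_pow]
    have h1 : s x ^ 2 ≤ 1 := by
      rw [sq_le_one_iff_abs_le_one]; exact abs_mode_le _ _ _
    nlinarith [sq_nonneg ((h - P) x)]
  have := l2NormSq_sub_le hu mI mPs
  linarith

lemma tendsto_l2NormSq_sub_proj (τ : Fin d → Bool) {u : (Fin d → ℝ) → ℝ} (hu : MemL2 u) :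
    Tendsto (fun N => l2NormSq (u - proj τ N u)) atTop (𝓝 0) := by
  rw [Metric.tendsto_atTop]
  intro ε hε
  obtain ⟨P, hP, hPu⟩ := exists_trigPoly_near τ hu (half_pos hε)
  obtain ⟨N, hN⟩ := exists_eq_trigPoly hP
  refine ⟨N, fun M hM => ?_⟩
  obtain ⟨α, rfl⟩ := hN M hM
  have h1 := integral_sub_trigPoly_sq (τ := τ) (N := M) hu α
  rw [← l2NormSq_sub_proj hu] at h1
  have h2 := l2NormSq_nonneg (proj τ M u - trigPoly τ (cube d M) α)
  rw [Real.dist_eq, sub_zero, abs_of_nonneg (l2NormSq_nonneg _)]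
  linarith

lemma summable_coef_sq (τ : Fin d → Bool) {u : (Fin d → ℝ) → ℝ} (hu : MemL2 u) :
    Summable fun k => coef τ u k ^ 2 := by
  refine summable_of_sum_le (c := (Real.pi ^ d)⁻¹ * l2NormSq u) (fun _ => sq_nonneg _) fun F => ?_
  rw [inv_mul_eq_div, le_div_iff₀' (by positivity)]
  exact sum_coef_sq_le hu F

/-- **Parseval's identity** for the modes of type `τ`. -/
theorem hasSum_coef_sq (τ : Fin d → Bool) {u : (Fin d → ℝ) → ℝ} (hu : MemL2 u) :
    HasSum (fun k => Real.pi ^ d * coef τ u k ^ 2) (l2NormSq u) := by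
  have hs := ((summable_coef_sq τ hu).mul_left (Real.pi ^ d)).hasSum
  have h1 := hs.comp tendsto_cube
  have h2 : Tendsto ((fun F => ∑ k ∈ F, Real.pi ^ d * coef τ u k ^ 2) ∘ cube d) atTop
      (𝓝 (l2NormSq u)) := by
    have h3 := (tendsto_const_nhds (x := l2NormSq u)).sub (tendsto_l2NormSq_sub_proj τ hu)
    rw [sub_zero] at h3
    refine h3.congr fun N => ?_
    rw [l2NormSq_sub_proj hu, Function.comp_apply, ← Finset.mul_sum]
    ring
  rwa [tendsto_nhds_unique h1 h2] at hs

/-- Convergence of the partial sums of Fourier series, tested against an `L²` function. -/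
lemma tendsto_integral_proj_mul (τ : Fin d → Bool) {u g : (Fin d → ℝ) → ℝ} (hu : MemL2 u)
    (hg : MemL2 g) :
    Tendsto (fun N => ∫ x in box d, proj τ N u x * g x) atTop (𝓝 (∫ x in box d, u x * g x)) := by
  have h0 := (((Real.continuous_sqrt.tendsto _).comp (tendsto_l2NormSq_sub_proj τ hu))).mul_const
    (Real.sqrt (l2NormSq g))
  rw [Real.sqrt_zero, zero_mul] at h0
  rw [tendsto_iff_dist_tendsto_zero]
  refine squeeze_zero (fun _ => dist_nonneg) (fun N => ?_) h0
  rw [dist_comm, Real.dist_eq, ← integral_sub (hu.mul_integrable hg)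
    ((memL2_proj τ N u).mul_integrable hg)]
  have := abs_integral_mul_le (hu.sub' (memL2_proj τ N u)) hg
  simpa [sub_mul] using this

/-! ### Integration by parts and cutoff functions -/

lemma box_ae_eq_cbox : box d =ᵐ[volume] cbox d := by
  have := Measure.univ_pi_Ioo_ae_eq_Icc (μ := fun _ : Fin d => (volume : Measure ℝ))
    (f := 0) (g := fun _ => Real.pi)
  exact this

lemma continuousOn_partialDeriv {F : (Fin d → ℝ) → ℝ} {K : Set (Fin d → ℝ)} (i : Fin d)
    (hF : ∀ x ∈ K, ContDiffAt ℝ 1 F x) : ContinuousOn (partialDeriv i F) K := fun x hx =>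
  (((hF x hx).continuousAt_fderiv (by simp)).clm_apply continuousAt_const).continuousWithinAt

/-- The integral of a partial derivative `∂ᵢF` vanishes if `F` does on the faces `xᵢ = 0, π`. -/
lemma integral_partialDeriv_eq_zero {F : (Fin d → ℝ) → ℝ} (i : Fin d)
    (hF : ∀ x ∈ cbox d, ContDiffAt ℝ 1 F x)
    (h0 : ∀ x, x i = 0 ∨ x i = Real.pi → F x = 0) :
    ∫ x in box d, partialDeriv i F x = 0 := by
  rw [setIntegral_congr_set box_ae_eq_cbox]
  have hcont := continuousOn_partialDeriv i hF
  cases d with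
  | zero => exact i.elim0
  | succ n =>
    have hsum : ∀ x, ∑ j, (if j = i then fderiv ℝ F x else 0) (Pi.single j 1)
        = partialDeriv i F x := by
      intro x
      rw [Finset.sum_eq_single i]
      · simp [partialDeriv]
      · intro b _ hb; simp [hb]
      · simp
    have := integral_divergence_of_hasFDerivAt_off_countable' (E := ℝ) (n := n)
      (a := 0) (b := fun _ => Real.pi) (fun _ => Real.pi_pos.le)
      (fun j => if j = i then F else 0)
      (fun j x => if j = i then fderiv ℝ F x else 0) ∅ Set.countable_empty ?_ ?_ ?_
    · simp_rw [hsum] at this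
      rw [cbox, this]
      refine Finset.sum_eq_zero fun j _ => ?_
      by_cases hj : j = i
      · subst hj
        simp [h0]
      · simp [hj]
    · intro j
      by_cases hj : j = i
      · simp only [hj, if_true]
        exact fun x hx => (hF x hx).continuousAt.continuousWithinAt
      · simp only [hj, if_false]
        exact continuousOn_const
    · intro x hx j
      by_cases hj : j = i
      · simp only [hj, if_true]
        exact ((hF x (box_subset_cbox hx.1)).differentiableAt (by simp)).hasFDerivAt
      · simp only [hj, if_false]
        exact hasFDerivAt_const (0 : ℝ) x
    · simp_rw [hsum]
      exact hcont.integrableOn_compact isCompact_cbox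

lemma partialDeriv_mul {F G : (Fin d → ℝ) → ℝ} (i : Fin d) {x : Fin d → ℝ}
    (hF : DifferentiableAt ℝ F x) (hG : DifferentiableAt ℝ G x) :
    partialDeriv i (fun y => F y * G y) x = F x * partialDeriv i G x + partialDeriv i F x * G x := by
  rw [partialDeriv, fderiv_fun_mul hF hG]
  simp [partialDeriv]
  ring

/-- Integration by parts on the box. -/
lemma integral_mul_partialDeriv {F G : (Fin d → ℝ) → ℝ} (i : Fin d)
    (hF : ∀ x ∈ cbox d, ContDiffAt ℝ 1 F x) (hG : ∀ x ∈ cbox d, ContDiffAt ℝ 1 G x)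
    (h0 : ∀ x, x i = 0 ∨ x i = Real.pi → F x * G x = 0) :
    ∫ x in box d, F x * partialDeriv i G x = -∫ x in box d, partialDeriv i F x * G x := by
  have h := integral_partialDeriv_eq_zero (F := fun x => F x * G x) i
    (fun x hx => (hF x hx).mul (hG x hx)) h0
  have e : ∫ x in box d, partialDeriv i (fun x => F x * G x) x
      = ∫ x in box d, (F x * partialDeriv i G x + partialDeriv i F x * G x) :=
    setIntegral_congr_fun measurableSet_box fun x hx => partialDeriv_mul i
      ((hF x (box_subset_cbox hx)).differentiableAt (by simp))
      ((hG x (box_subset_cbox hx)).differentiableAt (by simp))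
  have cF : ContinuousOn F (cbox d) := fun x hx => (hF x hx).continuousAt.continuousWithinAt
  have cG : ContinuousOn G (cbox d) := fun x hx => (hG x hx).continuousAt.continuousWithinAt
  rw [e, integral_add] at h
  · linarith
  · exact (memL2_of_continuousOn cF).mul_integrable
      (memL2_of_continuousOn (continuousOn_partialDeriv i hG))
  · exact (memL2_of_continuousOn (continuousOn_partialDeriv i hF)).mul_integrable
      (memL2_of_continuousOn cG)

lemma trig_true_eq_zero (k : ℤ) {s : ℝ} (h : s = 0 ∨ s = Real.pi) : trig true k s = 0 := by
  rcases h with rfl | rfl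
  · simp [trig]
  · simp [trig, Real.sin_int_mul_pi]

lemma mode_eq_zero {τ : Fin d → Bool} (k : Fin d → ℤ) {i : Fin d} (hi : τ i = true)
    {x : Fin d → ℝ} (h : x i = 0 ∨ x i = Real.pi) : mode τ k x = 0 :=
  Finset.prod_eq_zero (Finset.mem_univ i) (by rw [hi]; exact trig_true_eq_zero _ h)

lemma trigPoly_eq_zero {τ : Fin d → Bool} (Q : Finset (Fin d → ℤ)) (α : (Fin d → ℤ) → ℝ)
    {i : Fin d} (hi : τ i = true) {x : Fin d → ℝ} (h : x i = 0 ∨ x i = Real.pi) :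
    trigPoly τ Q α x = 0 :=
  Finset.sum_eq_zero fun k _ => by rw [mode_eq_zero k hi h, mul_zero]

/-- A smooth cutoff on `(0, π)`: it vanishes where `n s (π - s) ≤ 1` and is `1` where
`n s (π - s) ≥ 2`. -/
def bump (n : ℕ) (s : ℝ) : ℝ := Real.smoothTransition (n * (s * (Real.pi - s)) - 1)

/-- The product of the one-dimensional cutoffs. -/
def cutoff (n : ℕ) (x : Fin d → ℝ) : ℝ := ∏ j, bump n (x j)

lemma contDiff_bump (n : ℕ) : ContDiff ℝ ∞ (bump n) :=
  Real.smoothTransition.contDiff.comp (by fun_prop)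

lemma bump_nonneg (n : ℕ) (s : ℝ) : 0 ≤ bump n s := Real.smoothTransition.nonneg _

lemma bump_le_one (n : ℕ) (s : ℝ) : bump n s ≤ 1 := Real.smoothTransition.le_one _

lemma cutoff_nonneg (n : ℕ) (x : Fin d → ℝ) : 0 ≤ cutoff n x :=
  Finset.prod_nonneg fun _ _ => bump_nonneg _ _

lemma cutoff_le_one (n : ℕ) (x : Fin d → ℝ) : cutoff n x ≤ 1 :=
  Finset.prod_le_one (fun _ _ => bump_nonneg _ _) fun _ _ => bump_le_one _ _

lemma contDiff_cutoff (n : ℕ) : ContDiff ℝ ∞ (cutoff (d := d) n) := by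
  unfold cutoff
  exact contDiff_prod fun j _ => (contDiff_bump n).comp (contDiff_apply ℝ ℝ j)

lemma exists_deriv_smoothTransition_bound :
    ∃ B, 0 < B ∧ ∀ s, |deriv Real.smoothTransition s| ≤ B := by
  have hc : Continuous (deriv Real.smoothTransition) :=
    (Real.smoothTransition.contDiff (n := 1)).continuous_deriv (by simp)
  obtain ⟨B, hB⟩ := (isCompact_Icc (a := (0 : ℝ)) (b := 1)).exists_bound_of_continuousOn
    hc.continuousOn
  refine ⟨max B 1, by positivity, fun s => ?_⟩
  rcases lt_or_ge s 0 with h | h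
  · have : Real.smoothTransition =ᶠ[𝓝 s] fun _ => 0 := by
      filter_upwards [gt_mem_nhds h] with r hr
      exact Real.smoothTransition.zero_of_nonpos hr.le
    rw [this.deriv_eq]
    simp
  rcases lt_or_ge 1 s with h1 | h1
  · have : Real.smoothTransition =ᶠ[𝓝 s] fun _ => 1 := by
      filter_upwards [lt_mem_nhds h1] with r hr
      exact Real.smoothTransition.one_of_one_le hr.le
    rw [this.deriv_eq]
    simp
  · exact (hB s ⟨h, h1⟩).trans (le_max_left _ _)

/-- A bound for the derivative of `Real.smoothTransition`. -/
def transBound : ℝ := Classical.choose exists_deriv_smoothTransition_bound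

lemma transBound_pos : 0 < transBound :=
  (Classical.choose_spec exists_deriv_smoothTransition_bound).1

lemma abs_deriv_bump_le (n : ℕ) {s : ℝ} (hs : s ∈ Set.Ioo 0 Real.pi) :
    |deriv (bump n) s| ≤ n * Real.pi * transBound := by
  have h1 : HasDerivAt (fun s : ℝ => n * (s * (Real.pi - s)) - 1) (n * (Real.pi - 2 * s)) s := by
    have := ((((hasDerivAt_id' s).mul ((hasDerivAt_id' s).const_sub Real.pi)).const_mul
      (n : ℝ)).sub_const 1)
    refine this.congr_deriv ?_
    ring
  have h2 : HasDerivAt (bump n) (deriv Real.smoothTransition (n * (s * (Real.pi - s)) - 1)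
      * (n * (Real.pi - 2 * s))) s :=
    HasDerivAt.comp s (h₂ := Real.smoothTransition)
      (((Real.smoothTransition.contDiff (n := 1)).differentiable (by simp) _).hasDerivAt) h1
  rw [h2.deriv, abs_mul, abs_mul]
  have h3 : |Real.pi - 2 * s| ≤ Real.pi := by
    rw [abs_le]; constructor <;> linarith [hs.1, hs.2]
  have h4 := (Classical.choose_spec exists_deriv_smoothTransition_bound).2
    (n * (s * (Real.pi - s)) - 1)
  calc _ ≤ transBound * (|(n : ℝ)| * Real.pi) := by
        gcongr
        exact transBound_pos.le
        exact h4
    _ = _ := by rw [abs_of_nonneg (by positivity)]; ring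

lemma deriv_bump_eq_zero (n : ℕ) {s : ℝ} (h : 2 < n * (s * (Real.pi - s))) :
    deriv (bump n) s = 0 := by
  have hc : Continuous fun s : ℝ => (n : ℝ) * (s * (Real.pi - s)) := by fun_prop
  have : bump n =ᶠ[𝓝 s] fun _ => 1 := by
    filter_upwards [hc.continuousAt.eventually (lt_mem_nhds h)] with r hr
    exact Real.smoothTransition.one_of_one_le (by linarith)
  rw [this.deriv_eq]
  simp

lemma mul_abs_deriv_bump_le (n : ℕ) {s : ℝ} (hs : s ∈ Set.Ioo 0 Real.pi) :
    s * (Real.pi - s) * |deriv (bump n) s| ≤ 2 * Real.pi * transBound := by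
  have hy : 0 < s * (Real.pi - s) := mul_pos hs.1 (by linarith [hs.2])
  have hB := transBound_pos
  rcases lt_or_ge 2 (n * (s * (Real.pi - s))) with h | h
  · rw [deriv_bump_eq_zero n h]
    simp; positivity
  · calc _ ≤ s * (Real.pi - s) * (n * Real.pi * transBound) := by
          gcongr; exact abs_deriv_bump_le n hs
      _ = (n * (s * (Real.pi - s))) * (Real.pi * transBound) := by ring
      _ ≤ 2 * (Real.pi * transBound) := by gcongr
      _ = _ := by ring

lemma tendsto_nat_mul_atTop {y : ℝ} (hy : 0 < y) :
    Tendsto (fun n : ℕ => (n : ℝ) * y) atTop atTop :=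
  tendsto_natCast_atTop_atTop.atTop_mul_const hy

lemma eventually_deriv_bump_eq_zero {s : ℝ} (hs : s ∈ Set.Ioo 0 Real.pi) :
    ∀ᶠ n : ℕ in atTop, deriv (bump n) s = 0 := by
  have hy : 0 < s * (Real.pi - s) := mul_pos hs.1 (by linarith [hs.2])
  filter_upwards [(tendsto_nat_mul_atTop hy).eventually_gt_atTop 2] with n hn
  exact deriv_bump_eq_zero n hn

lemma tendsto_cutoff {x : Fin d → ℝ} (hx : x ∈ box d) :
    Tendsto (fun n => cutoff n x) atTop (𝓝 1) := by
  have h : ∀ᶠ n : ℕ in atTop, ∀ j, bump n (x j) = 1 := by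
    rw [eventually_all]
    intro j
    have hs := hx j (Set.mem_univ j)
    have hy : 0 < x j * (Real.pi - x j) := mul_pos hs.1 (by linarith [hs.2])
    filter_upwards [(tendsto_nat_mul_atTop hy).eventually_gt_atTop 2] with n hn
    exact Real.smoothTransition.one_of_one_le (by linarith)
  refine tendsto_const_nhds.congr' ?_
  filter_upwards [h] with n hn
  simp [cutoff, hn]

lemma partialDeriv_cutoff (n : ℕ) (i : Fin d) (x : Fin d → ℝ) :
    partialDeriv i (cutoff n) x
      = deriv (bump n) (x i) * ∏ j ∈ Finset.univ.erase i, bump n (x j) := by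
  have h1 := hasDerivAt_update_of_differentiableAt
    ((contDiff_cutoff n).differentiable (by simp) x) i
  have h2 : HasDerivAt (fun s => cutoff n (Function.update x i s))
      (deriv (bump n) (x i) * ∏ j ∈ Finset.univ.erase i, bump n (x j)) (x i) := by
    have : (fun s => cutoff n (Function.update x i s)) = fun s =>
        bump n s * ∏ j ∈ Finset.univ.erase i, bump n (x j) := by
      funext s
      rw [cutoff, ← Finset.mul_prod_erase _ _ (Finset.mem_univ i)]
      congr 1
      · simp
      · refine Finset.prod_congr rfl fun j hj => ?_
        rw [Function.update_of_ne (Finset.ne_of_mem_erase hj)]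
    rw [this]
    exact (((contDiff_bump n).differentiable (by simp) _).hasDerivAt).mul_const _
  exact h1.unique h2

lemma abs_partialDeriv_cutoff_le (n : ℕ) (i : Fin d) (x : Fin d → ℝ) :
    |partialDeriv i (cutoff n) x| ≤ |deriv (bump n) (x i)| := by
  rw [partialDeriv_cutoff, abs_mul, Finset.abs_prod]
  refine mul_le_of_le_one_right (abs_nonneg _) (Finset.prod_le_one (fun _ _ => abs_nonneg _) ?_)
  intro j _
  rw [abs_of_nonneg (bump_nonneg _ _)]
  exact bump_le_one _ _

lemma isTestFunction_cutoff_mul (n : ℕ) {φ : (Fin d → ℝ) → ℝ} (hφ : ContDiff ℝ ∞ φ) :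
    IsTestFunction fun x => cutoff n x * φ x := by
  let K : Set (Fin d → ℝ) := {x | ∀ j, 1 ≤ n * (x j * (Real.pi - x j))}
  have hK : IsClosed K := by
    simp only [K, Set.ofPred_forall]
    exact isClosed_iInter fun j => isClosed_le continuous_const (by fun_prop)
  have hKb : K ⊆ box d := by
    intro x hx j _
    have h := hx j
    have h1 : 0 < x j * (Real.pi - x j) := by
      by_contra! h2
      have : (n : ℝ) * (x j * (Real.pi - x j)) ≤ 0 :=
        mul_nonpos_of_nonneg_of_nonpos (by positivity) h2
      linarith
    rcases pos_and_pos_or_neg_and_neg_of_mul_pos h1 with ⟨h2, h3⟩ | ⟨h2, h3⟩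
    · exact ⟨h2, by linarith⟩
    · linarith [Real.pi_pos]
  have hs : tsupport (fun x => cutoff n x * φ x) ⊆ K := by
    refine closure_minimal (fun x hx j => ?_) hK
    by_contra! h
    apply hx
    have : cutoff n x = 0 := Finset.prod_eq_zero (Finset.mem_univ j)
      (Real.smoothTransition.zero_of_nonpos (by linarith))
    simp [this]
  refine ⟨(contDiff_cutoff n).mul hφ, ?_, hs.trans hKb⟩
  exact isCompact_cbox.of_isClosed_subset (isClosed_tsupport _)
    (hs.trans (hKb.trans box_subset_cbox))

lemma abs_sin_int_mul_le (k : ℤ) {s : ℝ} (hs : s ∈ Set.Ioo 0 Real.pi) :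
    |Real.sin (k * s)| ≤ |(k : ℝ)| * (s * (Real.pi - s)) := by
  have h1 : |Real.sin (k * s)| ≤ |(k : ℝ)| * s := by
    refine Real.abs_sin_le_abs.trans ?_
    rw [abs_mul, abs_of_pos hs.1]
  have h2 : |Real.sin (k * s)| ≤ |(k : ℝ)| * (Real.pi - s) := by
    have e : (k : ℝ) * s = k * Real.pi - k * (Real.pi - s) := by ring
    rw [e, Real.sin_int_mul_pi_sub, abs_neg, abs_mul, abs_zpow, abs_neg, abs_one, one_zpow,
      one_mul]
    refine Real.abs_sin_le_abs.trans ?_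
    rw [abs_mul, abs_of_pos (show 0 < Real.pi - s by linarith [hs.2])]
  have hk := abs_nonneg (k : ℝ)
  have hp := Real.pi_gt_three
  rcases le_total s (Real.pi / 2) with h | h
  · refine h1.trans (mul_le_mul_of_nonneg_left ?_ hk)
    nlinarith [hs.1]
  · refine h2.trans (mul_le_mul_of_nonneg_left ?_ hk)
    nlinarith [hs.2]

/-! ### Fourier coefficients of weak derivatives -/

lemma hasWeakPartial_weakPartial {i : Fin d} {u : (Fin d → ℝ) → ℝ}
    (h : ∃ g, HasWeakPartial i u g) : HasWeakPartial i u (weakPartial i u) := by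
  rw [weakPartial, dif_pos h]
  exact Classical.choose_spec h

/-- A weak derivative `∂ᵢu` may be tested against modes that are sines in `xᵢ`: these vanish on
the faces `xᵢ = 0, π`, so that no boundary condition on `u` is needed. -/
lemma _root_.HasWeakPartial.integral_mul_partialDeriv_mode {i : Fin d} {u g : (Fin d → ℝ) → ℝ}
    (hu : MemL2 u) (h : HasWeakPartial i u g) {τ : Fin d → Bool} (hτ : τ i = true)
    (k : Fin d → ℤ) :
    ∫ x in box d, u x * partialDeriv i (mode τ k) x = -∫ x in box d, g x * mode τ k x := by
  have hm := contDiff_mode τ k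
  have cm : Continuous (partialDeriv i (mode τ k)) :=
    (hm.continuous_fderiv (by simp)).clm_apply continuous_const
  have hL : Tendsto (fun n => ∫ x in box d, u x * partialDeriv i (fun y => cutoff n y * mode τ k y) x)
      atTop (𝓝 (∫ x in box d, u x * partialDeriv i (mode τ k) x)) := by
    obtain ⟨C, hC⟩ := (isCompact_cbox (d := d)).exists_bound_of_continuousOn cm.continuousOn
    refine tendsto_integral_of_dominated_convergence
      (fun x => |u x| * (C + |(k i : ℝ)| * (2 * Real.pi * transBound))) ?_ ?_ ?_ ?_
    · intro n
      exact (hu.mul_integrable (memL2_of_continuous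
        ((((contDiff_cutoff n).mul hm).continuous_fderiv (by simp)).clm_apply
          continuous_const))).aestronglyMeasurable
    · exact hu.integrableOn.abs.mul_const _
    · intro n
      filter_upwards [ae_restrict_mem measurableSet_box] with x hx
      have hs := hx i (Set.mem_univ i)
      rw [partialDeriv_mul i ((contDiff_cutoff n).differentiable (by simp) x)
        (hm.differentiable (by simp) x), norm_mul, Real.norm_eq_abs, Real.norm_eq_abs]
      refine mul_le_mul_of_nonneg_left ((abs_add_le _ _).trans (add_le_add ?_ ?_)) (abs_nonneg _)
      · rw [abs_mul, abs_of_nonneg (cutoff_nonneg n x)]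
        exact (mul_le_of_le_one_left (abs_nonneg _) (cutoff_le_one n x)).trans
          (hC x (box_subset_cbox hx))
      · have h1 : |mode τ k x| ≤ |(k i : ℝ)| * (x i * (Real.pi - x i)) := by
          rw [mode, ← Finset.mul_prod_erase _ _ (Finset.mem_univ i), abs_mul, Finset.abs_prod, hτ]
          refine (mul_le_of_le_one_right (abs_nonneg _) (Finset.prod_le_one
            (fun _ _ => abs_nonneg _) fun j _ => abs_trig_le _ _ _)).trans ?_
          exact abs_sin_int_mul_le _ hs
        rw [abs_mul]
        calc _ ≤ |deriv (bump n) (x i)| * (|(k i : ℝ)| * (x i * (Real.pi - x i))) := by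
              exact mul_le_mul (abs_partialDeriv_cutoff_le n i x) h1 (abs_nonneg _) (abs_nonneg _)
          _ = |(k i : ℝ)| * (x i * (Real.pi - x i) * |deriv (bump n) (x i)|) := by ring
          _ ≤ _ := mul_le_mul_of_nonneg_left (mul_abs_deriv_bump_le n hs) (abs_nonneg _)
    · filter_upwards [ae_restrict_mem measurableSet_box] with x hx
      refine Tendsto.const_mul _ ?_
      have h1 := (tendsto_cutoff hx).mul_const (partialDeriv i (mode τ k) x)
      rw [one_mul] at h1
      refine h1.congr' ?_
      filter_upwards [eventually_deriv_bump_eq_zero (hx i (Set.mem_univ i))] with n hn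
      rw [partialDeriv_mul i ((contDiff_cutoff n).differentiable (by simp) x)
        (hm.differentiable (by simp) x), partialDeriv_cutoff, hn]
      ring
  have hR : Tendsto (fun n => -∫ x in box d, g x * (cutoff n x * mode τ k x))
      atTop (𝓝 (-∫ x in box d, g x * mode τ k x)) := by
    refine Tendsto.neg (tendsto_integral_of_dominated_convergence (fun x => |g x|) ?_ ?_ ?_ ?_)
    · intro n
      exact (h.1.mul_integrable (memL2_of_continuous
        ((contDiff_cutoff n).mul hm).continuous)).aestronglyMeasurable
    · exact h.1.integrableOn.abs
    · intro n
      refine Eventually.of_forall fun x => ?_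
      rw [norm_mul, norm_mul, Real.norm_eq_abs, Real.norm_eq_abs, Real.norm_eq_abs,
        abs_of_nonneg (cutoff_nonneg n x)]
      refine mul_le_of_le_one_right (abs_nonneg _) (mul_le_one₀ (cutoff_le_one n x)
        (abs_nonneg _) (abs_mode_le _ _ _))
    · filter_upwards [ae_restrict_mem measurableSet_box] with x hx
      have h1 := ((tendsto_cutoff hx).mul_const (mode τ k x)).const_mul (g x)
      rwa [one_mul] at h1
  refine tendsto_nhds_unique hL (hR.congr fun n => ?_)
  rw [h.2 _ (isTestFunction_cutoff_mul n hm)]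

lemma _root_.HasWeakPartial.coef_eq {i : Fin d} {u g : (Fin d → ℝ) → ℝ}
    (hu : MemL2 u) (h : HasWeakPartial i u g) {τ : Fin d → Bool} (hτ : τ i = true)
    (k : Fin d → ℤ) : coef τ g k = -(k i * coef (Function.update τ i false) u k) := by
  have h1 := h.integral_mul_partialDeriv_mode hu hτ k
  simp_rw [partialDeriv_mode, hτ] at h1
  have h2 : ∀ x, u x * (-parity true * (k i : ℝ) * mode (Function.update τ i (!true)) k x)
      = k i * (u x * mode (Function.update τ i false) k x) := fun x => by
    simp only [parity, Bool.not_true]; ring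
  simp_rw [h2, integral_const_mul] at h1
  rw [coef, coef]
  linear_combination (Real.pi ^ d)⁻¹ * h1

/-- The coefficients with respect to products of cosines. -/
abbrev cosCoef : ((Fin d → ℝ) → ℝ) → (Fin d → ℤ) → ℝ := coef fun _ => false

/-- The type of the modes of `∂ᵢu`: a sine in `xᵢ`, cosines in the other variables. -/
abbrev sinAt (i : Fin d) : Fin d → Bool := Function.update (fun _ => false) i true

lemma memL2_weakPartial {u : (Fin d → ℝ) → ℝ} (hu : MemH2 u) (i : Fin d) :
    MemL2 (weakPartial i u) := (hasWeakPartial_weakPartial (hu.2.1 i)).1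

lemma memL2_weakPartial₂ {u : (Fin d → ℝ) → ℝ} (hu : MemH2 u) (i j : Fin d) :
    MemL2 (weakPartial j (weakPartial i u)) := (hasWeakPartial_weakPartial (hu.2.2 i j)).1

lemma coef_weakPartial {u : (Fin d → ℝ) → ℝ} (hu : MemH2 u) (i : Fin d) (k : Fin d → ℤ) :
    coef (sinAt i) (weakPartial i u) k = -(k i * cosCoef u k) := by
  rw [(hasWeakPartial_weakPartial (hu.2.1 i)).coef_eq hu.1 (by simp)]
  simp [sinAt]

lemma coef_weakPartial₂ {u : (Fin d → ℝ) → ℝ} (hu : MemH2 u) {i j : Fin d} (hij : i ≠ j)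
    (k : Fin d → ℤ) :
    coef (Function.update (sinAt i) j true) (weakPartial j (weakPartial i u)) k
      = k i * k j * cosCoef u k := by
  rw [(hasWeakPartial_weakPartial (hu.2.2 i j)).coef_eq (memL2_weakPartial hu i) (by simp)]
  have : Function.update (Function.update (sinAt i) j true) j false = sinAt i := by
    rw [Function.update_idem]
    refine Function.update_eq_self_iff.2 ?_
    rw [sinAt, Function.update_of_ne hij.symm]
  rw [this, coef_weakPartial hu]
  ring

/-- For the pure second derivatives the Neumann condition enters: `∂ᵢ∂ᵢu` is tested against
cosines, which do not vanish on the boundary. -/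
lemma coef_weakPartial_self {u : (Fin d → ℝ) → ℝ} (hu : MemH2 u) (hn : NeumannBC u) (i : Fin d)
    (k : Fin d → ℤ) : cosCoef (weakPartial i (weakPartial i u)) k = -(k i ^ 2 * cosCoef u k) := by
  have h := hn i (mode (fun _ => false) k) (contDiff_mode _ _)
  simp_rw [partialDeriv_mode] at h
  have h2 : ∀ x, weakPartial i u x *
        (-parity false * (k i : ℝ) * mode (Function.update (fun _ => false) i (!false)) k x)
      = -k i * (weakPartial i u x * mode (sinAt i) k x) := fun x => by
    simp only [parity, Bool.not_false]; ring
  simp_rw [h2, integral_const_mul] at h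
  have h3 := coef_weakPartial hu i k
  rw [coef] at h3
  rw [cosCoef, coef, h]
  linear_combination (k i : ℝ) * h3

/-- `∑_{i ≤ j} kᵢ² kⱼ²`, the symbol of the second derivatives in the squared `H²` norm. -/
def quartic (k : Fin d → ℤ) : ℝ := ∑ i, ∑ j ∈ Finset.Ici i, (k i : ℝ) ^ 2 * (k j : ℝ) ^ 2

/-- `|k|²`, the symbol of the first derivatives in the squared `H²` norm. -/
def normSq (k : Fin d → ℤ) : ℝ := ∑ i, (k i : ℝ) ^ 2

lemma hasSum_l2NormSq_weakPartial {u : (Fin d → ℝ) → ℝ} (hu : MemH2 u) (i : Fin d) :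
    HasSum (fun k => Real.pi ^ d * ((k i : ℝ) ^ 2 * cosCoef u k ^ 2))
      (l2NormSq (weakPartial i u)) := by
  have h := hasSum_coef_sq (sinAt i) (memL2_weakPartial hu i)
  simp_rw [coef_weakPartial hu, neg_sq, mul_pow] at h
  exact h

lemma hasSum_l2NormSq_weakPartial₂ {u : (Fin d → ℝ) → ℝ} (hu : MemH2 u) (hn : NeumannBC u)
    (i j : Fin d) :
    HasSum (fun k => Real.pi ^ d * ((k i : ℝ) ^ 2 * (k j : ℝ) ^ 2 * cosCoef u k ^ 2))
      (l2NormSq (weakPartial j (weakPartial i u))) := by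
  rcases eq_or_ne i j with rfl | hij
  · have h := hasSum_coef_sq (fun _ => false) (memL2_weakPartial₂ hu i i)
    refine h.congr_fun ?_
    intro k
    have := coef_weakPartial_self hu hn i k
    rw [cosCoef] at this
    rw [this]
    ring
  · have h := hasSum_coef_sq (Function.update (sinAt i) j true) (memL2_weakPartial₂ hu i j)
    simp_rw [coef_weakPartial₂ hu hij, mul_pow] at h
    exact h

/-- The `H²` norm in terms of cosine coefficients. -/
theorem hasSum_h2NormSq {u : (Fin d → ℝ) → ℝ} (hu : MemH2 u) (hn : NeumannBC u) :
    HasSum (fun k => Real.pi ^ d * ((1 + normSq k + quartic k) * cosCoef u k ^ 2))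
      (h2NormSq u) := by
  have h := ((hasSum_coef_sq (fun _ => false) hu.1).add
    (hasSum_sum fun i (_ : i ∈ Finset.univ) => hasSum_l2NormSq_weakPartial hu i)).add
    (hasSum_sum fun i (_ : i ∈ Finset.univ) => hasSum_sum
      fun j (_ : j ∈ Finset.Ici i) => hasSum_l2NormSq_weakPartial₂ hu hn i j)
  refine h.congr_fun ?_
  intro k
  simp only [← Finset.mul_sum, ← Finset.sum_mul, normSq, quartic]
  ring

/-! ### The Sobolev embedding with constant one -/

lemma normSq_nonneg (k : Fin d → ℤ) : 0 ≤ normSq k := Finset.sum_nonneg fun _ _ => sq_nonneg _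

lemma quartic_nonneg (k : Fin d → ℤ) : 0 ≤ quartic k :=
  Finset.sum_nonneg fun _ _ => Finset.sum_nonneg fun _ _ => by positivity

lemma sq_le_normSq (k : Fin d → ℤ) (i : Fin d) : (k i : ℝ) ^ 2 ≤ normSq k :=
  Finset.single_le_sum (f := fun i => (k i : ℝ) ^ 2) (fun _ _ => sq_nonneg _) (Finset.mem_univ i)

lemma one_le_normSq {k : Fin d → ℤ} (hk : k ≠ 0) : 1 ≤ normSq k := by
  obtain ⟨i, hi⟩ := Function.ne_iff.1 hk
  refine le_trans ?_ (sq_le_normSq k i)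
  have : 1 ≤ (k i) ^ 2 := by
    have := sq_pos_of_ne_zero (a := k i) (by simpa using hi)
    omega
  exact_mod_cast this

lemma normSq_sq_eq (k : Fin d → ℤ) :
    normSq k ^ 2 = ∑ i, ∑ j, (k i : ℝ) ^ 2 * (k j : ℝ) ^ 2 := by
  rw [sq, normSq, Finset.sum_mul_sum]

lemma quartic_le (k : Fin d → ℤ) : quartic k ≤ normSq k ^ 2 := by
  rw [normSq_sq_eq]
  exact Finset.sum_le_sum fun i _ => Finset.sum_le_sum_of_subset_of_nonneg
    (Finset.subset_univ _) fun _ _ _ => by positivity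

lemma normSq_sq_le (k : Fin d → ℤ) : normSq k ^ 2 ≤ 2 * quartic k := by
  have h1 : normSq k ^ 2 = quartic k + ∑ i, ∑ j ∈ Finset.Iio i, (k i : ℝ) ^ 2 * (k j : ℝ) ^ 2 := by
    rw [normSq_sq_eq, quartic, ← Finset.sum_add_distrib]
    refine Finset.sum_congr rfl fun i _ => ?_
    rw [← Finset.sum_filter_add_sum_filter_not Finset.univ (fun j => i ≤ j)]
    congr 1
    · refine Finset.sum_congr ?_ fun _ _ => rfl
      ext j; simp
    · refine Finset.sum_congr ?_ fun _ _ => rfl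
      ext j; simp
  have h2 : ∑ i, ∑ j ∈ Finset.Iio i, (k i : ℝ) ^ 2 * (k j : ℝ) ^ 2
      = ∑ j, ∑ i ∈ Finset.Ioi j, (k i : ℝ) ^ 2 * (k j : ℝ) ^ 2 :=
    Finset.sum_comm' (by simp)
  have h3 : ∑ j, ∑ i ∈ Finset.Ioi j, (k i : ℝ) ^ 2 * (k j : ℝ) ^ 2 ≤ quartic k := by
    refine Finset.sum_le_sum fun j _ => ?_
    simp_rw [mul_comm _ ((k j : ℝ) ^ 2)]
    exact Finset.sum_le_sum_of_subset_of_nonneg Finset.Ioi_subset_Ici_self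
      fun _ _ _ => by positivity
  linarith

lemma pow_four_le_quartic (k : Fin d → ℤ) (i : Fin d) : (k i : ℝ) ^ 4 ≤ quartic k := by
  have h1 : (k i : ℝ) ^ 2 * (k i : ℝ) ^ 2 ≤ ∑ j ∈ Finset.Ici i, (k i : ℝ) ^ 2 * (k j : ℝ) ^ 2 :=
    Finset.single_le_sum (f := fun j => (k i : ℝ) ^ 2 * (k j : ℝ) ^ 2)
      (fun _ _ => by positivity) (by simp)
  have h2 : ∑ j ∈ Finset.Ici i, (k i : ℝ) ^ 2 * (k j : ℝ) ^ 2 ≤ quartic k :=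
    Finset.single_le_sum (f := fun i => ∑ j ∈ Finset.Ici i, (k i : ℝ) ^ 2 * (k j : ℝ) ^ 2)
      (fun _ _ => Finset.sum_nonneg fun _ _ => by positivity) (Finset.mem_univ i)
  calc (k i : ℝ) ^ 4 = (k i : ℝ) ^ 2 * (k i : ℝ) ^ 2 := by ring
    _ ≤ _ := h1.trans h2

/-- The symbol of the squared `H²` norm. -/
def h2Symbol (k : Fin d → ℤ) : ℝ := 1 + normSq k + quartic k

lemma one_le_h2Symbol (k : Fin d → ℤ) : 1 ≤ h2Symbol k := by
  have := normSq_nonneg k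
  have := quartic_nonneg k
  rw [h2Symbol]; linarith

lemma h2Symbol_pos (k : Fin d → ℤ) : 0 < h2Symbol k := by linarith [one_le_h2Symbol k]

lemma card_cube (N : ℕ) : (cube d N).card = (2 * N + 1) ^ d := by
  rw [cube, Fintype.card_piFinset]
  simp only [Int.card_Icc, Finset.prod_const, Finset.card_univ, Fintype.card_fin]
  congr 1
  omega

/-- On the shell `max |kᵢ| = N + 1` the symbol is at least its value at a point of the shell on a
coordinate axis. -/
lemma sum_cube_succ_le (N : ℕ) :
    ∑ k ∈ cube d (N + 1), (h2Symbol k)⁻¹ ≤ ∑ k ∈ cube d N, (h2Symbol k)⁻¹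
      + ((2 * N + 3 : ℝ) ^ d - (2 * N + 1) ^ d) / (1 + (N + 1) ^ 2 + (N + 1) ^ 4) := by
  have hsub := cube_mono (d := d) (Nat.le_succ N)
  rw [← Finset.sum_sdiff hsub, add_comm]
  gcongr
  have hcard : ((cube d (N + 1) \ cube d N).card : ℝ) = (2 * N + 3 : ℝ) ^ d - (2 * N + 1) ^ d := by
    rw [Finset.card_sdiff_of_subset hsub, Nat.cast_sub (Finset.card_le_card hsub), card_cube,
      card_cube]
    push_cast
    ring
  rw [← hcard, div_eq_mul_inv, ← nsmul_eq_mul]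
  refine Finset.sum_le_card_nsmul _ _ _ fun k hk => ?_
  rw [Finset.mem_sdiff, mem_cube, mem_cube] at hk
  obtain ⟨h1, h2⟩ := hk
  push Not at h2
  obtain ⟨i, hi⟩ := h2
  have h3 := h1 i
  have habs : (k i) ^ 2 = ((N : ℤ) + 1) ^ 2 := by
    by_cases h4 : -(N : ℤ) ≤ k i
    · have : k i = N + 1 := by have := hi h4; push_cast at h3; omega
      rw [this]
    · have : k i = -(N + 1) := by push_cast at h3; omega
      rw [this]; ring
  have habs' : (k i : ℝ) ^ 2 = ((N : ℝ) + 1) ^ 2 := by exact_mod_cast habs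
  have h5 := sq_le_normSq k i
  have h6 := pow_four_le_quartic k i
  have h7 : (k i : ℝ) ^ 4 = ((N : ℝ) + 1) ^ 4 := by
    calc (k i : ℝ) ^ 4 = ((k i : ℝ) ^ 2) ^ 2 := by ring
      _ = _ := by rw [habs']; ring
  apply inv_anti₀ (by positivity)
  rw [h2Symbol]
  linarith

/-- Summation over shells. The shell of radius `n` contributes at most
`c / (n - 1/2) - c / (n + 1/2)`, which telescopes. -/
lemma sum_cube_le_of_shell {A c : ℝ} (hc : 0 ≤ c)
    (h1 : 1 + ((3 : ℝ) ^ d - 1) / 3 + c * (2 / 3) ≤ A)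
    (h2 : ∀ n : ℝ, 2 ≤ n → (2 * n + 1) ^ d - (2 * n - 1) ^ d ≤ c * n ^ 2 + 2 * (c / 24)) (N : ℕ) :
    ∑ k ∈ cube d (N + 1), (h2Symbol k)⁻¹ ≤ A - c / (N + 3 / 2) := by
  induction N with
  | zero =>
    have h3 := sum_cube_succ_le (d := d) 0
    have h4 : ∑ k ∈ cube d 0, (h2Symbol k)⁻¹ = 1 := by
      have : cube d 0 = {0} := by
        ext k
        simp only [mem_cube, Finset.mem_singleton, Nat.cast_zero, neg_zero]
        constructor
        · intro h; funext j; have := h j; simp; omega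
        · rintro rfl; simp
      rw [this]
      simp [h2Symbol, normSq, quartic]
    rw [h4] at h3
    norm_num at h3 ⊢
    linarith
  | succ N ih =>
    have h3 := sum_cube_succ_le (d := d) (N + 1)
    set n : ℝ := N + 2 with hn
    have hn2 : 2 ≤ n := by have : (0 : ℝ) ≤ N := by positivity
                           linarith
    have h4 := h2 n hn2
    have e1 : (2 * ((N + 1 : ℕ) : ℝ) + 3) = 2 * n + 1 := by push_cast; rw [hn]; ring
    have e2 : (2 * ((N + 1 : ℕ) : ℝ) + 1) = 2 * n - 1 := by push_cast; rw [hn]; ring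
    have e3 : (((N + 1 : ℕ) : ℝ) + 1) = n := by push_cast; rw [hn]; ring
    rw [e1, e2, e3] at h3
    have h5 : ((2 * n + 1) ^ d - (2 * n - 1) ^ d) / (1 + n ^ 2 + n ^ 4)
        ≤ c / (N + 3 / 2) - c / (((N + 1 : ℕ) : ℝ) + 3 / 2) := by
      have e4 : (N : ℝ) + 3 / 2 = n - 1 / 2 := by rw [hn]; ring
      have e5 : ((N + 1 : ℕ) : ℝ) + 3 / 2 = n + 1 / 2 := by push_cast; rw [hn]; ring
      rw [e4, e5, div_sub_div _ _ (by linarith) (by linarith), div_le_div_iff₀ (by positivity)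
        (by nlinarith)]
      have h6 : 0 ≤ (n - 1 / 2) * (n + 1 / 2) := by nlinarith
      calc _ ≤ (c * n ^ 2 + 2 * (c / 24)) * ((n - 1 / 2) * (n + 1 / 2)) := by gcongr
        _ ≤ c * (1 + n ^ 2 + n ^ 4) := by nlinarith [mul_nonneg hc (sq_nonneg n)]
        _ = _ := by ring
    linarith

/-- The comparison with `3^d ≤ π^d` is what makes the constant of the Sobolev embedding at most one. -/
lemma sum_inv_h2Symbol_le (hd1 : 1 ≤ d) (hd3 : d ≤ 3) (F : Finset (Fin d → ℤ)) :
    ∑ k ∈ F, (h2Symbol k)⁻¹ ≤ 3 ^ d := by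
  obtain ⟨N, hN⟩ := exists_subset_cube F
  have h1 : ∑ k ∈ F, (h2Symbol k)⁻¹ ≤ ∑ k ∈ cube d (N + 1), (h2Symbol k)⁻¹ :=
    Finset.sum_le_sum_of_subset_of_nonneg (hN.trans (cube_mono (Nat.le_succ N)))
      fun k _ _ => (inv_pos.2 (h2Symbol_pos k)).le
  refine h1.trans ?_
  have h0 : (0 : ℝ) ≤ N := by positivity
  interval_cases d
  · have := sum_cube_le_of_shell (d := 1) (A := 3) (c := 2) (by norm_num) (by norm_num)
      (fun n hn => by nlinarith) N
    have h2 : (0 : ℝ) ≤ 2 / (N + 3 / 2) := by positivity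
    linarith
  · have := sum_cube_le_of_shell (d := 2) (A := 19 / 3) (c := 4) (by norm_num) (by norm_num)
      (fun n hn => by nlinarith) N
    have h2 : (0 : ℝ) ≤ 4 / (N + 3 / 2) := by positivity
    linarith
  · have := sum_cube_le_of_shell (d := 3) (A := 77 / 3) (c := 24) (by norm_num) (by norm_num)
      (fun n hn => by ring_nf; rfl) N
    have h2 : (0 : ℝ) ≤ 24 / (N + 3 / 2) := by positivity
    linarith

lemma sum_h2Symbol_mul_sq_le {u : (Fin d → ℝ) → ℝ} (hu : MemH2 u) (hn : NeumannBC u)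
    (F : Finset (Fin d → ℤ)) :
    Real.pi ^ d * ∑ k ∈ F, h2Symbol k * cosCoef u k ^ 2 ≤ h2NormSq u := by
  rw [Finset.mul_sum]
  refine sum_le_hasSum F (fun k _ => ?_) (hasSum_h2NormSq hu hn)
  have := h2Symbol_pos k
  rw [h2Symbol] at this
  positivity

lemma h2NormSq_nonneg (u : (Fin d → ℝ) → ℝ) : 0 ≤ h2NormSq u := by
  unfold h2NormSq
  have h1 := l2NormSq_nonneg u
  have h2 : 0 ≤ ∑ i, l2NormSq (weakPartial i u) := Finset.sum_nonneg fun _ _ => l2NormSq_nonneg _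
  have h3 : 0 ≤ ∑ i, ∑ j ∈ Finset.Ici i, l2NormSq (weakPartial j (weakPartial i u)) :=
    Finset.sum_nonneg fun _ _ => Finset.sum_nonneg fun _ _ => l2NormSq_nonneg _
  linarith

lemma l2NormSq_le_h2NormSq (u : (Fin d → ℝ) → ℝ) : l2NormSq u ≤ h2NormSq u := by
  unfold h2NormSq
  have h2 : 0 ≤ ∑ i, l2NormSq (weakPartial i u) := Finset.sum_nonneg fun _ _ => l2NormSq_nonneg _
  have h3 : 0 ≤ ∑ i, ∑ j ∈ Finset.Ici i, l2NormSq (weakPartial j (weakPartial i u)) :=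
    Finset.sum_nonneg fun _ _ => Finset.sum_nonneg fun _ _ => l2NormSq_nonneg _
  linarith

lemma l2NormSq_weakPartial_le (u : (Fin d → ℝ) → ℝ) (i : Fin d) :
    l2NormSq (weakPartial i u) ≤ h2NormSq u := by
  unfold h2NormSq
  have h1 := l2NormSq_nonneg u
  have h2 : l2NormSq (weakPartial i u) ≤ ∑ i, l2NormSq (weakPartial i u) :=
    Finset.single_le_sum (f := fun i => l2NormSq (weakPartial i u))
      (fun _ _ => l2NormSq_nonneg _) (Finset.mem_univ i)
  have h3 : 0 ≤ ∑ i, ∑ j ∈ Finset.Ici i, l2NormSq (weakPartial j (weakPartial i u)) :=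
    Finset.sum_nonneg fun _ _ => Finset.sum_nonneg fun _ _ => l2NormSq_nonneg _
  linarith

lemma l2NormSq_weakPartial_self_le (u : (Fin d → ℝ) → ℝ) (i : Fin d) :
    l2NormSq (weakPartial i (weakPartial i u)) ≤ h2NormSq u := by
  unfold h2NormSq
  have h1 := l2NormSq_nonneg u
  have h2 : 0 ≤ ∑ i, l2NormSq (weakPartial i u) := Finset.sum_nonneg fun _ _ => l2NormSq_nonneg _
  have h3 : ∑ j ∈ Finset.Ici i, l2NormSq (weakPartial j (weakPartial i u))
      ≤ ∑ i, ∑ j ∈ Finset.Ici i, l2NormSq (weakPartial j (weakPartial i u)) :=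
    Finset.single_le_sum
      (f := fun i => ∑ j ∈ Finset.Ici i, l2NormSq (weakPartial j (weakPartial i u)))
      (fun _ _ => Finset.sum_nonneg fun _ _ => l2NormSq_nonneg _) (Finset.mem_univ i)
  have h4 : l2NormSq (weakPartial i (weakPartial i u))
      ≤ ∑ j ∈ Finset.Ici i, l2NormSq (weakPartial j (weakPartial i u)) :=
    Finset.single_le_sum (f := fun j => l2NormSq (weakPartial j (weakPartial i u)))
      (fun _ _ => l2NormSq_nonneg _) (by simp)
  linarith

/-- The Sobolev embedding `H² ⊆ L^∞` in terms of coefficients. The constant is at most one, so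
that a function that is small in `H²` takes its values in a disc of the same radius. -/
lemma sum_abs_cosCoef_sq_le (hd1 : 1 ≤ d) (hd3 : d ≤ 3) {u : (Fin d → ℝ) → ℝ} (hu : MemH2 u)
    (hn : NeumannBC u) (F : Finset (Fin d → ℤ)) : (∑ k ∈ F, |cosCoef u k|) ^ 2 ≤ h2NormSq u := by
  have h1 := Finset.sum_sq_le_sum_mul_sum_of_sq_le_mul F (r := fun k => |cosCoef u k|)
    (f := fun k => (h2Symbol k)⁻¹) (g := fun k => h2Symbol k * cosCoef u k ^ 2)
    (fun k _ => (inv_pos.2 (h2Symbol_pos k)).le)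
    (fun k _ => mul_nonneg (h2Symbol_pos k).le (sq_nonneg _)) (fun k _ => by
      have := h2Symbol_pos k
      rw [sq_abs]
      field_simp
      rfl)
  have h2 := sum_inv_h2Symbol_le hd1 hd3 F
  have h3 : (3 : ℝ) ^ d ≤ Real.pi ^ d := by gcongr; exact Real.pi_gt_three.le
  have h4 := sum_h2Symbol_mul_sq_le hu hn F
  have h5 : 0 ≤ ∑ k ∈ F, h2Symbol k * cosCoef u k ^ 2 :=
    Finset.sum_nonneg fun k _ => mul_nonneg (h2Symbol_pos k).le (sq_nonneg _)
  calc _ ≤ _ := h1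
    _ ≤ Real.pi ^ d * ∑ k ∈ F, h2Symbol k * cosCoef u k ^ 2 := by gcongr; exact h2.trans h3
    _ ≤ _ := h4

/-! ### The continuous representative -/

/-- The sum of the cosine series of `u`, a continuous function that agrees with `u` almost everywhere
if `u` is in `H²` and `d ≤ 3`. -/
def rep (u : (Fin d → ℝ) → ℝ) (x : Fin d → ℝ) : ℝ := ∑' k, cosCoef u k * cosMode k x

/-- The partial sums of the cosine series. -/
abbrev cosProj (N : ℕ) (u : (Fin d → ℝ) → ℝ) : (Fin d → ℝ) → ℝ := proj (fun _ => false) N u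

lemma summable_abs_cosCoef (hd1 : 1 ≤ d) (hd3 : d ≤ 3) {u : (Fin d → ℝ) → ℝ} (hu : MemH2 u)
    (hn : NeumannBC u) : Summable fun k => |cosCoef u k| :=
  summable_of_sum_le (fun _ => abs_nonneg _)
    fun F => Real.le_sqrt_of_sq_le (sum_abs_cosCoef_sq_le hd1 hd3 hu hn F)

lemma abs_coef_mul_mode_le (τ : Fin d → Bool) (a : ℝ) (k : Fin d → ℤ) (x : Fin d → ℝ) :
    |a * mode τ k x| ≤ |a| := by
  rw [abs_mul]
  exact mul_le_of_le_one_right (abs_nonneg _) (abs_mode_le _ _ _)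

lemma continuous_rep (hd1 : 1 ≤ d) (hd3 : d ≤ 3) {u : (Fin d → ℝ) → ℝ} (hu : MemH2 u)
    (hn : NeumannBC u) : Continuous (rep u) :=
  continuous_tsum (fun k => (continuous_mode _ k).const_mul _)
    (summable_abs_cosCoef hd1 hd3 hu hn) fun _ _ => abs_coef_mul_mode_le _ _ _ _

lemma tendsto_cosProj (hd1 : 1 ≤ d) (hd3 : d ≤ 3) {u : (Fin d → ℝ) → ℝ} (hu : MemH2 u)
    (hn : NeumannBC u) (x : Fin d → ℝ) : Tendsto (fun N => cosProj N u x) atTop (𝓝 (rep u x)) := by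
  have hs : Summable fun k => cosCoef u k * cosMode k x :=
    Summable.of_norm_bounded (summable_abs_cosCoef hd1 hd3 hu hn)
      fun k => abs_coef_mul_mode_le _ _ _ _
  exact hs.hasSum.comp tendsto_cube

lemma cosProj_sq_le (hd1 : 1 ≤ d) (hd3 : d ≤ 3) {u : (Fin d → ℝ) → ℝ} (hu : MemH2 u)
    (hn : NeumannBC u) (N : ℕ) (x : Fin d → ℝ) : cosProj N u x ^ 2 ≤ h2NormSq u := by
  refine le_trans ?_ (sum_abs_cosCoef_sq_le hd1 hd3 hu hn (cube d N))
  rw [← sq_abs]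
  gcongr
  exact (Finset.abs_sum_le_sum_abs _ _).trans
    (Finset.sum_le_sum fun k _ => abs_coef_mul_mode_le _ _ _ _)

lemma rep_sq_le (hd1 : 1 ≤ d) (hd3 : d ≤ 3) {u : (Fin d → ℝ) → ℝ} (hu : MemH2 u)
    (hn : NeumannBC u) (x : Fin d → ℝ) : rep u x ^ 2 ≤ h2NormSq u :=
  le_of_tendsto ((tendsto_cosProj hd1 hd3 hu hn x).pow 2)
    (Eventually.of_forall fun N => cosProj_sq_le hd1 hd3 hu hn N x)

lemma ae_eq_rep (hd1 : 1 ≤ d) (hd3 : d ≤ 3) {u : (Fin d → ℝ) → ℝ} (hu : MemH2 u)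
    (hn : NeumannBC u) : u =ᵐ[volume.restrict (box d)] rep u := by
  have mr : MemL2 (rep u) := memL2_of_continuous (continuous_rep hd1 hd3 hu hn)
  have h1 := tendsto_l2NormSq_sub_proj (fun _ => false) hu.1
  have h2 : Tendsto (fun N => l2NormSq (cosProj N u - rep u)) atTop (𝓝 0) := by
    have : (0 : ℝ) = ∫ x in box d, (0 : ℝ) := by simp
    rw [this]
    refine tendsto_integral_of_dominated_convergence (fun _ => 4 * h2NormSq u) ?_
      (integrable_const _) ?_ ?_
    · intro N
      exact ((memL2_proj _ N u).sub' mr).sq_integrable.aestronglyMeasurable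
    · intro N
      refine Eventually.of_forall fun x => ?_
      have h3 := cosProj_sq_le hd1 hd3 hu hn N x
      have h4 := rep_sq_le hd1 hd3 hu hn x
      rw [Real.norm_eq_abs, abs_of_nonneg (sq_nonneg _), Pi.sub_apply]
      nlinarith [sq_nonneg (cosProj N u x + rep u x)]
    · refine Eventually.of_forall fun x => ?_
      have := ((tendsto_cosProj hd1 hd3 hu hn x).sub_const (rep u x)).pow 2
      simpa using this
  have h3 : l2NormSq (u - rep u) ≤ 0 := by
    have h4 := (h1.const_mul 2).add (h2.const_mul 2)
    simp only [mul_zero, add_zero] at h4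
    exact ge_of_tendsto h4 (Eventually.of_forall fun N =>
      l2NormSq_sub_le hu.1 (memL2_proj _ N u) mr)
  have h5 := (integral_eq_zero_iff_of_nonneg (fun _ => sq_nonneg _)
    (hu.1.sub' mr).sq_integrable).1 (le_antisymm h3 (l2NormSq_nonneg _))
  filter_upwards [h5] with x hx
  have : (u x - rep u x) ^ 2 = 0 := hx
  linarith [pow_eq_zero_iff (two_ne_zero) |>.1 this]

/-! ### Partial sums of derivatives -/

lemma l2NormSq_proj_le {τ : Fin d → Bool} {u : (Fin d → ℝ) → ℝ} (hu : MemL2 u) (N : ℕ) :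
    l2NormSq (proj τ N u) ≤ l2NormSq u := by
  have h := integral_sub_trigPoly_sq (τ := τ) (N := N) hu (fun _ => 0)
  have h0 : trigPoly τ (cube d N) (fun _ => 0) = 0 := by
    funext x; simp [trigPoly]
  rw [h0, sub_zero, sub_zero] at h
  have h1 := sum_coef_sq_le (τ := τ) hu (cube d N)
  have h2 := l2NormSq_sub_proj (τ := τ) (N := N) hu
  have h3 := l2NormSq_nonneg (u - proj τ N u)
  have h4 : 0 ≤ Real.pi ^ d * ∑ k ∈ cube d N, coef τ u k ^ 2 :=
    mul_nonneg (by positivity) (Finset.sum_nonneg fun _ _ => sq_nonneg _)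
  linarith

lemma partialDeriv_cosProj {u : (Fin d → ℝ) → ℝ} (hu : MemH2 u) (i : Fin d) (N : ℕ) :
    partialDeriv i (cosProj N u) = proj (sinAt i) N (weakPartial i u) := by
  rw [cosProj, proj, partialDeriv_trigPoly, proj]
  congr 1
  funext k
  rw [coef_weakPartial hu]
  simp [parity]

lemma partialDeriv_proj_weakPartial {u : (Fin d → ℝ) → ℝ} (hu : MemH2 u) (hn : NeumannBC u)
    (i : Fin d) (N : ℕ) :
    partialDeriv i (proj (sinAt i) N (weakPartial i u))
      = cosProj N (weakPartial i (weakPartial i u)) := by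
  rw [cosProj, proj, partialDeriv_trigPoly, proj]
  have e : Function.update (sinAt i) i (!sinAt i i) = fun _ => false := by simp [sinAt]
  rw [e]
  congr 1
  funext k
  have := coef_weakPartial_self hu hn i k
  rw [cosCoef] at this
  rw [coef_weakPartial hu, this]
  simp [sinAt, parity]
  ring

/-! ### The disc and the constant `C_η` -/

lemma convex_disc (S : RDSystem) (η : ℝ) : Convex ℝ (S.disc η) := by
  intro p hp q hq a b ha hb hab
  simp only [RDSystem.disc, mem_ofPred_eq, Prod.fst_add, Prod.smul_fst, Prod.snd_add,
    Prod.smul_snd, smul_eq_mul] at *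
  have hb' : b = 1 - a := by linarith
  subst hb'
  have h1 : ∀ x y c : ℝ, (a * x + (1 - a) * y - c) ^ 2
      ≤ a * (x - c) ^ 2 + (1 - a) * (y - c) ^ 2 := by
    intro x y c
    nlinarith [mul_nonneg (mul_nonneg ha hb) (sq_nonneg (x - y))]
  nlinarith [h1 p.1 q.1 S.Ubar, h1 p.2 q.2 S.Vbar]

lemma isCompact_disc (S : RDSystem) {η : ℝ} (hη : 0 < η) : IsCompact (S.disc η) := by
  refine (isCompact_Icc (a := (S.Ubar - η, S.Vbar - η)) (b := (S.Ubar + η, S.Vbar + η))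
    ).of_isClosed_subset (isClosed_le (by fun_prop) continuous_const) fun p hp => ?_
  have hp' : (p.1 - S.Ubar) ^ 2 + (p.2 - S.Vbar) ^ 2 ≤ η ^ 2 := hp
  have h1 := abs_le_of_sq_le_sq' (show (p.1 - S.Ubar) ^ 2 ≤ η ^ 2 by nlinarith [sq_nonneg (p.2 - S.Vbar)]) hη.le
  have h2 := abs_le_of_sq_le_sq' (show (p.2 - S.Vbar) ^ 2 ≤ η ^ 2 by nlinarith [sq_nonneg (p.1 - S.Ubar)]) hη.le
  refine ⟨⟨?_, ?_⟩, ⟨?_, ?_⟩⟩ <;> simp <;> linarith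

lemma Wbar_mem_disc (S : RDSystem) (η : ℝ) : S.Wbar ∈ S.disc η := by
  simp [RDSystem.disc, RDSystem.Wbar]
  positivity

/-- `h` is `C²` near the points of `K`, and `h`, `Dh`, `D²h` are bounded by `C` there. -/
structure C2BoundOn (K : Set (ℝ × ℝ)) (h : ℝ × ℝ → ℝ) (C : ℝ) : Prop where
  contDiffAt : ∀ p ∈ K, ContDiffAt ℝ 2 h p
  bound₀ : ∀ p ∈ K, |h p| ≤ C
  bound₁ : ∀ p ∈ K, ‖fderiv ℝ h p‖ ≤ C
  bound₂ : ∀ p ∈ K, ‖fderiv ℝ (fderiv ℝ h) p‖ ≤ C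

lemma c2Size_nonneg (h : ℝ × ℝ → ℝ) (p : ℝ × ℝ) : 0 ≤ RDSystem.c2Size h p :=
  Finset.sum_nonneg fun _ _ => norm_nonneg _

lemma continuousAt_c2Size {h : ℝ × ℝ → ℝ} {p : ℝ × ℝ} (hh : ContDiffAt ℝ 2 h p) :
    ContinuousAt (RDSystem.c2Size h) p := by
  unfold RDSystem.c2Size
  refine tendsto_finsetSum _ fun k hk => ?_
  have hk2 : k ≤ 2 := by have := Finset.mem_range.1 hk; omega
  have h0 : ContDiffAt ℝ 0 (iteratedFDeriv ℝ k h) p :=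
    hh.iteratedFDeriv_right (by simpa using hk2)
  exact h0.continuousAt.norm

lemma C2BoundOn.of_c2Size {K : Set (ℝ × ℝ)} {h : ℝ × ℝ → ℝ} {C : ℝ}
    (hc : ∀ p ∈ K, ContDiffAt ℝ 2 h p) (hs : ∀ p ∈ K, RDSystem.c2Size h p ≤ C) :
    C2BoundOn K h C := by
  have e : ∀ p, RDSystem.c2Size h p
      = |h p| + ‖fderiv ℝ h p‖ + ‖fderiv ℝ (fderiv ℝ h) p‖ := by
    intro p
    rw [RDSystem.c2Size, Finset.sum_range_succ, Finset.sum_range_succ, Finset.sum_range_one,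
      norm_iteratedFDeriv_zero, norm_iteratedFDeriv_one, Real.norm_eq_abs,
      ← norm_iteratedFDeriv_fderiv, norm_iteratedFDeriv_one]
  refine ⟨hc, fun p hp => ?_, fun p hp => ?_, fun p hp => ?_⟩ <;>
  · have h1 := hs p hp
    rw [e] at h1
    linarith [abs_nonneg (h p), norm_nonneg (fderiv ℝ h p),
      norm_nonneg (fderiv ℝ (fderiv ℝ h) p)]

/-- `C_η` bounds the `C²` sizes of `D₁, D₂, f, g` on the disc. -/
lemma c2BoundOn_Ceta (S : RDSystem) {η : ℝ} (hη : 0 < η) (hS : S.SmoothNear η) :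
    C2BoundOn (S.disc η) S.D₁ (S.Ceta η) ∧ C2BoundOn (S.disc η) S.D₂ (S.Ceta η) ∧
      C2BoundOn (S.disc η) S.f (S.Ceta η) ∧ C2BoundOn (S.disc η) S.g (S.Ceta η) := by
  have hb : BddAbove ((fun p => RDSystem.c2Size S.D₁ p + RDSystem.c2Size S.D₂ p
      + RDSystem.c2Size S.f p + RDSystem.c2Size S.g p) '' S.disc η) := by
    refine (isCompact_disc S hη).bddAbove_image fun p hp => ?_
    obtain ⟨h1, h2, h3, h4⟩ := hS p hp
    exact ((((continuousAt_c2Size h1).add (continuousAt_c2Size h2)).add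
      (continuousAt_c2Size h3)).add (continuousAt_c2Size h4)).continuousWithinAt
  have hle : ∀ p ∈ S.disc η, RDSystem.c2Size S.D₁ p + RDSystem.c2Size S.D₂ p
      + RDSystem.c2Size S.f p + RDSystem.c2Size S.g p ≤ S.Ceta η :=
    fun p hp => le_csSup hb ⟨p, hp, rfl⟩
  refine ⟨.of_c2Size (fun p hp => (hS p hp).1) ?_, .of_c2Size (fun p hp => (hS p hp).2.1) ?_,
    .of_c2Size (fun p hp => (hS p hp).2.2.1) ?_, .of_c2Size (fun p hp => (hS p hp).2.2.2) ?_⟩ <;>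
  · intro p hp
    have := hle p hp
    linarith [c2Size_nonneg S.D₁ p, c2Size_nonneg S.D₂ p, c2Size_nonneg S.f p,
      c2Size_nonneg S.g p]

/-! ### Composition with smooth functions -/

/-- The function `x ↦ (P x + Ū, Q x + V̄)`. -/
def state (S : RDSystem) (P Q : (Fin d → ℝ) → ℝ) (x : Fin d → ℝ) : ℝ × ℝ :=
  (P x + S.Ubar, Q x + S.Vbar)

/-- The pair `(∂ᵢP, ∂ᵢQ)`. -/
def pairDeriv (i : Fin d) (P Q : (Fin d → ℝ) → ℝ) (x : Fin d → ℝ) : ℝ × ℝ :=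
  (partialDeriv i P x, partialDeriv i Q x)

lemma contDiff_partialDeriv {n m : WithTop ℕ∞} {P : (Fin d → ℝ) → ℝ} (hP : ContDiff ℝ n P)
    (h : m + 1 ≤ n) (i : Fin d) : ContDiff ℝ m (partialDeriv i P) :=
  (hP.fderiv_right h).clm_apply contDiff_const

lemma contDiff_state (S : RDSystem) {n : WithTop ℕ∞} {P Q : (Fin d → ℝ) → ℝ}
    (hP : ContDiff ℝ n P) (hQ : ContDiff ℝ n Q) : ContDiff ℝ n (state S P Q) :=
  (hP.add contDiff_const).prodMk (hQ.add contDiff_const)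

lemma fderiv_state_apply (S : RDSystem) {P Q : (Fin d → ℝ) → ℝ} {x : Fin d → ℝ}
    (hP : DifferentiableAt ℝ P x) (hQ : DifferentiableAt ℝ Q x) (i : Fin d) :
    fderiv ℝ (state S P Q) x (Pi.single i 1) = pairDeriv i P Q x := by
  have h : HasFDerivAt (state S P Q) ((fderiv ℝ P x).prod (fderiv ℝ Q x)) x :=
    (hP.hasFDerivAt.add_const _).prodMk (hQ.hasFDerivAt.add_const _)
  rw [h.fderiv]
  rfl

section
variable {S : RDSystem} {K : Set (ℝ × ℝ)} {h : ℝ × ℝ → ℝ} {C : ℝ} {P Q : (Fin d → ℝ) → ℝ}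

lemma contDiff_comp_state (hh : C2BoundOn K h C) (hP : ContDiff ℝ ∞ P) (hQ : ContDiff ℝ ∞ Q)
    (hK : ∀ x, state S P Q x ∈ K) : ContDiff ℝ 2 fun x => h (state S P Q x) :=
  contDiff_iff_contDiffAt.2 fun x => (hh.contDiffAt _ (hK x)).comp x
    (contDiff_infty.1 (contDiff_state S hP hQ) 2).contDiffAt

lemma partialDeriv_comp_state (hh : C2BoundOn K h C) (hP : ContDiff ℝ ∞ P) (hQ : ContDiff ℝ ∞ Q)
    (hK : ∀ x, state S P Q x ∈ K) (i : Fin d) (x : Fin d → ℝ) :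
    partialDeriv i (fun x => h (state S P Q x)) x
      = fderiv ℝ h (state S P Q x) (pairDeriv i P Q x) := by
  have h1 := ((hh.contDiffAt _ (hK x)).differentiableAt (by simp)).hasFDerivAt.comp x
    ((contDiff_state S hP hQ).differentiable (by simp) x).hasFDerivAt
  have h2 : fderiv ℝ (fun x => h (state S P Q x)) x = _ := h1.fderiv
  rw [partialDeriv, h2, ContinuousLinearMap.comp_apply, fderiv_state_apply S
    (hP.differentiable (by simp) x) (hQ.differentiable (by simp) x)]

lemma partialDeriv₂_comp_state (hh : C2BoundOn K h C) (hP : ContDiff ℝ ∞ P)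
    (hQ : ContDiff ℝ ∞ Q) (hK : ∀ x, state S P Q x ∈ K) (i : Fin d) (x : Fin d → ℝ) :
    partialDeriv i (partialDeriv i fun x => h (state S P Q x)) x
      = fderiv ℝ (fderiv ℝ h) (state S P Q x) (pairDeriv i P Q x) (pairDeriv i P Q x)
        + fderiv ℝ h (state S P Q x) (pairDeriv i (partialDeriv i P) (partialDeriv i Q) x) := by
  have e : (partialDeriv i fun x => h (state S P Q x))
      = fun x => fderiv ℝ h (state S P Q x) (pairDeriv i P Q x) :=
    funext (partialDeriv_comp_state hh hP hQ hK i)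
  have hP1 : ContDiff ℝ ∞ (partialDeriv i P) := contDiff_partialDeriv hP (by simp) i
  have hQ1 : ContDiff ℝ ∞ (partialDeriv i Q) := contDiff_partialDeriv hQ (by simp) i
  have hP1x := hP1.differentiable (by simp) x
  have hQ1x := hQ1.differentiable (by simp) x
  have h1 : HasFDerivAt (fun x => fderiv ℝ h (state S P Q x)) _ x :=
    ((((hh.contDiffAt _ (hK x)).fderiv_right (m := 1) (by norm_num)).differentiableAt
      (by simp)).hasFDerivAt).comp x
    ((contDiff_state S hP hQ).differentiable (by simp) x).hasFDerivAt
  have h2 : HasFDerivAt (pairDeriv i P Q)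
      ((fderiv ℝ (partialDeriv i P) x).prod (fderiv ℝ (partialDeriv i Q) x)) x :=
    hP1x.hasFDerivAt.prodMk hQ1x.hasFDerivAt
  rw [e, partialDeriv, (h1.clm_apply h2).fderiv]
  simp only [_root_.add_apply, ContinuousLinearMap.comp_apply,
    ContinuousLinearMap.flip_apply]
  rw [fderiv_state_apply S (hP.differentiable (by simp) x) (hQ.differentiable (by simp) x),
    add_comm]
  rfl

lemma pairDeriv_eq_zero {i : Fin d} {x : Fin d → ℝ} (h1 : partialDeriv i P x = 0)
    (h2 : partialDeriv i Q x = 0) : pairDeriv i P Q x = 0 := by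
  rw [pairDeriv, h1, h2]; rfl

lemma norm_pairDeriv_sq_le (i : Fin d) (x : Fin d → ℝ) :
    ‖pairDeriv i P Q x‖ ^ 2 ≤ partialDeriv i P x ^ 2 + partialDeriv i Q x ^ 2 := by
  rw [pairDeriv, Prod.norm_def]
  have h1 := sq_nonneg (partialDeriv i P x)
  have h2 := sq_nonneg (partialDeriv i Q x)
  rcases max_choice ‖partialDeriv i P x‖ ‖partialDeriv i Q x‖ with h | h <;>
  · simp only [Real.norm_eq_abs] at h ⊢
    rw [h, sq_abs]
    linarith

lemma norm_pairDeriv_pow_four_le (i : Fin d) (x : Fin d → ℝ) :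
    ‖pairDeriv i P Q x‖ ^ 4 ≤ partialDeriv i P x ^ 4 + partialDeriv i Q x ^ 4 := by
  rw [pairDeriv, Prod.norm_def]
  have e : ∀ a : ℝ, |a| ^ 4 = a ^ 4 := fun a => by rw [← abs_pow, abs_of_nonneg (by positivity)]
  have h1 : 0 ≤ partialDeriv i P x ^ 4 := by positivity
  have h2 : 0 ≤ partialDeriv i Q x ^ 4 := by positivity
  rcases max_choice ‖partialDeriv i P x‖ ‖partialDeriv i Q x‖ with h | h <;>
  · simp only [Real.norm_eq_abs] at h ⊢
    rw [h, e]
    linarith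

lemma partialDeriv₂_comp_state_sq_le (hh : C2BoundOn K h C) (hP : ContDiff ℝ ∞ P)
    (hQ : ContDiff ℝ ∞ Q) (hK : ∀ x, state S P Q x ∈ K) (i : Fin d) (x : Fin d → ℝ) :
    partialDeriv i (partialDeriv i fun x => h (state S P Q x)) x ^ 2
      ≤ 2 * C ^ 2 * (partialDeriv i P x ^ 4 + partialDeriv i Q x ^ 4
        + (partialDeriv i (partialDeriv i P) x ^ 2 + partialDeriv i (partialDeriv i Q) x ^ 2)) := by
  rw [partialDeriv₂_comp_state hh hP hQ hK]
  set w := pairDeriv i P Q x with hw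
  set z := pairDeriv i (partialDeriv i P) (partialDeriv i Q) x with hz
  have h4 := norm_pairDeriv_pow_four_le (P := P) (Q := Q) i x
  have h2 := norm_pairDeriv_sq_le (P := partialDeriv i P) (Q := partialDeriv i Q) i x
  have hA : |fderiv ℝ (fderiv ℝ h) (state S P Q x) w w| ≤ C * ‖w‖ ^ 2 := by
    have := ContinuousLinearMap.le_opNorm₂ (fderiv ℝ (fderiv ℝ h) (state S P Q x)) w w
    rw [Real.norm_eq_abs] at this
    calc _ ≤ _ := this
      _ = ‖fderiv ℝ (fderiv ℝ h) (state S P Q x)‖ * ‖w‖ ^ 2 := by ring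
      _ ≤ _ := by gcongr; exact hh.bound₂ _ (hK x)
  have hB : |fderiv ℝ h (state S P Q x) z| ≤ C * ‖z‖ := by
    have := ContinuousLinearMap.le_opNorm (fderiv ℝ h (state S P Q x)) z
    rw [Real.norm_eq_abs] at this
    exact this.trans (by gcongr; exact hh.bound₁ _ (hK x))
  have hA2 : (fderiv ℝ (fderiv ℝ h) (state S P Q x) w w) ^ 2 ≤ C ^ 2 * ‖w‖ ^ 4 := by
    rw [← sq_abs]
    calc _ ≤ (C * ‖w‖ ^ 2) ^ 2 := by gcongr
      _ = _ := by ring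
  have hB2 : (fderiv ℝ h (state S P Q x) z) ^ 2 ≤ C ^ 2 * ‖z‖ ^ 2 := by
    rw [← sq_abs]
    calc _ ≤ (C * ‖z‖) ^ 2 := by gcongr
      _ = _ := by ring
  have hC2 := sq_nonneg C
  have hA3 := mul_le_mul_of_nonneg_left h4 hC2
  have hB3 := mul_le_mul_of_nonneg_left h2 hC2
  nlinarith [sq_nonneg (fderiv ℝ (fderiv ℝ h) (state S P Q x) w w
    - fderiv ℝ h (state S P Q x) z)]

/-- Cosine coefficients of `∂ᵢ∂ᵢb` for a `C²` function `b` with vanishing normal derivative. -/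
lemma cosCoef_partialDeriv₂ {b : (Fin d → ℝ) → ℝ} (hb : ContDiff ℝ 2 b) {i : Fin d}
    (h0 : ∀ x, x i = 0 ∨ x i = Real.pi → partialDeriv i b x = 0) (k : Fin d → ℤ) :
    cosCoef (partialDeriv i (partialDeriv i b)) k = -(k i ^ 2 * cosCoef b k) := by
  have hb1 : ContDiff ℝ 1 (partialDeriv i b) := contDiff_partialDeriv hb (by norm_num) i
  have hb0 : ContDiff ℝ 1 b := hb.of_le (by norm_num)
  have hm : ContDiff ℝ 1 (mode (fun _ => false) k) := (contDiff_mode _ k).of_le (by simp)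
  have e1 : partialDeriv i (mode (fun _ => false) k)
      = fun x => -k i * mode (sinAt i) k x := by
    funext x; rw [partialDeriv_mode]; simp [parity, sinAt]
  have hs : ContDiff ℝ 1 fun x => -(k i : ℝ) * mode (sinAt i) k x :=
    contDiff_const.mul ((contDiff_mode _ k).of_le (by simp))
  have h1 := integral_mul_partialDeriv (F := mode (fun _ => false) k) (G := partialDeriv i b) i
    (fun x _ => hm.contDiffAt) (fun x _ => hb1.contDiffAt)
    (fun x hx => by rw [h0 x hx, mul_zero])
  rw [e1] at h1
  have h2 := integral_mul_partialDeriv (F := fun x => -(k i : ℝ) * mode (sinAt i) k x) (G := b) i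
    (fun x _ => hs.contDiffAt) (fun x _ => hb0.contDiffAt)
    (fun x hx => by rw [mode_eq_zero k (by simp [sinAt]) hx]; ring)
  have e2 : ∀ x, partialDeriv i (fun x => -(k i : ℝ) * mode (sinAt i) k x) x
      = -(k i : ℝ) ^ 2 * mode (fun _ => false) k x := by
    intro x
    rw [partialDeriv, fderiv_const_mul ((contDiff_mode _ k).differentiable (by simp) x)]
    have := partialDeriv_mode (sinAt i) k i x
    rw [partialDeriv] at this
    simp only [_root_.smul_apply, smul_eq_mul]
    rw [this]
    simp [sinAt, parity]
    ring
  simp_rw [e2] at h2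
  rw [h2] at h1
  have e3 : ∫ x in box d, -(k i : ℝ) ^ 2 * mode (fun _ => false) k x * b x
      = -(k i : ℝ) ^ 2 * ∫ x in box d, b x * mode (fun _ => false) k x := by
    rw [← integral_const_mul]
    congr 1; funext x; ring
  rw [e3] at h1
  simp_rw [mul_comm (mode (fun _ => false) k _)] at h1
  rw [cosCoef, coef, coef, h1]
  ring

lemma coef_partialDeriv {b : (Fin d → ℝ) → ℝ} (hb : ContDiff ℝ 1 b) (i : Fin d)
    (k : Fin d → ℤ) : coef (sinAt i) (partialDeriv i b) k = -(k i * cosCoef b k) := by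
  have hm : ContDiff ℝ 1 (mode (sinAt i) k) := (contDiff_mode _ k).of_le (by simp)
  have h1 := integral_mul_partialDeriv (F := mode (sinAt i) k) (G := b) i
    (fun x _ => hm.contDiffAt) (fun x _ => hb.contDiffAt)
    (fun x hx => by rw [mode_eq_zero k (by simp [sinAt]) hx]; ring)
  have e2 : ∀ x, partialDeriv i (mode (sinAt i) k) x * b x
      = k i * (b x * mode (fun _ => false) k x) := by
    intro x
    rw [partialDeriv_mode]
    simp [sinAt, parity]
    ring
  simp_rw [e2, integral_const_mul, mul_comm (mode (sinAt i) k _)] at h1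
  rw [cosCoef, coef, coef, h1]
  ring

/-- A Gagliardo–Nirenberg inequality: integrate `∂ᵢ(P (∂ᵢP)³)`. -/
lemma integral_partialDeriv_pow_four_le (hP : ContDiff ℝ ∞ P) {i : Fin d}
    (h0 : ∀ x, x i = 0 ∨ x i = Real.pi → partialDeriv i P x = 0) {s : ℝ}
    (hs : ∀ x, P x ^ 2 ≤ s) :
    ∫ x in box d, partialDeriv i P x ^ 4
      ≤ 9 * s * ∫ x in box d, partialDeriv i (partialDeriv i P) x ^ 2 := by
  have hP1 : ContDiff ℝ ∞ (partialDeriv i P) := contDiff_partialDeriv hP (by simp) i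
  have hP2 : ContDiff ℝ ∞ (partialDeriv i (partialDeriv i P)) :=
    contDiff_partialDeriv hP1 (by simp) i
  have hG : ContDiff ℝ ∞ fun x => partialDeriv i P x ^ 3 := hP1.pow 3
  have h1 := integral_mul_partialDeriv (F := P) (G := fun x => partialDeriv i P x ^ 3) i
    (fun x _ => (hP.of_le (by simp)).contDiffAt) (fun x _ => (hG.of_le (by simp)).contDiffAt)
    (fun x hx => by rw [h0 x hx]; ring)
  have e : ∀ x, partialDeriv i (fun x => partialDeriv i P x ^ 3) x
      = 3 * partialDeriv i P x ^ 2 * partialDeriv i (partialDeriv i P) x := by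
    intro x
    have := ((hP1.differentiable (by simp) x).hasFDerivAt.pow 3).fderiv
    change (fderiv ℝ (fun x => partialDeriv i P x ^ 3) x) (Pi.single i 1)
      = 3 * partialDeriv i P x ^ 2 * (fderiv ℝ (partialDeriv i P) x) (Pi.single i 1)
    rw [this]
    simp
  simp_rw [e] at h1
  have hint : ∀ {g : (Fin d → ℝ) → ℝ}, ContDiff ℝ ∞ g → IntegrableOn g (box d) :=
    fun hg => (memL2_of_continuous hg.continuous).integrableOn
  have i4 : IntegrableOn (fun x => partialDeriv i P x ^ 4) (box d) := hint (hP1.pow 4)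
  have i2 : IntegrableOn (fun x => partialDeriv i (partialDeriv i P) x ^ 2) (box d) :=
    hint (hP2.pow 2)
  have h2 : ∫ x in box d, partialDeriv i P x ^ 4
      ≤ ∫ x in box d, (1 / 2 * partialDeriv i P x ^ 4
        + 9 / 2 * s * partialDeriv i (partialDeriv i P) x ^ 2) := by
    have e2 : ∫ x in box d, partialDeriv i P x ^ 4
        = ∫ x in box d,
          -(P x * (3 * partialDeriv i P x ^ 2 * partialDeriv i (partialDeriv i P) x)) := by
      rw [integral_neg, h1, neg_neg]
      congr 1; funext x; ring
    rw [e2]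
    refine integral_mono ?_ ((i4.const_mul _).add (i2.const_mul _)) fun x => ?_
    · exact (hint (hP.mul ((contDiff_const.mul (hP1.pow 2)).mul hP2))).neg
    · simp only
      have h3 := mul_le_mul_of_nonneg_right (hs x) (sq_nonneg (partialDeriv i (partialDeriv i P) x))
      nlinarith [sq_nonneg (partialDeriv i P x ^ 2 + 3 * P x * partialDeriv i (partialDeriv i P) x)]
  rw [integral_add (i4.const_mul _) (i2.const_mul _), integral_const_mul,
    integral_const_mul] at h2
  linarith

end

/-! ### Fourier coefficients of the nonlinear terms -/

/-- `[u, v]` is a pair of `H²` functions with Neumann conditions and of `H²` norm at most `r ≤ η`, in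
dimension one, two or three. -/
structure SmallState (η r : ℝ) (u v : (Fin d → ℝ) → ℝ) : Prop where
  one_le_dim : 1 ≤ d
  dim_le : d ≤ 3
  memH2_fst : MemH2 u
  memH2_snd : MemH2 v
  neumann_fst : NeumannBC u
  neumann_snd : NeumannBC v
  nonneg : 0 ≤ r
  h2_le : h2NormSq u + h2NormSq v ≤ r ^ 2
  le : r ≤ η

lemma mem_disc_of_sq_le {S : RDSystem} {η r a b : ℝ} (hr : 0 ≤ r) (h : a ^ 2 + b ^ 2 ≤ r ^ 2)
    (hη : r ≤ η) : (a + S.Ubar, b + S.Vbar) ∈ S.disc η := by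
  simp only [RDSystem.disc, mem_ofPred_eq, add_sub_cancel_right]
  nlinarith

lemma norm_pair_le {S : RDSystem} {r a b : ℝ} (hr : 0 ≤ r) (h : a ^ 2 + b ^ 2 ≤ r ^ 2) :
    ‖((a + S.Ubar, b + S.Vbar) : ℝ × ℝ) - S.Wbar‖ ≤ r := by
  rw [RDSystem.Wbar, Prod.mk_sub_mk, add_sub_cancel_right, add_sub_cancel_right, Prod.norm_def]
  exact max_le (abs_le_of_sq_le_sq (by nlinarith [sq_nonneg b]) hr)
    (abs_le_of_sq_le_sq (by nlinarith [sq_nonneg a]) hr)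

section
variable {S : RDSystem} {η r C : ℝ} {u v : (Fin d → ℝ) → ℝ} {h : ℝ × ℝ → ℝ}

lemma SmallState.cosProj_le (H : SmallState η r u v) (N : ℕ) (x : Fin d → ℝ) :
    cosProj N u x ^ 2 + cosProj N v x ^ 2 ≤ r ^ 2 :=
  (add_le_add (cosProj_sq_le H.one_le_dim H.dim_le H.memH2_fst H.neumann_fst N x)
    (cosProj_sq_le H.one_le_dim H.dim_le H.memH2_snd H.neumann_snd N x)).trans H.h2_le

lemma SmallState.rep_le (H : SmallState η r u v) (x : Fin d → ℝ) :
    rep u x ^ 2 + rep v x ^ 2 ≤ r ^ 2 :=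
  (add_le_add (rep_sq_le H.one_le_dim H.dim_le H.memH2_fst H.neumann_fst x)
    (rep_sq_le H.one_le_dim H.dim_le H.memH2_snd H.neumann_snd x)).trans H.h2_le

lemma SmallState.proj_mem (H : SmallState η r u v) (N : ℕ) (x : Fin d → ℝ) :
    state S (cosProj N u) (cosProj N v) x ∈ S.disc η :=
  mem_disc_of_sq_le H.nonneg (H.cosProj_le N x) H.le

lemma SmallState.rep_mem (H : SmallState η r u v) (x : Fin d → ℝ) :
    state S (rep u) (rep v) x ∈ S.disc η :=
  mem_disc_of_sq_le H.nonneg (H.rep_le x) H.le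

lemma SmallState.continuous_state (H : SmallState η r u v) :
    Continuous (state S (rep u) (rep v)) :=
  ((continuous_rep H.one_le_dim H.dim_le H.memH2_fst H.neumann_fst).add continuous_const).prodMk
    ((continuous_rep H.one_le_dim H.dim_le H.memH2_snd H.neumann_snd).add continuous_const)

lemma SmallState.ae_state_eq (H : SmallState η r u v) :
    ∀ᵐ x ∂(volume.restrict (box d)), state S u v x = state S (rep u) (rep v) x := by
  filter_upwards [ae_eq_rep H.one_le_dim H.dim_le H.memH2_fst H.neumann_fst,
    ae_eq_rep H.one_le_dim H.dim_le H.memH2_snd H.neumann_snd] with x h1 h2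
  rw [state, state, h1, h2]

lemma SmallState.continuous_comp (H : SmallState η r u v) {Φ : ℝ × ℝ → ℝ}
    (hΦ : ContinuousOn Φ (S.disc η)) : Continuous fun x => Φ (state S (rep u) (rep v) x) :=
  hΦ.comp_continuous H.continuous_state H.rep_mem

lemma C2BoundOn.continuousOn {K : Set (ℝ × ℝ)} (hh : C2BoundOn K h C) : ContinuousOn h K :=
  fun p hp => (hh.contDiffAt p hp).continuousAt.continuousWithinAt

/-- Coefficients of a composite function are limits of those with the partial sums of `u, v`. -/
lemma SmallState.tendsto_cosCoef (H : SmallState η r u v) (hη : 0 < η) {Φ : ℝ × ℝ → ℝ}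
    (hΦ : ContinuousOn Φ (S.disc η)) (k : Fin d → ℤ) :
    Tendsto (fun N => cosCoef (fun x => Φ (state S (cosProj N u) (cosProj N v) x)) k) atTop
      (𝓝 (cosCoef (fun x => Φ (state S (rep u) (rep v) x)) k)) := by
  obtain ⟨B, hB⟩ := (isCompact_disc S hη).exists_bound_of_continuousOn hΦ
  refine Tendsto.const_mul _ (tendsto_integral_of_dominated_convergence (fun _ => B) ?_
    (integrable_const _) ?_ ?_)
  · intro N
    have hc : Continuous (state S (cosProj N u) (cosProj N v)) :=
      (contDiff_state S (contDiff_trigPoly _ _ _) (contDiff_trigPoly _ _ _)).continuous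
    exact ((hΦ.comp_continuous hc (H.proj_mem N)).mul
      (continuous_mode _ k)).aestronglyMeasurable
  · intro N
    refine Eventually.of_forall fun x => ?_
    rw [norm_mul]
    exact (mul_le_of_le_one_right (norm_nonneg _) (abs_mode_le _ _ _)).trans
      (hB _ (H.proj_mem N x))
  · refine Eventually.of_forall fun x => Tendsto.mul_const _ ?_
    refine ((hΦ _ (H.rep_mem x)).tendsto).comp ?_
    refine tendsto_nhdsWithin_iff.2 ⟨?_, Eventually.of_forall fun N => H.proj_mem N x⟩
    exact ((tendsto_cosProj H.one_le_dim H.dim_le H.memH2_fst H.neumann_fst x).add_const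
      _).prodMk_nhds ((tendsto_cosProj H.one_le_dim H.dim_le H.memH2_snd H.neumann_snd x).add_const _)

lemma contDiff_cosProj (N : ℕ) (u : (Fin d → ℝ) → ℝ) : ContDiff ℝ ∞ (cosProj N u) :=
  contDiff_trigPoly _ _ _

lemma partialDeriv_cosProj_face {u : (Fin d → ℝ) → ℝ} (hu : MemH2 u) {i : Fin d} (N : ℕ)
    {x : Fin d → ℝ} (hx : x i = 0 ∨ x i = Real.pi) : partialDeriv i (cosProj N u) x = 0 := by
  rw [partialDeriv_cosProj hu]
  exact trigPoly_eq_zero _ _ (by simp [sinAt]) hx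

lemma integral_partialDeriv₂_cosProj_sq_le {u : (Fin d → ℝ) → ℝ} (hu : MemH2 u)
    (hn : NeumannBC u) (i : Fin d) (N : ℕ) :
    ∫ x in box d, partialDeriv i (partialDeriv i (cosProj N u)) x ^ 2 ≤ h2NormSq u := by
  rw [partialDeriv_cosProj hu, partialDeriv_proj_weakPartial hu hn]
  exact (l2NormSq_proj_le (memL2_weakPartial₂ hu i i) N).trans (l2NormSq_weakPartial_self_le u i)

lemma integral_partialDeriv_cosProj_pow_four_le (hd1 : 1 ≤ d) (hd3 : d ≤ 3)
    {u : (Fin d → ℝ) → ℝ} (hu : MemH2 u) (hn : NeumannBC u) (i : Fin d) (N : ℕ) :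
    ∫ x in box d, partialDeriv i (cosProj N u) x ^ 4 ≤ 9 * h2NormSq u * h2NormSq u := by
  refine (integral_partialDeriv_pow_four_le (contDiff_trigPoly _ _ _)
    (fun x hx => partialDeriv_cosProj_face hu N hx)
    (fun x => cosProj_sq_le hd1 hd3 hu hn N x)).trans ?_
  have := h2NormSq_nonneg u
  gcongr
  exact integral_partialDeriv₂_cosProj_sq_le hu hn i N

lemma partialDeriv_sub_const (b : (Fin d → ℝ) → ℝ) (c : ℝ) (i : Fin d) :
    partialDeriv i (fun x => b x - c) = partialDeriv i b := by
  funext x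
  rw [partialDeriv, fderiv_sub_const, partialDeriv]

lemma SmallState.integral_partialDeriv₂_sq_le (H : SmallState η r u v)
    (hh : C2BoundOn (S.disc η) h C) (i : Fin d) (N : ℕ) :
    ∫ x in box d,
        partialDeriv i (partialDeriv i fun x => h (state S (cosProj N u) (cosProj N v) x)) x ^ 2
      ≤ 18 * (C * (1 + η) * r) ^ 2 := by
  have sP : ContDiff ℝ ∞ (cosProj N u) := contDiff_trigPoly _ _ _
  have sQ : ContDiff ℝ ∞ (cosProj N v) := contDiff_trigPoly _ _ _
  have s1 : ∀ {P : (Fin d → ℝ) → ℝ}, ContDiff ℝ ∞ P → ContDiff ℝ ∞ (partialDeriv i P) :=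
    fun hP => contDiff_partialDeriv hP (by simp) i
  have hint : ∀ {g : (Fin d → ℝ) → ℝ}, ContDiff ℝ ∞ g → IntegrableOn g (box d) :=
    fun hg => (memL2_of_continuous hg.continuous).integrableOn
  have h2 := contDiff_comp_state hh sP sQ (H.proj_mem N)
  have c2 : Continuous (partialDeriv i (partialDeriv i
      fun x => h (state S (cosProj N u) (cosProj N v) x))) :=
    (contDiff_partialDeriv (m := 0) (contDiff_partialDeriv (m := 1) h2 (by norm_num) i)
      (by norm_num) i).continuous
  have h3 : ∫ x in box d,
        partialDeriv i (partialDeriv i fun x => h (state S (cosProj N u) (cosProj N v) x)) x ^ 2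
      ≤ ∫ x in box d, 2 * C ^ 2 * (partialDeriv i (cosProj N u) x ^ 4
        + partialDeriv i (cosProj N v) x ^ 4
        + (partialDeriv i (partialDeriv i (cosProj N u)) x ^ 2
          + partialDeriv i (partialDeriv i (cosProj N v)) x ^ 2)) := by
    refine integral_mono (memL2_of_continuous c2).sq_integrable ?_
      fun x => partialDeriv₂_comp_state_sq_le hh sP sQ (H.proj_mem N) i x
    exact hint (contDiff_const.mul ((((s1 sP).pow 4).add ((s1 sQ).pow 4)).add
      (((s1 (s1 sP)).pow 2).add ((s1 (s1 sQ)).pow 2))))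
  rw [integral_const_mul, integral_add, integral_add, integral_add] at h3
  · have a1 := integral_partialDeriv_cosProj_pow_four_le H.one_le_dim H.dim_le H.memH2_fst
      H.neumann_fst i N
    have a2 := integral_partialDeriv_cosProj_pow_four_le H.one_le_dim H.dim_le H.memH2_snd
      H.neumann_snd i N
    have a3 := integral_partialDeriv₂_cosProj_sq_le H.memH2_fst H.neumann_fst i N
    have a4 := integral_partialDeriv₂_cosProj_sq_le H.memH2_snd H.neumann_snd i N
    have u0 := h2NormSq_nonneg u
    have v0 := h2NormSq_nonneg v
    have huv := H.h2_le
    have hr := H.nonneg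
    have hη := H.le
    have b1 : 9 * h2NormSq u * h2NormSq u + 9 * h2NormSq v * h2NormSq v ≤ 9 * (r ^ 2) ^ 2 := by
      nlinarith [mul_nonneg u0 v0]
    have b2 : 9 * (r ^ 2) ^ 2 + r ^ 2 ≤ 9 * ((1 + η) * r) ^ 2 := by
      have : r ^ 2 ≤ η ^ 2 := by gcongr
      nlinarith [mul_nonneg (sq_nonneg r) (sub_nonneg.2 this), mul_nonneg (sq_nonneg r) (hr.trans hη)]
    calc _ ≤ _ := h3
      _ ≤ 2 * C ^ 2 * (9 * ((1 + η) * r) ^ 2) := by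
        gcongr
        linarith
      _ = _ := by ring
  · exact hint ((s1 (s1 sP)).pow 2)
  · exact hint ((s1 (s1 sQ)).pow 2)
  · exact hint ((s1 sP).pow 4)
  · exact hint ((s1 sQ).pow 4)
  · exact hint (((s1 sP).pow 4).add ((s1 sQ).pow 4))
  · exact hint (((s1 (s1 sP)).pow 2).add ((s1 (s1 sQ)).pow 2))

lemma three_le_pi_pow (hd1 : 1 ≤ d) : 3 ≤ Real.pi ^ d :=
  Real.pi_gt_three.le.trans (le_self_pow₀ (by linarith [Real.pi_gt_three]) (by omega))

lemma normSq_sq_le_three_mul (hd3 : d ≤ 3) (k : Fin d → ℤ) :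
    normSq k ^ 2 ≤ 3 * ∑ i, (k i : ℝ) ^ 4 := by
  have h := sq_sum_le_card_mul_sum_sq (s := Finset.univ) (f := fun i => (k i : ℝ) ^ 2)
  rw [Finset.card_univ, Fintype.card_fin] at h
  have e : ∀ i, ((k i : ℝ) ^ 2) ^ 2 = (k i : ℝ) ^ 4 := fun i => by ring
  simp_rw [e] at h
  refine h.trans (mul_le_mul_of_nonneg_right (by exact_mod_cast hd3) ?_)
  exact Finset.sum_nonneg fun i _ => by positivity

/-- The function `h(w + W̄) - c` is in `H²`, quantitatively and in terms of its coefficients. -/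
lemma SmallState.sum_normSq_sq_mul_cosCoef_sq_le (H : SmallState η r u v) (hη : 0 < η)
    (hh : C2BoundOn (S.disc η) h C) (c : ℝ) (F : Finset (Fin d → ℤ)) :
    ∑ k ∈ F, normSq k ^ 2 * cosCoef (fun x => h (state S (rep u) (rep v) x) - c) k ^ 2
      ≤ (8 * (C * (1 + η) * r)) ^ 2 := by
  have hlim := tendsto_finsetSum F fun k (_ : k ∈ F) =>
    ((H.tendsto_cosCoef hη (S := S) (Φ := fun p => h p - c)
      (hh.continuousOn.sub continuousOn_const) k).pow 2).const_mul (normSq k ^ 2)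
  refine le_of_tendsto hlim (Eventually.of_forall fun N => ?_)
  set b : (Fin d → ℝ) → ℝ := fun x => h (state S (cosProj N u) (cosProj N v) x) - c with hb
  have hC : ContDiff ℝ 2 fun x => h (state S (cosProj N u) (cosProj N v) x) :=
    contDiff_comp_state hh (contDiff_trigPoly _ _ _) (contDiff_trigPoly _ _ _) (H.proj_mem N)
  have hbC : ContDiff ℝ 2 b := hC.sub contDiff_const
  have key : ∀ i : Fin d, Real.pi ^ d * ∑ k ∈ F, (k i : ℝ) ^ 4 * cosCoef b k ^ 2
      ≤ 18 * (C * (1 + η) * r) ^ 2 := by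
    intro i
    -- By the chain rule, the composite function inherits the Neumann condition.
    have hface : ∀ x, x i = 0 ∨ x i = Real.pi → partialDeriv i b x = 0 := by
      intro x hx
      rw [hb, partialDeriv_sub_const, partialDeriv_comp_state hh (contDiff_cosProj N u)
        (contDiff_cosProj N v) (H.proj_mem N), pairDeriv_eq_zero
        (partialDeriv_cosProj_face H.memH2_fst N hx) (partialDeriv_cosProj_face H.memH2_snd N hx),
        map_zero]
    have c2 : Continuous (partialDeriv i (partialDeriv i b)) :=
      (contDiff_partialDeriv (m := 0) (contDiff_partialDeriv (m := 1) hbC (by norm_num) i)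
        (by norm_num) i).continuous
    have h1 := sum_coef_sq_le (τ := fun _ => false) (memL2_of_continuous c2) F
    have h2 := H.integral_partialDeriv₂_sq_le hh i N
    have e : ∀ k : Fin d → ℤ, coef (fun _ => false) (partialDeriv i (partialDeriv i b)) k ^ 2
        = (k i : ℝ) ^ 4 * cosCoef b k ^ 2 := by
      intro k
      have := cosCoef_partialDeriv₂ hbC hface k
      rw [cosCoef] at this
      rw [this]; ring
    simp_rw [e] at h1
    refine h1.trans (le_trans (le_of_eq ?_) h2)
    rw [l2NormSq, hb, partialDeriv_sub_const]
  have h3 := Finset.sum_le_sum fun i (_ : i ∈ Finset.univ) => key i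
  rw [← Finset.mul_sum, Finset.sum_const, Finset.card_univ, Fintype.card_fin, nsmul_eq_mul,
    Finset.sum_comm] at h3
  have h4 : ∑ k ∈ F, normSq k ^ 2 * cosCoef b k ^ 2
      ≤ 3 * ∑ k ∈ F, ∑ i, (k i : ℝ) ^ 4 * cosCoef b k ^ 2 := by
    rw [Finset.mul_sum]
    refine Finset.sum_le_sum fun k _ => ?_
    rw [← Finset.sum_mul, ← mul_assoc]
    exact mul_le_mul_of_nonneg_right (normSq_sq_le_three_mul H.dim_le k) (sq_nonneg _)
  have h5 : (0 : ℝ) ≤ ∑ k ∈ F, ∑ i, (k i : ℝ) ^ 4 * cosCoef b k ^ 2 :=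
    Finset.sum_nonneg fun k _ => Finset.sum_nonneg fun i _ => by positivity
  have h6 := three_le_pi_pow H.one_le_dim
  have h7 : (d : ℝ) ≤ 3 := by exact_mod_cast H.dim_le
  have h8 : 0 ≤ (C * (1 + η) * r) ^ 2 := sq_nonneg _
  have h9 := mul_le_mul_of_nonneg_right h6 h5
  have h10 : (d : ℝ) * (18 * (C * (1 + η) * r) ^ 2) ≤ 3 * (18 * (C * (1 + η) * r) ^ 2) := by
    gcongr
  rw [mul_pow]
  linarith

/-- `ℓ¹` bound for coefficients of functions in `H²`, by the Cauchy–Schwarz inequality and the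
summability of `|k|⁻⁴` for `d ≤ 3`. -/
lemma sum_abs_le_of_normSq (hd1 : 1 ≤ d) (hd3 : d ≤ 3) {a : (Fin d → ℤ) → ℝ} {B : ℝ} (hB : 0 ≤ B)
    (F : Finset (Fin d → ℤ)) (h : ∑ k ∈ F, normSq k ^ 2 * a k ^ 2 ≤ B ^ 2) (hF : (0 : Fin d → ℤ) ∉ F) :
    ∑ k ∈ F, |a k| ≤ 9 * B := by
  have hpos : ∀ k ∈ F, 1 ≤ normSq k := fun k hk => one_le_normSq (by rintro rfl; exact hF hk)
  have h1 := Finset.sum_sq_le_sum_mul_sum_of_sq_le_mul F (r := fun k => |a k|)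
    (f := fun k => (normSq k ^ 2)⁻¹) (g := fun k => normSq k ^ 2 * a k ^ 2)
    (fun k _ => by positivity) (fun k _ => by positivity) (fun k hk => by
      have := hpos k hk
      rw [sq_abs]
      have : normSq k ^ 2 ≠ 0 := by positivity
      field_simp
      rfl)
  have h2 : ∑ k ∈ F, (normSq k ^ 2)⁻¹ ≤ 81 := by
    have h3 := sum_inv_h2Symbol_le hd1 hd3 F
    have h4 : (3 : ℝ) ^ d ≤ 3 ^ 3 := pow_le_pow_right₀ (by norm_num) hd3
    have h5 : ∑ k ∈ F, (normSq k ^ 2)⁻¹ ≤ ∑ k ∈ F, 3 * (h2Symbol k)⁻¹ := by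
      refine Finset.sum_le_sum fun k hk => ?_
      have h6 := hpos k hk
      have h7 := quartic_le k
      have h8 : h2Symbol k ≤ 3 * normSq k ^ 2 := by rw [h2Symbol]; nlinarith
      have h9 := h2Symbol_pos k
      rw [← div_eq_mul_inv, inv_eq_one_div, div_le_div_iff₀ (by positivity) h9]
      linarith
    rw [← Finset.mul_sum] at h5
    linarith
  have h3 : 0 ≤ ∑ k ∈ F, normSq k ^ 2 * a k ^ 2 := Finset.sum_nonneg fun k _ => by positivity
  refine abs_le_of_sq_le_sq' (h1.trans ?_) (by positivity) |>.2
  calc _ ≤ 81 * B ^ 2 := by gcongr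
    _ = _ := by ring

lemma C2BoundOn.abs_sub_le (hh : C2BoundOn (S.disc η) h C) {p : ℝ × ℝ} (hp : p ∈ S.disc η) :
    |h p - h S.Wbar| ≤ C * ‖p - S.Wbar‖ :=
  Convex.norm_image_sub_le_of_norm_fderiv_le
    (fun q hq => (hh.contDiffAt q hq).differentiableAt (by simp)) hh.bound₁ (convex_disc S η)
    (Wbar_mem_disc S η) hp

lemma C2BoundOn.norm_fderiv_sub_le (hh : C2BoundOn (S.disc η) h C) {p : ℝ × ℝ}
    (hp : p ∈ S.disc η) : ‖fderiv ℝ h p - fderiv ℝ h S.Wbar‖ ≤ C * ‖p - S.Wbar‖ :=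
  Convex.norm_image_sub_le_of_norm_fderiv_le
    (fun q hq => ((hh.contDiffAt q hq).fderiv_right (m := 1) (by norm_num)).differentiableAt
      (by simp)) hh.bound₂ (convex_disc S η) (Wbar_mem_disc S η) hp

lemma C2BoundOn.nonneg (hh : C2BoundOn (S.disc η) h C) : 0 ≤ C :=
  (abs_nonneg _).trans (hh.bound₀ _ (Wbar_mem_disc S η))

/-- The coefficients of `h(w + W̄) - h(W̄)` are summable, with a bound that is linear in `r`. -/
lemma SmallState.sum_abs_cosCoef_comp_le (H : SmallState η r u v) (hη : 0 < η)
    (hh : C2BoundOn (S.disc η) h C) (F : Finset (Fin d → ℤ)) :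
    ∑ k ∈ F, |cosCoef (fun x => h (state S (rep u) (rep v) x) - h S.Wbar) k|
      ≤ 73 * (C * (1 + η) * r) := by
  have hC := hh.nonneg
  have hr := H.nonneg
  have h0 : |cosCoef (fun x => h (state S (rep u) (rep v) x) - h S.Wbar) 0| ≤ C * r := by
    have h1 : ‖∫ x in box d, (h (state S (rep u) (rep v) x) - h S.Wbar) * mode (fun _ => false) 0 x‖
        ≤ C * r * (volume.restrict (box d)).real univ := by
      refine norm_integral_le_of_norm_le_const (Eventually.of_forall fun x => ?_)
      rw [norm_mul]
      refine (mul_le_of_le_one_right (norm_nonneg _) (abs_mode_le _ _ _)).trans ?_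
      refine (hh.abs_sub_le (H.rep_mem x)).trans ?_
      gcongr
      exact norm_pair_le hr (H.rep_le x)
    have h2 : (volume.restrict (box d)).real univ = Real.pi ^ d := by
      rw [Measure.real, Measure.restrict_apply_univ, volume_box,
        ENNReal.toReal_ofReal (by positivity)]
    rw [h2, Real.norm_eq_abs] at h1
    rw [cosCoef, coef, abs_mul, abs_of_pos (by positivity), inv_mul_eq_div,
      div_le_iff₀ (by positivity)]
    exact h1
  -- The mean is bounded pointwise; the other coefficients are controlled by second derivatives.
  have h1 : ∑ k ∈ F.erase 0, |cosCoef (fun x => h (state S (rep u) (rep v) x) - h S.Wbar) k|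
      ≤ 9 * (8 * (C * (1 + η) * r)) :=
    sum_abs_le_of_normSq H.one_le_dim H.dim_le (by positivity) _
      (H.sum_normSq_sq_mul_cosCoef_sq_le hη hh _ _) (by simp)
  have h2 : C * r ≤ C * (1 + η) * r := by
    have : 0 ≤ C * r := by positivity
    nlinarith
  have h3 : ∑ k ∈ F, |cosCoef (fun x => h (state S (rep u) (rep v) x) - h S.Wbar) k|
      ≤ |cosCoef (fun x => h (state S (rep u) (rep v) x) - h S.Wbar) 0|
        + ∑ k ∈ F.erase 0, |cosCoef (fun x => h (state S (rep u) (rep v) x) - h S.Wbar) k| := by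
    by_cases hF : (0 : Fin d → ℤ) ∈ F
    · exact (Finset.add_sum_erase F (fun k =>
        |cosCoef (fun x => h (state S (rep u) (rep v) x) - h S.Wbar) k|) hF).ge
    · rw [Finset.erase_eq_of_notMem hF]
      linarith [abs_nonneg (cosCoef (fun x => h (state S (rep u) (rep v) x) - h S.Wbar) 0)]
  linarith

/-- The Taylor remainder of first order of `h` at `W̄`. -/
def taylorRem (S : RDSystem) (h : ℝ × ℝ → ℝ) (p : ℝ × ℝ) : ℝ :=
  h p - h S.Wbar - fderiv ℝ h S.Wbar (p - S.Wbar)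

/-- The gradient of the Taylor remainder is quadratically small in `L²`. -/
lemma SmallState.sum_normSq_mul_taylorRem_sq_le (H : SmallState η r u v) (hη : 0 < η)
    (hh : C2BoundOn (S.disc η) h C) (F : Finset (Fin d → ℤ)) :
    Real.pi ^ d * ∑ k ∈ F, normSq k *
        cosCoef (fun x => taylorRem S h (state S (rep u) (rep v) x)) k ^ 2
      ≤ (C * r) ^ 2 * ∑ i, (l2NormSq (weakPartial i u) + l2NormSq (weakPartial i v)) := by
  have hcont : ContinuousOn (taylorRem S h) (S.disc η) :=
    (hh.continuousOn.sub continuousOn_const).sub (by fun_prop)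
  have hlim := (tendsto_finsetSum F fun k (_ : k ∈ F) =>
    ((H.tendsto_cosCoef hη (S := S) hcont k).pow 2).const_mul (normSq k)).const_mul (Real.pi ^ d)
  refine le_of_tendsto hlim (Eventually.of_forall fun N => ?_)
  set P := cosProj N u with hP
  set Q := cosProj N v with hQ
  have sP : ContDiff ℝ ∞ P := contDiff_trigPoly _ _ _
  have sQ : ContDiff ℝ ∞ Q := contDiff_trigPoly _ _ _
  have hmem : ∀ x, state S P Q x ∈ S.disc η := H.proj_mem N
  set R : (Fin d → ℝ) → ℝ := fun x => taylorRem S h (state S P Q x) with hR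
  have sγ : ContDiff ℝ 1 (state S P Q) := (contDiff_state S sP sQ).of_le (by simp)
  have hR1 : ContDiff ℝ 1 R :=
    (((contDiff_comp_state hh sP sQ hmem).of_le (by norm_num)).sub contDiff_const).sub
      ((fderiv ℝ h S.Wbar).contDiff.comp (sγ.sub contDiff_const))
  have key : ∀ i : Fin d, Real.pi ^ d * ∑ k ∈ F, (k i : ℝ) ^ 2 * cosCoef R k ^ 2
      ≤ (C * r) ^ 2 * (l2NormSq (weakPartial i u) + l2NormSq (weakPartial i v)) := by
    intro i
    have hd : ∀ x, partialDeriv i R x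
        = (fderiv ℝ h (state S P Q x) - fderiv ℝ h S.Wbar) (pairDeriv i P Q x) := by
      intro x
      have d1 : HasFDerivAt (state S P Q) (fderiv ℝ (state S P Q) x) x :=
        (sγ.differentiable (by simp) x).hasFDerivAt
      have d2 := ((hh.contDiffAt _ (hmem x)).differentiableAt (by simp)).hasFDerivAt.comp x d1
      have d3 : HasFDerivAt (fun x => fderiv ℝ h S.Wbar (state S P Q x - S.Wbar))
          ((fderiv ℝ h S.Wbar).comp (fderiv ℝ (state S P Q) x)) x :=
        (fderiv ℝ h S.Wbar).hasFDerivAt.comp x (d1.sub_const _)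
      have d4 : HasFDerivAt R ((fderiv ℝ h (state S P Q x)).comp (fderiv ℝ (state S P Q) x)
          - (fderiv ℝ h S.Wbar).comp (fderiv ℝ (state S P Q) x)) x :=
        (d2.sub_const _).sub d3
      rw [partialDeriv, d4.fderiv, _root_.sub_apply, ContinuousLinearMap.comp_apply,
        ContinuousLinearMap.comp_apply, fderiv_state_apply S (sP.differentiable (by simp) x)
        (sQ.differentiable (by simp) x), _root_.sub_apply]
    have h1 := sum_coef_sq_le (τ := sinAt i) (memL2_of_continuous
      (contDiff_partialDeriv (m := 0) hR1 (by norm_num) i).continuous) F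
    simp_rw [coef_partialDeriv hR1 i, neg_sq, mul_pow] at h1
    refine h1.trans ?_
    have mP : MemL2 (partialDeriv i P) :=
      memL2_of_continuous (contDiff_partialDeriv (m := 0) sP (by simp) i).continuous
    have mQ : MemL2 (partialDeriv i Q) :=
      memL2_of_continuous (contDiff_partialDeriv (m := 0) sQ (by simp) i).continuous
    have h2 : l2NormSq (partialDeriv i R) ≤ ∫ x in box d,
        (C * r) ^ 2 * (partialDeriv i P x ^ 2 + partialDeriv i Q x ^ 2) := by
      refine integral_mono (memL2_of_continuous
        (contDiff_partialDeriv (m := 0) hR1 (by norm_num) i).continuous).sq_integrable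
        ((mP.sq_integrable.add mQ.sq_integrable).const_mul _) fun x => ?_
      simp only
      rw [hd]
      have h3 : ‖(fderiv ℝ h (state S P Q x) - fderiv ℝ h S.Wbar) (pairDeriv i P Q x)‖
          ≤ (C * r) * ‖pairDeriv i P Q x‖ := by
        refine (ContinuousLinearMap.le_opNorm _ _).trans ?_
        gcongr
        refine (hh.norm_fderiv_sub_le (hmem x)).trans ?_
        have := hh.nonneg
        gcongr
        exact norm_pair_le H.nonneg (H.cosProj_le N x)
      rw [Real.norm_eq_abs] at h3
      rw [← sq_abs]
      calc _ ≤ ((C * r) * ‖pairDeriv i P Q x‖) ^ 2 := by gcongr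
        _ = (C * r) ^ 2 * ‖pairDeriv i P Q x‖ ^ 2 := by ring
        _ ≤ _ := by gcongr; exact norm_pairDeriv_sq_le i x
    rw [integral_const_mul, integral_add mP.sq_integrable mQ.sq_integrable] at h2
    refine h2.trans ?_
    have h4 : ∫ x in box d, partialDeriv i P x ^ 2 ≤ l2NormSq (weakPartial i u) := by
      rw [hP, partialDeriv_cosProj H.memH2_fst]
      exact l2NormSq_proj_le (memL2_weakPartial H.memH2_fst i) N
    have h5 : ∫ x in box d, partialDeriv i Q x ^ 2 ≤ l2NormSq (weakPartial i v) := by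
      rw [hQ, partialDeriv_cosProj H.memH2_snd]
      exact l2NormSq_proj_le (memL2_weakPartial H.memH2_snd i) N
    gcongr
  have h3 := Finset.sum_le_sum fun i (_ : i ∈ Finset.univ) => key i
  rw [← Finset.mul_sum, ← Finset.mul_sum, Finset.sum_comm] at h3
  refine le_trans (le_of_eq ?_) h3
  congr 1
  refine Finset.sum_congr rfl fun k _ => ?_
  rw [← Finset.sum_mul, normSq]

end

/-! ### A Hardy inequality for the normal derivative -/

/-- The function `xᵢ (π - xᵢ)`, comparable to the distance to the faces `xᵢ = 0, π`. -/
def faceDist (i : Fin d) (x : Fin d → ℝ) : ℝ := x i * (Real.pi - x i)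

lemma faceDist_nonneg {i : Fin d} {x : Fin d → ℝ} (hx : x ∈ cbox d) : 0 ≤ faceDist i x :=
  mul_nonneg (hx.1 i) (sub_nonneg.2 (hx.2 i))

lemma contDiff_faceDist (i : Fin d) : ContDiff ℝ ∞ (faceDist (d := d) i) := by
  unfold faceDist
  fun_prop

lemma partialDeriv_of_coord {i : Fin d} {F : (Fin d → ℝ) → ℝ} {ψ : ℝ → ℝ} {ψ' : ℝ}
    {x : Fin d → ℝ} (hF : F = fun y => ψ (y i)) (h : HasDerivAt ψ ψ' (x i)) :
    partialDeriv i F x = ψ' := by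
  subst hF
  have h1 : HasFDerivAt (fun y : Fin d → ℝ => y i)
      (ContinuousLinearMap.proj (R := ℝ) (φ := fun _ => ℝ) i) x :=
    (ContinuousLinearMap.proj (R := ℝ) (φ := fun _ : Fin d => ℝ) i).hasFDerivAt
  have h2 := h.comp_hasFDerivAt x h1
  have h3 : fderiv ℝ (fun y : Fin d → ℝ => ψ (y i)) x = _ := h2.fderiv
  rw [partialDeriv, h3]
  simp

/-- Hardy's inequality for smooth functions that vanish on the faces `xᵢ = 0, π`: integrate by
parts with the weight `(2xᵢ - π) / (xᵢ(π - xᵢ) + δ)`, whose derivative dominates its square. -/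
lemma integral_sq_div_le_of_contDiff {G : (Fin d → ℝ) → ℝ} (hG : ContDiff ℝ ∞ G) {i : Fin d}
    (h0 : ∀ x, x i = 0 ∨ x i = Real.pi → G x = 0) {δ : ℝ} (hδ : 0 < δ) :
    ∫ x in box d, (G x / (faceDist i x + δ)) ^ 2 ≤ 2 * l2NormSq (partialDeriv i G) := by
  set ψ : ℝ → ℝ := fun s => (2 * s - Real.pi) / (s * (Real.pi - s) + δ) with hψ
  set W : (Fin d → ℝ) → ℝ := fun x => ψ (x i) with hW
  have hpos : ∀ x ∈ cbox d, 0 < faceDist i x + δ := fun x hx => by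
    linarith [faceDist_nonneg (i := i) hx]
  have hG1 : ContDiff ℝ 1 G := hG.of_le (by simp)
  have hG2 : ContDiff ℝ 1 fun x => G x ^ 2 := hG1.pow 2
  have cdW : ∀ x ∈ cbox d, ContDiffAt ℝ 1 W x := by
    intro x hx
    have hne : x i * (Real.pi - x i) + δ ≠ 0 := (hpos x hx).ne'
    simp only [hW, hψ]
    fun_prop (disch := exact hne)
  have h1 := integral_mul_partialDeriv (F := fun x => G x ^ 2) (G := W) i
    (fun x _ => hG2.contDiffAt) cdW (fun x hx => by rw [h0 x hx]; ring)
  have dG2 : ∀ x, partialDeriv i (fun x => G x ^ 2) x = 2 * G x * partialDeriv i G x := by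
    intro x
    have := ((hG1.differentiable (by simp) x).hasFDerivAt.pow 2).fderiv
    change (fderiv ℝ (fun x => G x ^ 2) x) (Pi.single i 1)
      = 2 * G x * (fderiv ℝ G x) (Pi.single i 1)
    rw [this]
    simp
  simp_rw [dG2] at h1
  have dW : ∀ x ∈ cbox d, partialDeriv i W x
      = (2 * (faceDist i x + δ) + (2 * x i - Real.pi) ^ 2) / (faceDist i x + δ) ^ 2 := by
    intro x hx
    refine partialDeriv_of_coord hW ?_
    have e1 : HasDerivAt (fun s : ℝ => 2 * s - Real.pi) 2 (x i) := by
      simpa using ((hasDerivAt_id' (x i)).const_mul 2).sub_const Real.pi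
    have e2 : HasDerivAt (fun s : ℝ => s * (Real.pi - s) + δ) (Real.pi - 2 * x i) (x i) := by
      refine (((hasDerivAt_id' (x i)).mul ((hasDerivAt_id' (x i)).const_sub Real.pi)).add_const
        δ).congr_deriv ?_
      ring
    refine (e1.div e2 (hpos x hx).ne').congr_deriv ?_
    rw [faceDist]
    ring
  have cW : ContinuousOn W (cbox d) := fun x hx => (cdW x hx).continuousAt.continuousWithinAt
  have cDW := continuousOn_partialDeriv i cdW
  have cDG : Continuous (partialDeriv i G) :=
    (contDiff_partialDeriv (m := 0) hG1 (by norm_num) i).continuous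
  have cq : ContinuousOn (fun x => G x / (faceDist i x + δ)) (cbox d) :=
    hG.continuous.continuousOn.div
      ((contDiff_faceDist i).continuous.continuousOn.add continuousOn_const)
      fun x hx => (hpos x hx).ne'
  have iq : IntegrableOn (fun x => (G x / (faceDist i x + δ)) ^ 2) (box d) :=
    (memL2_of_continuousOn cq).sq_integrable
  have iDG : IntegrableOn (fun x => partialDeriv i G x ^ 2) (box d) :=
    (memL2_of_continuous cDG).sq_integrable
  have hpi := Real.pi_gt_three
  have h2 : ∫ x in box d, Real.pi ^ 2 / 2 * (G x / (faceDist i x + δ)) ^ 2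
      ≤ ∫ x in box d, G x ^ 2 * partialDeriv i W x := by
    refine setIntegral_mono_on (iq.const_mul _) ?_ measurableSet_box fun x hx => ?_
    · exact ((memL2_of_continuousOn ((hG.continuous.continuousOn.pow 2).mul cDW))).integrableOn
    · have hx' := box_subset_cbox hx
      have hp := hpos x hx'
      rw [dW x hx', div_pow, ← mul_div_assoc, ← mul_div_assoc]
      refine div_le_div_of_nonneg_right ?_ (sq_nonneg _)
      rw [mul_comm]
      refine mul_le_mul_of_nonneg_left ?_ (sq_nonneg _)
      rw [faceDist]
      nlinarith [sq_nonneg (2 * x i - Real.pi)]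
  have h3 : -∫ x in box d, 2 * G x * partialDeriv i G x * W x
      ≤ ∫ x in box d, (Real.pi ^ 2 / 4 * (G x / (faceDist i x + δ)) ^ 2
        + 4 * partialDeriv i G x ^ 2) := by
    rw [← integral_neg]
    refine setIntegral_mono_on ?_ ((iq.const_mul _).add (iDG.const_mul _)) measurableSet_box
      fun x hx => ?_
    · exact ((memL2_of_continuousOn (((continuousOn_const.mul
        hG.continuous.continuousOn).mul cDG.continuousOn).mul cW))).integrableOn.neg
    · have hx' := box_subset_cbox hx
      have hp := hpos x hx'
      set q := G x / (faceDist i x + δ) with hq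
      have e : G x * W x = (2 * x i - Real.pi) * q := by
        rw [hq, hW]
        simp only [hψ, faceDist]
        ring
      have hb : (2 * x i - Real.pi) ^ 2 ≤ Real.pi ^ 2 := by
        have h1 := hx'.1 i
        have h2 := hx'.2 i
        simp only [Pi.zero_apply] at h1 h2
        nlinarith
      have e2 : 2 * G x * partialDeriv i G x * W x
          = 2 * ((2 * x i - Real.pi) * q) * partialDeriv i G x := by rw [← e]; ring
      rw [e2]
      have h5 := mul_le_mul_of_nonneg_right hb (sq_nonneg q)
      nlinarith [sq_nonneg ((2 * x i - Real.pi) * q + 4 * partialDeriv i G x)]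
  rw [integral_add (iq.const_mul _) (iDG.const_mul _)] at h3
  simp_rw [integral_const_mul] at h2 h3
  rw [l2NormSq]
  have h4 : (0 : ℝ) ≤ ∫ x in box d, (G x / (faceDist i x + δ)) ^ 2 :=
    integral_nonneg fun _ => sq_nonneg _
  have h5 : (9 : ℝ) ≤ Real.pi ^ 2 := by nlinarith
  rw [h1] at h2
  nlinarith [mul_le_mul_of_nonneg_right h5 h4]

/-- Hardy's inequality for `∂ᵢz`, which vanishes on the faces `xᵢ = 0, π` by the Neumann
condition. -/
lemma integral_weakPartial_sq_div_le {z : (Fin d → ℝ) → ℝ} (hz : MemH2 z) (hn : NeumannBC z)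
    (i : Fin d) {δ : ℝ} (hδ : 0 < δ) :
    ∫ x in box d, (weakPartial i z x / (faceDist i x + δ)) ^ 2 ≤ 2 * h2NormSq z := by
  set g := weakPartial i z with hg
  have mg : MemL2 g := memL2_weakPartial hz i
  have hpos : ∀ x ∈ cbox d, 0 < faceDist i x + δ := fun x hx => by
    linarith [faceDist_nonneg (i := i) hx]
  have cw : ContinuousOn (fun x => (faceDist i x + δ)⁻¹) (cbox d) :=
    ContinuousOn.inv₀ ((contDiff_faceDist i).continuous.continuousOn.add continuousOn_const)
      fun x hx => (hpos x hx).ne'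
  obtain ⟨B, hB⟩ := isCompact_cbox.exists_bound_of_continuousOn cw
  have mwm : AEStronglyMeasurable (fun x => (faceDist i x + δ)⁻¹) (volume.restrict (box d)) :=
    (cw.mono box_subset_cbox).aestronglyMeasurable measurableSet_box
  have hmul : ∀ {f : (Fin d → ℝ) → ℝ}, MemL2 f → MemL2 fun x => f x / (faceDist i x + δ) := by
    intro f hf
    refine MemLp.of_le_mul (c := B) hf (hf.1.mul mwm) ?_
    filter_upwards [ae_restrict_mem measurableSet_box] with x hx
    rw [div_eq_mul_inv, norm_mul, mul_comm]
    exact mul_le_mul_of_nonneg_right (hB x (box_subset_cbox hx)) (norm_nonneg _)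
  have mgw := hmul mg
  have hlim := tendsto_integral_proj_mul (sinAt i) mg (hmul mgw)
  have hN : ∀ N, ∫ x in box d, proj (sinAt i) N g x * (g x / (faceDist i x + δ) / (faceDist i x + δ))
      ≤ h2NormSq z + 1 / 2 * ∫ x in box d, (g x / (faceDist i x + δ)) ^ 2 := by
    intro N
    have mG := hmul (memL2_proj (sinAt i) N g)
    have h1 := integral_sq_div_le_of_contDiff (G := proj (sinAt i) N g) (i := i)
      (contDiff_trigPoly _ _ _) (fun x hx => trigPoly_eq_zero _ _ (by simp [sinAt]) hx) hδ
    rw [hg, partialDeriv_proj_weakPartial hz hn, ← hg] at h1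
    have h2 := (l2NormSq_proj_le (τ := fun _ => false) (memL2_weakPartial₂ hz i i) N).trans
      (l2NormSq_weakPartial_self_le z i)
    have h3 : ∫ x in box d, proj (sinAt i) N g x * (g x / (faceDist i x + δ) / (faceDist i x + δ))
        ≤ ∫ x in box d, (1 / 2 * (proj (sinAt i) N g x / (faceDist i x + δ)) ^ 2
          + 1 / 2 * (g x / (faceDist i x + δ)) ^ 2) := by
      refine integral_mono ((memL2_proj (sinAt i) N g).mul_integrable (hmul mgw))
        ((mG.sq_integrable.const_mul _).add (mgw.sq_integrable.const_mul _)) fun x => ?_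
      have e : proj (sinAt i) N g x * (g x / (faceDist i x + δ) / (faceDist i x + δ))
          = (proj (sinAt i) N g x / (faceDist i x + δ)) * (g x / (faceDist i x + δ)) := by ring
      simp only [e]
      nlinarith [sq_nonneg (proj (sinAt i) N g x / (faceDist i x + δ) - g x / (faceDist i x + δ))]
    rw [integral_add (mG.sq_integrable.const_mul _) (mgw.sq_integrable.const_mul _),
      integral_const_mul, integral_const_mul] at h3
    linarith
  -- In the limit the last term of `hN` is half of the left-hand side, and is absorbed.
  have h5 := le_of_tendsto' hlim hN
  have h6 : ∫ x in box d, g x * (g x / (faceDist i x + δ) / (faceDist i x + δ))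
      = ∫ x in box d, (g x / (faceDist i x + δ)) ^ 2 := by
    congr 1; funext x; ring
  linarith

/-! ### The evolution of the Fourier coefficients -/

/-- The indicator of the neighbourhood of the faces `xᵢ = 0, π` where the cutoff varies. -/
def faceLayer (n : ℕ) (i : Fin d) : (Fin d → ℝ) → ℝ :=
  {x | n * faceDist i x ≤ 2}.indicator fun _ => 1

lemma measurableSet_faceLayer (n : ℕ) (i : Fin d) : MeasurableSet {x | n * faceDist i x ≤ 2} :=
  measurableSet_le (((contDiff_faceDist i).continuous.measurable).const_mul _) measurable_const

lemma memL2_faceLayer (n : ℕ) (i : Fin d) : MemL2 (faceLayer n i) :=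
  MemLp.indicator (measurableSet_faceLayer n i) (memL2_of_continuous continuous_const)

lemma tendsto_l2NormSq_faceLayer (i : Fin d) :
    Tendsto (fun n => l2NormSq (faceLayer n i)) atTop (𝓝 0) := by
  have : (0 : ℝ) = ∫ x in box d, (0 : ℝ) := by simp
  rw [this]
  refine tendsto_integral_of_dominated_convergence (fun _ => 1)
    (fun n => (memL2_faceLayer n i).sq_integrable.aestronglyMeasurable) (integrable_const _) ?_ ?_
  · intro n
    refine Eventually.of_forall fun x => ?_
    by_cases h : n * faceDist i x ≤ 2 <;> simp [faceLayer, h]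
  · filter_upwards [ae_restrict_mem measurableSet_box] with x hx
    have hs := hx i (Set.mem_univ i)
    have hy : 0 < faceDist i x := mul_pos hs.1 (by linarith [hs.2])
    refine tendsto_const_nhds.congr' ?_
    filter_upwards [(tendsto_nat_mul_atTop hy).eventually_gt_atTop 2] with n hn
    simp [faceLayer, hn]

lemma tendsto_l2NormSq_one_sub_cutoff :
    Tendsto (fun n => l2NormSq (fun x : Fin d → ℝ => 1 - cutoff n x)) atTop (𝓝 0) := by
  have : (0 : ℝ) = ∫ x in box d, (0 : ℝ) := by simp
  rw [this]
  refine tendsto_integral_of_dominated_convergence (fun _ => 1) ?_ (integrable_const _) ?_ ?_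
  · intro n
    exact ((continuous_const.sub (contDiff_cutoff n).continuous).pow 2).aestronglyMeasurable
  · intro n
    refine Eventually.of_forall fun x => ?_
    have h1 := cutoff_nonneg n x
    have h2 := cutoff_le_one n x
    rw [Real.norm_eq_abs, abs_of_nonneg (sq_nonneg _)]
    nlinarith
  · filter_upwards [ae_restrict_mem measurableSet_box] with x hx
    have := ((tendsto_cutoff hx).const_sub 1).pow 2
    simpa using this

/-- Where the cutoff varies, its derivative is at most of the order of the inverse distance to the
boundary. -/
lemma abs_deriv_bump_le_div {n : ℕ} (hn : 0 < n) (i : Fin d) {x : Fin d → ℝ} (hx : x ∈ box d) :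
    |deriv (bump n) (x i)| ≤ 3 * Real.pi * transBound * faceLayer n i x
      / (faceDist i x + 1 / n) := by
  have hn' : (0 : ℝ) < n := by exact_mod_cast hn
  have hs := hx i (Set.mem_univ i)
  have hy : 0 < faceDist i x := mul_pos hs.1 (by linarith [hs.2])
  have hB := transBound_pos
  rcases lt_or_ge 2 (n * faceDist i x) with h | h
  · rw [deriv_bump_eq_zero n h]
    have : faceLayer n i x = 0 := by simp [faceLayer, h]
    simp [this]
  · have e : faceLayer n i x = 1 := by simp [faceLayer, h]
    rw [e, mul_one, le_div_iff₀ (by positivity)]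
    calc _ ≤ n * Real.pi * transBound * (faceDist i x + 1 / n) := by
          gcongr; exact abs_deriv_bump_le n hs
      _ = Real.pi * transBound * (n * faceDist i x + 1) := by field_simp
      _ ≤ Real.pi * transBound * (2 + 1) := by gcongr
      _ = _ := by ring

lemma l2NormSq_mul_le {a g : (Fin d → ℝ) → ℝ} {C : ℝ} (ha : Continuous a)
    (hC : ∀ x, |a x| ≤ C) (hg : MemL2 g) :
    MemL2 (fun x => a x * g x) ∧ l2NormSq (fun x => a x * g x) ≤ C ^ 2 * l2NormSq g := by
  have m : MemL2 (fun x => a x * g x) := by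
    refine MemLp.of_le_mul (c := C) hg (ha.aestronglyMeasurable.mul hg.1) ?_
    refine Eventually.of_forall fun x => ?_
    rw [norm_mul]
    exact mul_le_mul_of_nonneg_right (hC x) (norm_nonneg _)
  refine ⟨m, ?_⟩
  rw [l2NormSq, l2NormSq, ← integral_const_mul]
  refine integral_mono m.sq_integrable (hg.sq_integrable.const_mul _) fun x => ?_
  simp only [mul_pow]
  have : a x ^ 2 ≤ C ^ 2 := by rw [← sq_abs]; have := abs_nonneg (a x); gcongr; exact hC x
  gcongr

/-- A cosine mode is a limit of test functions for the purpose of testing the flux `a ∂ᵢz`; the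
rate depends on the `H²` norm of `z` and the bound of `a` only. -/
lemma abs_flux_cutoff_sub_le {a z : (Fin d → ℝ) → ℝ} {C η : ℝ} (ha : Continuous a)
    (hC : ∀ x, |a x| ≤ C) (hz : MemH2 z) (hn : NeumannBC z) (hη : 0 ≤ η)
    (hzη : h2NormSq z ≤ η ^ 2) (i : Fin d) (k : Fin d → ℤ) {n : ℕ} (hn0 : 0 < n) :
    |(∫ x in box d, a x * weakPartial i z x * partialDeriv i (fun y => cutoff n y * cosMode k y) x)
        - ∫ x in box d, a x * weakPartial i z x * partialDeriv i (cosMode k) x|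
      ≤ C * η * |(k i : ℝ)| * Real.sqrt (l2NormSq fun x : Fin d → ℝ => 1 - cutoff n x)
        + C * (3 * Real.pi * transBound) * (2 * η) * Real.sqrt (l2NormSq (faceLayer n i)) := by
  have hn' : (0 : ℝ) < n := by exact_mod_cast hn0
  set g := weakPartial i z with hg
  have mg : MemL2 g := memL2_weakPartial hz i
  have hC0 : 0 ≤ C := (abs_nonneg _).trans (hC 0)
  have hm := contDiff_mode (fun _ => false) k
  have cm : Continuous (partialDeriv i (cosMode k)) :=
    (hm.continuous_fderiv (by simp)).clm_apply continuous_const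
  have c1 : Continuous (fun x : Fin d → ℝ => 1 - cutoff n x) :=
    continuous_const.sub (contDiff_cutoff n).continuous
  have cc : Continuous (partialDeriv i (cutoff (d := d) n)) :=
    ((contDiff_cutoff n).continuous_fderiv (by simp)).clm_apply continuous_const
  obtain ⟨mag, hag⟩ := l2NormSq_mul_le ha hC mg
  have e : ∀ x, partialDeriv i (fun y => cutoff n y * cosMode k y) x
      = cutoff n x * partialDeriv i (cosMode k) x + partialDeriv i (cutoff n) x * cosMode k x :=
    fun x => partialDeriv_mul i ((contDiff_cutoff n).differentiable (by simp) x)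
      (hm.differentiable (by simp) x)
  have hb : ∀ x, |partialDeriv i (cosMode k) x| ≤ |(k i : ℝ)| := by
    intro x
    rw [cosMode, partialDeriv_mode, abs_mul]
    refine (mul_le_of_le_one_right (abs_nonneg _) (abs_mode_le _ _ _)).trans ?_
    simp [parity]
  obtain ⟨mk, hk⟩ := l2NormSq_mul_le cm hb (memL2_of_continuous c1)
  have hsplit : (∫ x in box d, a x * g x * partialDeriv i (fun y => cutoff n y * cosMode k y) x)
        - ∫ x in box d, a x * g x * partialDeriv i (cosMode k) x
      = -(∫ x in box d, a x * g x * (partialDeriv i (cosMode k) x * (1 - cutoff n x)))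
        + ∫ x in box d, a x * g x * (partialDeriv i (cutoff n) x * cosMode k x) := by
    rw [← integral_sub, ← integral_neg, ← integral_add]
    · congr 1; funext x; rw [e]; ring
    · exact (mag.mul_integrable mk).neg
    · exact mag.mul_integrable (memL2_of_continuous (cc.mul hm.continuous))
    · simp_rw [e]
      exact mag.mul_integrable (memL2_of_continuous
        (((contDiff_cutoff n).continuous.mul cm).add (cc.mul hm.continuous)))
    · exact mag.mul_integrable (memL2_of_continuous cm)
  rw [hsplit]
  refine (abs_add_le _ _).trans (add_le_add ?_ ?_)
  · rw [abs_neg]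
    refine (abs_integral_mul_le mag mk).trans ?_
    have h1 : Real.sqrt (l2NormSq fun x => a x * g x) ≤ C * η := by
      rw [← Real.sqrt_sq (by positivity : 0 ≤ C * η)]
      apply Real.sqrt_le_sqrt
      refine hag.trans ?_
      rw [mul_pow]
      gcongr
      exact (l2NormSq_weakPartial_le z i).trans hzη
    have h2 : Real.sqrt (l2NormSq fun x => partialDeriv i (cosMode k) x * (1 - cutoff n x))
        ≤ |(k i : ℝ)| * Real.sqrt (l2NormSq fun x : Fin d → ℝ => 1 - cutoff n x) := by
      rw [← Real.sqrt_sq (abs_nonneg (k i : ℝ)), ← Real.sqrt_mul (sq_nonneg _)]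
      exact Real.sqrt_le_sqrt hk
    calc _ ≤ (C * η) * (|(k i : ℝ)| * Real.sqrt (l2NormSq fun x : Fin d → ℝ => 1 - cutoff n x)) := by
          gcongr
      _ = _ := by ring
  · have hpos : ∀ x ∈ cbox d, 0 < faceDist i x + 1 / n := fun x hx => by
      have := faceDist_nonneg (i := i) hx
      positivity
    have hHardy := integral_weakPartial_sq_div_le hz hn i (δ := 1 / n) (by positivity)
    rw [← hg] at hHardy
    have cw : ContinuousOn (fun x => (faceDist i x + 1 / (n : ℝ))⁻¹) (cbox d) :=
      ContinuousOn.inv₀ ((contDiff_faceDist i).continuous.continuousOn.add continuousOn_const)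
        fun x hx => (hpos x hx).ne'
    obtain ⟨B, hB⟩ := isCompact_cbox.exists_bound_of_continuousOn cw
    have mq : MemL2 fun x => g x / (faceDist i x + 1 / n) := by
      refine MemLp.of_le_mul (c := B) mg (mg.1.mul
        ((cw.mono box_subset_cbox).aestronglyMeasurable measurableSet_box)) ?_
      filter_upwards [ae_restrict_mem measurableSet_box] with x hx
      rw [div_eq_mul_inv, norm_mul, mul_comm]
      exact mul_le_mul_of_nonneg_right (hB x (box_subset_cbox hx)) (norm_nonneg _)
    have mq' : MemL2 fun x => |g x / (faceDist i x + 1 / n)| := MemLp.norm mq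
    set A := C * (3 * Real.pi * transBound) with hA
    have hA0 : 0 ≤ A := by have := transBound_pos; positivity
    have h1 : |∫ x in box d, a x * g x * (partialDeriv i (cutoff n) x * cosMode k x)|
        ≤ ∫ x in box d, A * (|g x / (faceDist i x + 1 / n)| * faceLayer n i x) := by
      refine (abs_integral_le_integral_abs).trans (setIntegral_mono_on ?_ ?_ measurableSet_box
        fun x hx => ?_)
      · exact (mag.mul_integrable (memL2_of_continuous (cc.mul hm.continuous))).abs
      · exact (mq'.mul_integrable (memL2_faceLayer n i)).const_mul _
      · have hp := hpos x (box_subset_cbox hx)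
        have h2 := (abs_partialDeriv_cutoff_le n i x).trans (abs_deriv_bump_le_div hn0 i hx)
        have h3 : |partialDeriv i (cutoff n) x * cosMode k x|
            ≤ 3 * Real.pi * transBound * faceLayer n i x / (faceDist i x + 1 / n) := by
          rw [abs_mul]
          exact (mul_le_of_le_one_right (abs_nonneg _) (abs_mode_le _ _ _)).trans h2
        rw [abs_mul, abs_mul]
        calc _ ≤ C * |g x| * (3 * Real.pi * transBound * faceLayer n i x
                / (faceDist i x + 1 / n)) := by
              gcongr; exact hC x
          _ = _ := by rw [abs_div, abs_of_pos hp, hA]; ring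
    have h2 := abs_integral_mul_le mq' (memL2_faceLayer n i)
    have h3 : Real.sqrt (l2NormSq fun x => |g x / (faceDist i x + 1 / n)|) ≤ 2 * η := by
      rw [← Real.sqrt_sq (by positivity : 0 ≤ 2 * η)]
      apply Real.sqrt_le_sqrt
      simp only [l2NormSq, sq_abs]
      refine hHardy.trans ?_
      nlinarith [h2NormSq_nonneg z]
    rw [integral_const_mul] at h1
    calc _ ≤ _ := h1
      _ ≤ A * (Real.sqrt (l2NormSq fun x => |g x / (faceDist i x + 1 / n)|)
          * Real.sqrt (l2NormSq (faceLayer n i))) := by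
        gcongr
        exact (le_abs_self _).trans h2
      _ ≤ A * ((2 * η) * Real.sqrt (l2NormSq (faceLayer n i))) := by gcongr
      _ = _ := by ring

section
variable {S : RDSystem} {η C T : ℝ} {u v z : ℝ → (Fin d → ℝ) → ℝ} {D F : ℝ × ℝ → ℝ}

lemma abs_source_cutoff_sub_le {a : (Fin d → ℝ) → ℝ} (ha : Continuous a)
    (hC : ∀ x, |a x| ≤ C) (k : Fin d → ℤ) (n : ℕ) :
    |(∫ x in box d, a x * (cutoff n x * cosMode k x)) - ∫ x in box d, a x * cosMode k x|
      ≤ C * Real.sqrt (Real.pi ^ d)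
        * Real.sqrt (l2NormSq fun x : Fin d → ℝ => 1 - cutoff n x) := by
  have hC0 : 0 ≤ C := (abs_nonneg _).trans (hC 0)
  have ma : MemL2 a := memL2_of_continuous ha
  have cc : Continuous (cutoff (d := d) n) := (contDiff_cutoff n).continuous
  have ck : Continuous (cosMode k) := continuous_mode _ k
  have m1 : MemL2 (fun x : Fin d → ℝ => 1 - cutoff n x) :=
    memL2_of_continuous (continuous_const.sub cc)
  obtain ⟨mk, hk⟩ := l2NormSq_mul_le ck (fun x => abs_mode_le _ k x) m1
  have e : (∫ x in box d, a x * (cutoff n x * cosMode k x)) - ∫ x in box d, a x * cosMode k x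
      = -∫ x in box d, a x * (cosMode k x * (1 - cutoff n x)) := by
    rw [← integral_sub, ← integral_neg]
    · congr 1; funext x; ring
    · exact ma.mul_integrable (memL2_of_continuous (cc.mul ck))
    · exact ma.mul_integrable (memL2_of_continuous ck)
  rw [e, abs_neg]
  refine (abs_integral_mul_le ma mk).trans ?_
  have h1 : Real.sqrt (l2NormSq a) ≤ C * Real.sqrt (Real.pi ^ d) := by
    rw [← Real.sqrt_sq hC0, ← Real.sqrt_mul (sq_nonneg _), mul_comm]
    exact Real.sqrt_le_sqrt (l2NormSq_le_of_bound ma fun x _ => hC x)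
  have h2 := Real.sqrt_le_sqrt hk
  rw [one_pow, one_mul] at h2
  gcongr

/-- The weak formulation may be tested against cosine modes. The formulation with cutoff modes
converges uniformly in time, hence so do the time derivatives. -/
lemma hasDerivAt_integral_mul_cosMode (hη : 0 < η) (hD : C2BoundOn (S.disc η) D C)
    (hF : C2BoundOn (S.disc η) F C) (H : ∀ t ∈ Icc 0 T, SmallState η η (u t) (v t))
    (hz : ∀ t ∈ Icc 0 T, MemH2 (z t) ∧ NeumannBC (z t) ∧ h2NormSq (z t) ≤ η ^ 2)
    (hsol : S.SolvesEquation D F T u v z) (k : Fin d → ℤ) {t : ℝ} (ht : t ∈ Ioo 0 T) :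
    HasDerivAt (fun s => ∫ x in box d, z s x * cosMode k x)
      (-(∑ i, ∫ x in box d, D (state S (rep (u t)) (rep (v t)) x) * weakPartial i (z t) x
          * partialDeriv i (cosMode k) x)
        + ∫ x in box d, F (state S (rep (u t)) (rep (v t)) x) * cosMode k x) t := by
  let I : (s : ℝ) → (φ : (Fin d → ℝ) → ℝ) → ℝ := fun s φ =>
    -(∑ i, ∫ x in box d, D (state S (rep (u s)) (rep (v s)) x) * weakPartial i (z s) x
          * partialDeriv i φ x)
        + ∫ x in box d, F (state S (rep (u s)) (rep (v s)) x) * φ x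
  have hder : ∀ n : ℕ, ∀ s ∈ Ioo 0 T,
      HasDerivAt (fun s => ∫ x in box d, z s x * (cutoff n x * cosMode k x))
        (I s fun x => cutoff n x * cosMode k x) s := by
    intro n s hs
    have h1 := (hsol s hs).2.2 _ (isTestFunction_cutoff_mul n (contDiff_mode (fun _ => false) k))
    have hae := (H s ⟨hs.1.le, hs.2.le⟩).ae_state_eq (S := S)
    refine h1.congr_deriv ?_
    simp only [I]
    congr 1
    · congr 1
      refine Finset.sum_congr rfl fun i _ => integral_congr_ae ?_
      filter_upwards [hae] with x hx
      rw [← hx]; rfl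
    · refine integral_congr_ae ?_
      filter_upwards [hae] with x hx
      rw [← hx]; rfl
  -- The error made by the cutoff, independent of time.
  let E : ℕ → ℝ := fun n =>
    (∑ i, (C * η * |(k i : ℝ)| * Real.sqrt (l2NormSq fun x : Fin d → ℝ => 1 - cutoff n x)
        + C * (3 * Real.pi * transBound) * (2 * η) * Real.sqrt (l2NormSq (faceLayer n i))))
      + C * Real.sqrt (Real.pi ^ d) * Real.sqrt (l2NormSq fun x : Fin d → ℝ => 1 - cutoff n x)
  have hE : Tendsto E atTop (𝓝 0) := by
    have h1 := ((Real.continuous_sqrt.tendsto _).comp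
      (tendsto_l2NormSq_one_sub_cutoff (d := d)))
    rw [Real.sqrt_zero] at h1
    have h2 : ∀ i : Fin d, Tendsto (fun n => Real.sqrt (l2NormSq (faceLayer n i))) atTop (𝓝 0) := by
      intro i
      have := ((Real.continuous_sqrt.tendsto _).comp (tendsto_l2NormSq_faceLayer i))
      rwa [Real.sqrt_zero] at this
    have h3 := (tendsto_finsetSum Finset.univ fun i (_ : i ∈ Finset.univ) =>
      (h1.const_mul (C * η * |(k i : ℝ)|)).add
        ((h2 i).const_mul (C * (3 * Real.pi * transBound) * (2 * η)))).add
      (h1.const_mul (C * Real.sqrt (Real.pi ^ d)))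
    simpa using h3
  have hbound : ∀ n : ℕ, 0 < n → ∀ s ∈ Ioo 0 T,
      |I s (fun x => cutoff n x * cosMode k x) - I s (cosMode k)| ≤ E n := by
    intro n hn s hs
    have hs' : s ∈ Icc 0 T := ⟨hs.1.le, hs.2.le⟩
    obtain ⟨z1, z2, z3⟩ := hz s hs'
    have cD := (H s hs').continuous_comp (S := S) hD.continuousOn
    have cF := (H s hs').continuous_comp (S := S) hF.continuousOn
    have hDb : ∀ x, |D (state S (rep (u s)) (rep (v s)) x)| ≤ C := fun x =>
      hD.bound₀ _ ((H s hs').rep_mem x)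
    have hFb : ∀ x, |F (state S (rep (u s)) (rep (v s)) x)| ≤ C := fun x =>
      hF.bound₀ _ ((H s hs').rep_mem x)
    have e : I s (fun x => cutoff n x * cosMode k x) - I s (cosMode k)
        = -(∑ i, ((∫ x in box d, D (state S (rep (u s)) (rep (v s)) x) * weakPartial i (z s) x
            * partialDeriv i (fun x => cutoff n x * cosMode k x) x)
          - ∫ x in box d, D (state S (rep (u s)) (rep (v s)) x) * weakPartial i (z s) x
            * partialDeriv i (cosMode k) x))
        + ((∫ x in box d, F (state S (rep (u s)) (rep (v s)) x) * (cutoff n x * cosMode k x))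
          - ∫ x in box d, F (state S (rep (u s)) (rep (v s)) x) * cosMode k x) := by
      simp only [I, Finset.sum_sub_distrib]
      ring
    rw [e]
    refine (abs_add_le _ _).trans (add_le_add ?_ (abs_source_cutoff_sub_le cF hFb k n))
    rw [abs_neg]
    exact (Finset.abs_sum_le_sum_abs _ _).trans (Finset.sum_le_sum fun i _ =>
      abs_flux_cutoff_sub_le cD hDb z1 z2 hη.le z3 i k hn)
  refine hasDerivAt_of_tendstoUniformlyOn (l := atTop) (g' := fun s => I s (cosMode k))
    (f := fun (n : ℕ) s => ∫ x in box d, z s x * (cutoff n x * cosMode k x))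
    (f' := fun n s => I s fun x => cutoff n x * cosMode k x) isOpen_Ioo ?_
    (Eventually.of_forall fun n s hs => hder n s hs) ?_ ht
  · rw [Metric.tendstoUniformlyOn_iff]
    intro ε hε
    filter_upwards [hE.eventually (gt_mem_nhds hε), eventually_gt_atTop 0] with n h1 h2 s hs
    rw [dist_comm, Real.dist_eq]
    exact (hbound n h2 s hs).trans_lt h1
  · intro s hs
    have mz : MemL2 (z s) := (hz s ⟨hs.1.le, hs.2.le⟩).1.1
    refine tendsto_integral_of_dominated_convergence (fun x => |z s x|) ?_ mz.integrableOn.abs ?_ ?_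
    · intro n
      exact (mz.mul_integrable (memL2_of_continuous
        ((contDiff_cutoff n).continuous.mul (continuous_mode _ k)))).aestronglyMeasurable
    · intro n
      refine Eventually.of_forall fun x => ?_
      rw [norm_mul, norm_mul, Real.norm_eq_abs, Real.norm_eq_abs, Real.norm_eq_abs,
        abs_of_nonneg (cutoff_nonneg n x)]
      exact mul_le_of_le_one_right (abs_nonneg _) (mul_le_one₀ (cutoff_le_one n x)
        (abs_nonneg _) (abs_mode_le _ _ _))
    · filter_upwards [ae_restrict_mem measurableSet_box] with x hx
      have h1 := ((tendsto_cutoff hx).mul_const (cosMode k x)).const_mul (z s x)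
      rwa [one_mul] at h1

end

/-! ### Products as convolutions -/

lemma mem_signs {σ : Fin d → ℤ} : σ ∈ signs d ↔ ∀ j, σ j = 1 ∨ σ j = -1 := by
  simp [signs, Fintype.mem_piFinset]

lemma cosMode_sign_mul {σ : Fin d → ℤ} (hσ : σ ∈ signs d) (p : Fin d → ℤ) :
    cosMode (σ * p) = cosMode p := by
  funext x
  rw [cosMode, mode, mode]
  refine Finset.prod_congr rfl fun j _ => ?_
  rcases mem_signs.1 hσ j with h | h
  · simp [h]
  · rw [Pi.mul_apply, h, neg_one_mul, trig_neg]
    simp [parity]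

lemma cosCoef_sign_mul {σ : Fin d → ℤ} (hσ : σ ∈ signs d) (b : (Fin d → ℝ) → ℝ)
    (p : Fin d → ℤ) : cosCoef b (σ * p) = cosCoef b p := by
  have := cosMode_sign_mul hσ p
  rw [cosMode] at this
  rw [cosCoef, coef, coef, this]

lemma sign_mul_self {σ : Fin d → ℤ} (hσ : σ ∈ signs d) : σ * σ = 1 := by
  funext j
  rcases mem_signs.1 hσ j with h | h <;> simp [h]

lemma sign_mul_mem_cube {σ : Fin d → ℤ} (hσ : σ ∈ signs d) {N : ℕ} {p : Fin d → ℤ}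
    (hp : p ∈ cube d N) : σ * p ∈ cube d N := by
  rw [mem_cube] at hp ⊢
  intro j
  have := hp j
  rcases mem_signs.1 hσ j with h | h <;> rw [Pi.mul_apply, h] <;> omega

lemma sum_cube_sign_mul {σ : Fin d → ℤ} (hσ : σ ∈ signs d) (N : ℕ) (f : (Fin d → ℤ) → ℝ) :
    ∑ p ∈ cube d N, f (σ * p) = ∑ p ∈ cube d N, f p := by
  have hinv : ∀ p, σ * (σ * p) = p := fun p => by rw [← mul_assoc, sign_mul_self hσ, one_mul]
  exact Finset.sum_nbij' (fun p => σ * p) (fun p => σ * p) (fun p hp => sign_mul_mem_cube hσ hp)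
    (fun p hp => sign_mul_mem_cube hσ hp) (fun p _ => hinv p) (fun p _ => hinv p) fun p _ => rfl

/-- Coefficients of the product of a cosine polynomial with an `L²` function: since the
coefficients are even, the averages over signs add up to a plain convolution. -/
lemma coef_cosProj_mul {τ : Fin d → Bool} {b g : (Fin d → ℝ) → ℝ} (hg : MemL2 g) (N : ℕ)
    (k : Fin d → ℤ) :
    coef τ (fun x => cosProj N b x * g x) k
      = ∑ p ∈ cube d N, cosCoef b p * coef τ g (k + p) := by
  have h1 : ∀ p : Fin d → ℤ, (Real.pi ^ d)⁻¹ * ∫ x in box d, g x * (cosMode p x * mode τ k x)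
      = ∑ σ ∈ signs d, (2 ^ d)⁻¹ * coef τ g (k + σ * p) := by
    intro p
    simp_rw [cosMode_mul_mode, Finset.mul_sum]
    rw [integral_finsetSum, Finset.mul_sum]
    · refine Finset.sum_congr rfl fun σ _ => ?_
      rw [coef, ← integral_const_mul, ← integral_const_mul, ← integral_const_mul]
      congr 1; funext x; ring
    · intro σ _
      exact hg.mul_integrable ((memL2_mode τ _).const_mul _)
  have h2 : coef τ (fun x => cosProj N b x * g x) k
      = ∑ p ∈ cube d N, cosCoef b p *
        ((Real.pi ^ d)⁻¹ * ∫ x in box d, g x * (cosMode p x * mode τ k x)) := by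
    have e : ∀ x, cosProj N b x * g x * mode τ k x
        = ∑ p ∈ cube d N, cosCoef b p * (g x * (cosMode p x * mode τ k x)) := by
      intro x
      rw [cosProj, proj, trigPoly, Finset.sum_mul, Finset.sum_mul]
      refine Finset.sum_congr rfl fun p _ => by ring
    rw [coef]
    simp_rw [e]
    rw [integral_finsetSum, Finset.mul_sum]
    · refine Finset.sum_congr rfl fun p _ => ?_
      rw [integral_const_mul]
      ring
    · intro p _
      exact (hg.mul_integrable (memL2_of_continuous
        ((continuous_mode _ p).mul (continuous_mode τ k)))).const_mul _
  rw [h2]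
  simp_rw [h1, Finset.mul_sum]
  rw [Finset.sum_comm]
  have h3 : ∀ σ ∈ signs d, ∑ p ∈ cube d N, cosCoef b p * ((2 ^ d)⁻¹ * coef τ g (k + σ * p))
      = (2 ^ d)⁻¹ * ∑ p ∈ cube d N, cosCoef b p * coef τ g (k + p) := by
    intro σ hσ
    rw [← sum_cube_sign_mul hσ N fun p => cosCoef b p * coef τ g (k + p), Finset.mul_sum]
    refine Finset.sum_congr rfl fun p _ => ?_
    rw [cosCoef_sign_mul hσ]
    ring
  rw [Finset.sum_congr rfl h3, Finset.sum_const, card_signs, nsmul_eq_mul]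
  push_cast
  field_simp

lemma tendsto_coef_mul {τ : Fin d → Bool} {b g : (Fin d → ℝ) → ℝ} (hb : Continuous b)
    (hg : MemL2 g) (k : Fin d → ℤ) :
    Tendsto (fun N => ∑ p ∈ cube d N, cosCoef b p * coef τ g (k + p)) atTop
      (𝓝 (coef τ (fun x => b x * g x) k)) := by
  simp_rw [← coef_cosProj_mul hg]
  have mgk : MemL2 fun x => mode τ k x * g x :=
    (l2NormSq_mul_le (continuous_mode τ k) (abs_mode_le τ k) hg).1
  have h := (tendsto_integral_proj_mul (fun _ => false) (memL2_of_continuous hb) mgk).const_mul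
    (Real.pi ^ d)⁻¹
  refine (h.congr fun N => ?_).congr' (EventuallyEq.refl _ _) |>.trans_eq ?_
  · rw [coef]
    congr 2; funext x; ring
  · rw [coef]
    congr 3; funext x; ring

/-- The cosine coefficient of `∇·(b ∇z)` in weak form: the derivatives fall on the mode and turn
cosines into sines. -/
def fluxCoef (b z : (Fin d → ℝ) → ℝ) (k : Fin d → ℤ) : ℝ :=
  ∑ i, k i * coef (sinAt i) (fun x => b x * weakPartial i z x) k

lemma tendsto_fluxCoef {b z : (Fin d → ℝ) → ℝ} (hb : Continuous b) (hz : MemH2 z)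
    (k : Fin d → ℤ) :
    Tendsto (fun N => -∑ p ∈ cube d N,
        cosCoef b p * (∑ i, (k i : ℝ) * ((k + p) i : ℤ)) * cosCoef z (k + p)) atTop
      (𝓝 (fluxCoef b z k)) := by
  have h := tendsto_finsetSum Finset.univ fun i (_ : i ∈ Finset.univ) =>
    (tendsto_coef_mul (τ := sinAt i) hb (memL2_weakPartial hz i) k).const_mul (k i : ℝ)
  refine h.congr fun N => ?_
  simp_rw [coef_weakPartial hz, Finset.mul_sum, Finset.sum_mul]
  rw [Finset.sum_comm, ← Finset.sum_neg_distrib]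
  refine Finset.sum_congr rfl fun p _ => ?_
  rw [← Finset.sum_neg_distrib]
  refine Finset.sum_congr rfl fun i _ => ?_
  ring

section
variable {S : RDSystem} {η C T : ℝ} {u v z : ℝ → (Fin d → ℝ) → ℝ} {D F : ℝ × ℝ → ℝ}

/-- The ordinary differential equations for the cosine coefficients of the solution, with the linear
parts of diffusion and reaction separated from the nonlinear ones. -/
theorem hasDerivAt_cosCoef (hη : 0 < η) (hD : C2BoundOn (S.disc η) D C)
    (hF : C2BoundOn (S.disc η) F C) (hF0 : F S.Wbar = 0)
    (H : ∀ t ∈ Icc 0 T, SmallState η η (u t) (v t))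
    (hz : ∀ t ∈ Icc 0 T, MemH2 (z t) ∧ NeumannBC (z t) ∧ h2NormSq (z t) ≤ η ^ 2)
    (hsol : S.SolvesEquation D F T u v z) (k : Fin d → ℤ) {t : ℝ} (ht : t ∈ Ioo 0 T) :
    HasDerivAt (fun s => cosCoef (z s) k)
      (-(D S.Wbar * normSq k * cosCoef (z t) k)
        + fluxCoef (fun x => D (state S (rep (u t)) (rep (v t)) x) - D S.Wbar) (z t) k
        + (fderiv ℝ F S.Wbar (1, 0) * cosCoef (u t) k + fderiv ℝ F S.Wbar (0, 1) * cosCoef (v t) k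
          + cosCoef (fun x => taylorRem S F (state S (rep (u t)) (rep (v t)) x)) k)) t := by
  have ht' : t ∈ Icc 0 T := ⟨ht.1.le, ht.2.le⟩
  have h := (hasDerivAt_integral_mul_cosMode hη hD hF H hz hsol k ht).const_mul (Real.pi ^ d)⁻¹
  refine h.congr_deriv ?_
  have Ht := H t ht'
  obtain ⟨z1, z2, z3⟩ := hz t ht'
  have cD := Ht.continuous_comp (S := S) hD.continuousOn
  have cF := Ht.continuous_comp (S := S) hF.continuousOn
  let a : (Fin d → ℝ) → ℝ := fun x => D (state S (rep (u t)) (rep (v t)) x)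
  have hflux : ∀ i, (Real.pi ^ d)⁻¹ * ∫ x in box d, a x * weakPartial i (z t) x
        * partialDeriv i (cosMode k) x
      = D S.Wbar * ((k i : ℝ) ^ 2 * cosCoef (z t) k)
        - k i * coef (sinAt i) (fun x => (a x - D S.Wbar) * weakPartial i (z t) x) k := by
    intro i
    have mg := memL2_weakPartial z1 i
    have mb : MemL2 fun x => (a x - D S.Wbar) * weakPartial i (z t) x := by
      obtain ⟨B, hB⟩ : ∃ B, ∀ x, |a x - D S.Wbar| ≤ B := ⟨C + C, fun x => (abs_sub _ _).trans
        (add_le_add (hD.bound₀ _ (Ht.rep_mem x)) (hD.bound₀ _ (Wbar_mem_disc S η)))⟩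
      exact (l2NormSq_mul_le (cD.sub continuous_const) hB mg).1
    have e : ∀ x, a x * weakPartial i (z t) x * partialDeriv i (cosMode k) x
        = -(k i * D S.Wbar * (weakPartial i (z t) x * mode (sinAt i) k x)
          + k i * ((a x - D S.Wbar) * weakPartial i (z t) x * mode (sinAt i) k x)) := by
      intro x
      rw [cosMode, partialDeriv_mode]
      simp only [parity, Bool.not_false]
      ring
    simp_rw [e]
    rw [integral_neg, integral_add ((mg.mul_integrable (memL2_mode _ k)).const_mul _)
      ((mb.mul_integrable (memL2_mode _ k)).const_mul _), integral_const_mul, integral_const_mul]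
    have h2 := coef_weakPartial z1 i k
    rw [coef] at h2
    rw [coef]
    linear_combination -(k i * D S.Wbar) * h2
  have hsource : (Real.pi ^ d)⁻¹ * ∫ x in box d, F (state S (rep (u t)) (rep (v t)) x) * cosMode k x
      = fderiv ℝ F S.Wbar (1, 0) * cosCoef (u t) k + fderiv ℝ F S.Wbar (0, 1) * cosCoef (v t) k
          + cosCoef (fun x => taylorRem S F (state S (rep (u t)) (rep (v t)) x)) k := by
    have cu := continuous_rep Ht.one_le_dim Ht.dim_le Ht.memH2_fst Ht.neumann_fst
    have cv := continuous_rep Ht.one_le_dim Ht.dim_le Ht.memH2_snd Ht.neumann_snd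
    have cR : Continuous fun x => taylorRem S F (state S (rep (u t)) (rep (v t)) x) :=
      Ht.continuous_comp ((hF.continuousOn.sub continuousOn_const).sub (by fun_prop))
    have e : ∀ x, F (state S (rep (u t)) (rep (v t)) x)
        = fderiv ℝ F S.Wbar (1, 0) * rep (u t) x + fderiv ℝ F S.Wbar (0, 1) * rep (v t) x
          + taylorRem S F (state S (rep (u t)) (rep (v t)) x) := by
      intro x
      have e1 : state S (rep (u t)) (rep (v t)) x - S.Wbar
          = rep (u t) x • ((1, 0) : ℝ × ℝ) + rep (v t) x • ((0, 1) : ℝ × ℝ) := by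
        simp [state, RDSystem.Wbar]
      rw [taylorRem, e1, map_add, map_smul, map_smul, hF0, smul_eq_mul, smul_eq_mul]
      ring
    have e2 : ∀ w, MemH2 w → NeumannBC w → ∫ x in box d, rep w x * mode (fun _ => false) k x
        = ∫ x in box d, w x * mode (fun _ => false) k x := by
      intro w hw hwn
      refine integral_congr_ae ?_
      filter_upwards [ae_eq_rep Ht.one_le_dim Ht.dim_le hw hwn] with x hx
      rw [hx]
    simp_rw [e, add_mul, mul_assoc]
    have mk := memL2_mode (fun _ => false) k
    have i1 := (memL2_of_continuous cu).mul_integrable mk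
    have i2 := (memL2_of_continuous cv).mul_integrable mk
    have i3 := (memL2_of_continuous cR).mul_integrable mk
    rw [integral_add, integral_add, integral_const_mul, integral_const_mul]
    · simp only [cosMode]
      rw [e2 _ Ht.memH2_fst Ht.neumann_fst, e2 _ Ht.memH2_snd Ht.neumann_snd]
      simp only [cosCoef, coef]
      ring
    · exact i1.const_mul _
    · exact i2.const_mul _
    · exact (i1.const_mul _).add (i2.const_mul _)
    · exact i3
  rw [mul_add, hsource, mul_neg, Finset.mul_sum, Finset.sum_congr rfl fun i _ => hflux i]
  rw [Finset.sum_sub_distrib, ← Finset.mul_sum, ← Finset.sum_mul, fluxCoef, normSq]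
  ring

end

/-! ### Convolution estimates with damped weights -/

/-- The damped multiplier `|k|² / (1 + ε |k|²)`. For `ε > 0` it is bounded, so that the dissipation
`∑ |k|² (damp ε k)² û(k)²` is finite for functions that are merely in `H²`. -/
def damp (ε : ℝ) (k : Fin d → ℤ) : ℝ := normSq k / (1 + ε * normSq k)

/-- The weight of the energy: the symbol of the derivatives of order one and two in the squared
`H²` norm, damped at high frequencies. -/
def weight (ε : ℝ) (k : Fin d → ℤ) : ℝ := (normSq k + quartic k) / (1 + ε * normSq k) ^ 2

lemma normSq_zero : normSq (0 : Fin d → ℤ) = 0 := by simp [normSq]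

lemma quartic_zero : quartic (0 : Fin d → ℤ) = 0 := by simp [quartic]

section
variable {ε : ℝ}

lemma one_le_denom (hε : 0 ≤ ε) (k : Fin d → ℤ) : 1 ≤ 1 + ε * normSq k := by
  have := mul_nonneg hε (normSq_nonneg k)
  linarith

lemma damp_nonneg (hε : 0 ≤ ε) (k : Fin d → ℤ) : 0 ≤ damp ε k :=
  div_nonneg (normSq_nonneg k) (by linarith [one_le_denom hε k])

lemma weight_nonneg (ε : ℝ) (k : Fin d → ℤ) : 0 ≤ weight ε k :=
  div_nonneg (add_nonneg (normSq_nonneg k) (quartic_nonneg k)) (sq_nonneg _)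

lemma damp_le_normSq (hε : 0 ≤ ε) (k : Fin d → ℤ) : damp ε k ≤ normSq k :=
  div_le_self (normSq_nonneg k) (one_le_denom hε k)

lemma weight_le (hε : 0 ≤ ε) (k : Fin d → ℤ) : weight ε k ≤ normSq k + quartic k :=
  div_le_self (add_nonneg (normSq_nonneg k) (quartic_nonneg k))
    (one_le_pow₀ (one_le_denom hε k))

lemma normSq_add_quartic_le (k : Fin d → ℤ) : normSq k + quartic k ≤ 2 * normSq k ^ 2 := by
  by_cases hk : k = 0
  · subst hk; rw [normSq_zero, quartic_zero]; norm_num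
  · have h1 := one_le_normSq hk
    have h2 := quartic_le k
    nlinarith

lemma weight_le_damp_sq (k : Fin d → ℤ) : weight ε k ≤ 2 * damp ε k ^ 2 := by
  rw [weight, damp, div_pow, ← mul_div_assoc]
  exact div_le_div_of_nonneg_right (normSq_add_quartic_le k) (sq_nonneg _)

lemma damp_sq_le_weight (k : Fin d → ℤ) : damp ε k ^ 2 ≤ 2 * weight ε k := by
  rw [weight, damp, div_pow, ← mul_div_assoc]
  refine div_le_div_of_nonneg_right ?_ (sq_nonneg _)
  have h1 := normSq_sq_le k
  have h2 := normSq_nonneg k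
  linarith

lemma normSq_sub_le (k l : Fin d → ℤ) : normSq (k - l) ≤ 2 * normSq k + 2 * normSq l := by
  rw [normSq, normSq, normSq, Finset.mul_sum, Finset.mul_sum, ← Finset.sum_add_distrib]
  refine Finset.sum_le_sum fun i _ => ?_
  rw [Pi.sub_apply]
  push_cast
  nlinarith [sq_nonneg ((k i : ℝ) + l i)]

/-- The damped multiplier is slowly varying. -/
lemma damp_le_of_add (hε : 0 ≤ ε) (k p : Fin d → ℤ) (hl : k + p ≠ 0) :
    damp ε k ≤ 2 * damp ε (k + p) * (1 + normSq p / normSq (k + p)) := by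
  have h1 : normSq k ≤ 2 * normSq (k + p) + 2 * normSq p := by
    simpa using normSq_sub_le (k + p) p
  have hx := normSq_nonneg k
  have hp := normSq_nonneg p
  have hL := one_le_normSq hl
  set x := normSq k
  set L := normSq (k + p) with hLdef
  set y := normSq p
  have e : 2 * damp ε (k + p) * (1 + y / L) = 2 * (L + y) / (1 + ε * L) := by
    rw [damp, ← hLdef]
    have : L ≠ 0 := by positivity
    field_simp
  rw [e, damp, div_le_div_iff₀ (by positivity) (by positivity)]
  nlinarith [mul_nonneg hε hx, mul_nonneg hε hp, mul_nonneg (mul_nonneg hε hx) hp,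
    mul_nonneg (mul_nonneg hε hx) (by linarith : (0 : ℝ) ≤ L)]

lemma abs_dot_le (k l : Fin d → ℤ) :
    |∑ i, (k i : ℝ) * (l i : ℝ)| ≤ Real.sqrt (normSq k) * Real.sqrt (normSq l) := by
  rw [← Real.sqrt_mul (normSq_nonneg k)]
  exact Real.abs_le_sqrt (Finset.sum_mul_sq_le_sq_mul_sq _ _ _)

/-- Young's inequality for a convolution, with the coefficient in `ℓ¹`. -/
lemma sum_conv_l1_le {b y : (Fin d → ℤ) → ℝ} {A Y : ℝ} (Q P : Finset (Fin d → ℤ))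
    (hA : ∑ p ∈ P, |b p| ≤ A) (hY : ∀ F : Finset (Fin d → ℤ), ∑ k ∈ F, y k ^ 2 ≤ Y) :
    ∑ k ∈ Q, ∑ p ∈ P, |b p| * (y k * y (k + p)) ≤ A * Y := by
  have hY0 : 0 ≤ Y := by simpa using hY ∅
  rw [Finset.sum_comm]
  calc ∑ p ∈ P, ∑ k ∈ Q, |b p| * (y k * y (k + p)) ≤ ∑ p ∈ P, |b p| * Y := by
        refine Finset.sum_le_sum fun p _ => ?_
        rw [← Finset.mul_sum]
        refine mul_le_mul_of_nonneg_left ?_ (abs_nonneg _)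
        have h1 : ∑ k ∈ Q, y k * y (k + p) ≤ ∑ k ∈ Q, (1 / 2 * y k ^ 2 + 1 / 2 * y (k + p) ^ 2) :=
          Finset.sum_le_sum fun k _ => by nlinarith [sq_nonneg (y k - y (k + p))]
        rw [Finset.sum_add_distrib, ← Finset.mul_sum, ← Finset.mul_sum] at h1
        have h2 : ∑ k ∈ Q, y (k + p) ^ 2 ≤ Y := by
          have := hY (Q.map (addRightEmbedding p))
          simpa using this
        linarith [hY Q]
    _ = (∑ p ∈ P, |b p|) * Y := by rw [Finset.sum_mul]
    _ ≤ A * Y := by gcongr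

/-- Young's inequality for a convolution, with the coefficient in `ℓ²` and one of the other factors in
`ℓ¹`. -/
lemma sum_conv_l2_le {β y z : (Fin d → ℤ) → ℝ} {B Y Z : ℝ} (Q P : Finset (Fin d → ℤ))
    (hβ : ∀ p, 0 ≤ β p) (hy : ∀ k, 0 ≤ y k) (hz : ∀ k, 0 ≤ z k) (hB0 : 0 ≤ B)
    (hB : ∀ F : Finset (Fin d → ℤ), ∑ k ∈ F, β k ^ 2 ≤ B ^ 2)
    (hY : ∀ F : Finset (Fin d → ℤ), ∑ k ∈ F, y k ^ 2 ≤ Y)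
    (hZ : ∀ F : Finset (Fin d → ℤ), ∑ k ∈ F, z k ≤ Z) :
    ∑ k ∈ Q, ∑ p ∈ P, β p * (y k * z (k + p)) ≤ Real.sqrt Y * B * Z := by
  classical
  let L : Finset (Fin d → ℤ) := Q.biUnion fun k => P.map (addLeftEmbedding k)
  have h1 : ∀ k ∈ Q, ∑ p ∈ P, β p * (y k * z (k + p)) ≤ ∑ l ∈ L, β (l - k) * (y k * z l) := by
    intro k hk
    have e : ∑ p ∈ P, β p * (y k * z (k + p))
        = ∑ l ∈ P.map (addLeftEmbedding k), β (l - k) * (y k * z l) := by simp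
    rw [e]
    exact Finset.sum_le_sum_of_subset_of_nonneg
      (Finset.subset_biUnion_of_mem (fun k => P.map (addLeftEmbedding k)) hk)
      fun l _ _ => mul_nonneg (hβ _) (mul_nonneg (hy _) (hz _))
  refine (Finset.sum_le_sum h1).trans ?_
  rw [Finset.sum_comm]
  calc ∑ l ∈ L, ∑ k ∈ Q, β (l - k) * (y k * z l) ≤ ∑ l ∈ L, (Real.sqrt Y * B) * z l := by
        refine Finset.sum_le_sum fun l _ => ?_
        have e : ∑ k ∈ Q, β (l - k) * (y k * z l) = (∑ k ∈ Q, y k * β (l - k)) * z l := by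
          rw [Finset.sum_mul]
          exact Finset.sum_congr rfl fun k _ => by ring
        rw [e]
        refine mul_le_mul_of_nonneg_right ?_ (hz l)
        refine (Real.sum_mul_le_sqrt_mul_sqrt Q y fun k => β (l - k)).trans ?_
        refine mul_le_mul (Real.sqrt_le_sqrt (hY Q)) ?_ (Real.sqrt_nonneg _) (Real.sqrt_nonneg _)
        refine (Real.sqrt_le_left hB0).2 ?_
        have := hB (Q.map (Equiv.subLeft l).toEmbedding)
        simpa using this
    _ = (Real.sqrt Y * B) * ∑ l ∈ L, z l := by rw [Finset.mul_sum]
    _ ≤ _ := by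
        refine mul_le_mul_of_nonneg_left (hZ L) (by positivity)

/-- The bilinear estimate behind the energy inequality: a flux `b ∇z` with small coefficient
`b ∈ H²` is dominated by the dissipation. In the convolution the damped weight of the output is
shared between the two factors; one of them is then in `ℓ²` and the other in `ℓ¹`. -/
lemma abs_flux_sum_le (hd1 : 1 ≤ d) (hd3 : d ≤ 3) (hε : 0 ≤ ε) {a b : (Fin d → ℤ) → ℝ}
    {A B Y : ℝ} (hB0 : 0 ≤ B) (Q P : Finset (Fin d → ℤ))
    (hA : ∑ p ∈ P, |b p| ≤ A)
    (hB : ∀ F : Finset (Fin d → ℤ), ∑ k ∈ F, normSq k ^ 2 * b k ^ 2 ≤ B ^ 2)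
    (hY : ∀ F : Finset (Fin d → ℤ), ∑ k ∈ F, normSq k * damp ε k ^ 2 * a k ^ 2 ≤ Y) :
    |∑ k ∈ Q, weight ε k * a k *
        ∑ p ∈ P, b p * (∑ i, (k i : ℝ) * ((k + p) i : ℤ)) * a (k + p)|
      ≤ 4 * (A + 9 * B) * Y := by
  have hY0 : 0 ≤ Y := by simpa using hY ∅
  let y : (Fin d → ℤ) → ℝ := fun k => damp ε k * Real.sqrt (normSq k) * |a k|
  have hy0 : ∀ k, 0 ≤ y k := fun k =>
    mul_nonneg (mul_nonneg (damp_nonneg hε k) (Real.sqrt_nonneg _)) (abs_nonneg _)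
  have hysq : ∀ k, y k ^ 2 = normSq k * damp ε k ^ 2 * a k ^ 2 := by
    intro k
    simp only [y, mul_pow, Real.sq_sqrt (normSq_nonneg k), sq_abs]
    ring
  have hY' : ∀ F : Finset (Fin d → ℤ), ∑ k ∈ F, y k ^ 2 ≤ Y := fun F => by
    simp_rw [hysq]; exact hY F
  have hterm : ∀ k p : Fin d → ℤ,
      |weight ε k * a k * (b p * (∑ i, (k i : ℝ) * ((k + p) i : ℤ)) * a (k + p))|
        ≤ 4 * (|b p| * (y k * y (k + p)))
          + 4 * ((normSq p * |b p|) * (y k * (y (k + p) / normSq (k + p)))) := by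
    intro k p
    have hpn := normSq_nonneg p
    by_cases hl : k + p = 0
    · have : ∑ i, (k i : ℝ) * ((k + p) i : ℤ) = 0 :=
        Finset.sum_eq_zero fun i _ => by rw [hl]; simp
      rw [this]
      have h1 := hy0 k
      have h2 := hy0 (k + p)
      have h3 := normSq_nonneg (k + p)
      have h4 : 0 ≤ y (k + p) / normSq (k + p) := div_nonneg h2 h3
      simp only [mul_zero, zero_mul, abs_zero]
      positivity
    · -- Of the two factors `damp ε k` of the weight, one is passed on to the frequency `k + p`.
      have h1 := damp_le_of_add hε k p hl
      have h2 := weight_le_damp_sq (ε := ε) k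
      have h3 := abs_dot_le k (k + p)
      have hk0 := damp_nonneg hε k
      have hl0 := damp_nonneg hε (k + p)
      rw [abs_mul, abs_mul, abs_mul, abs_mul, abs_of_nonneg (weight_nonneg ε k)]
      calc weight ε k * |a k| * (|b p| * |∑ i, (k i : ℝ) * ((k + p) i : ℤ)| * |a (k + p)|)
          ≤ (2 * (damp ε k * (2 * damp ε (k + p) * (1 + normSq p / normSq (k + p))))) * |a k|
            * (|b p| * (Real.sqrt (normSq k) * Real.sqrt (normSq (k + p))) * |a (k + p)|) := by
            have h4 : weight ε k ≤ 2 * (damp ε k * (2 * damp ε (k + p)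
                * (1 + normSq p / normSq (k + p)))) := by
              refine h2.trans ?_
              rw [sq]
              gcongr
            have h5 := mul_nonneg ((weight_nonneg ε k).trans h4) (abs_nonneg (a k))
            gcongr
        _ = _ := by
            simp only [y]
            ring
  have hsum : |∑ k ∈ Q, weight ε k * a k *
        ∑ p ∈ P, b p * (∑ i, (k i : ℝ) * ((k + p) i : ℤ)) * a (k + p)|
      ≤ ∑ k ∈ Q, ∑ p ∈ P, (4 * (|b p| * (y k * y (k + p)))
          + 4 * ((normSq p * |b p|) * (y k * (y (k + p) / normSq (k + p))))) := by
    refine (Finset.abs_sum_le_sum_abs _ _).trans (Finset.sum_le_sum fun k _ => ?_)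
    rw [Finset.mul_sum]
    exact (Finset.abs_sum_le_sum_abs _ _).trans (Finset.sum_le_sum fun p _ => hterm k p)
  have h1 := sum_conv_l1_le Q P hA hY'
  have hz0 : ∀ k, 0 ≤ y k / normSq k := fun k => div_nonneg (hy0 k) (normSq_nonneg k)
  have hZ : ∀ F : Finset (Fin d → ℤ), ∑ k ∈ F, y k / normSq k ≤ 9 * Real.sqrt Y := by
    intro F
    have h2 : ∑ k ∈ F.erase 0, |y k / normSq k| ≤ 9 * Real.sqrt Y := by
      refine sum_abs_le_of_normSq hd1 hd3 (Real.sqrt_nonneg _) _ ?_ (by simp)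
      rw [Real.sq_sqrt hY0]
      refine le_trans (Finset.sum_le_sum fun k hk => ?_) (hY' (F.erase 0))
      have := one_le_normSq (Finset.ne_of_mem_erase hk)
      have : normSq k ≠ 0 := by positivity
      rw [div_pow]
      field_simp
      rfl
    refine le_trans ?_ h2
    simp_rw [abs_of_nonneg (hz0 _)]
    by_cases hF : (0 : Fin d → ℤ) ∈ F
    · rw [← Finset.add_sum_erase F _ hF]
      simp [normSq_zero]
    · rw [Finset.erase_eq_of_notMem hF]
  have h2 := sum_conv_l2_le (β := fun p => normSq p * |b p|) (y := y)
    (z := fun k => y k / normSq k) Q P (fun p => mul_nonneg (normSq_nonneg p) (abs_nonneg _)) hy0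
    hz0 hB0 (fun F => by simp_rw [mul_pow, sq_abs]; exact hB F) hY' hZ
  have h3 : Real.sqrt Y * B * (9 * Real.sqrt Y) = 9 * B * Y := by
    have := Real.mul_self_sqrt hY0
    linear_combination 9 * B * this
  rw [h3] at h2
  simp_rw [Finset.sum_add_distrib, ← Finset.mul_sum] at hsum
  linarith

/-- The contribution of a remainder with small gradient to the energy. -/
lemma abs_rem_sum_le (hε : 0 ≤ ε) {a R : (Fin d → ℤ) → ℝ} {Y Y' c : ℝ} (hc : 0 ≤ c)
    (hYY : Y ≤ Y') (Q : Finset (Fin d → ℤ))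
    (hY : ∑ k ∈ Q, normSq k * damp ε k ^ 2 * a k ^ 2 ≤ Y)
    (hR : ∑ k ∈ Q, normSq k * R k ^ 2 ≤ 4 * c ^ 2 * Y') :
    |∑ k ∈ Q, weight ε k * a k * R k| ≤ 4 * c * Y' := by
  have hY0 : 0 ≤ Y := le_trans (Finset.sum_nonneg fun k _ => by
    have := normSq_nonneg k; positivity) hY
  have h1 : |∑ k ∈ Q, weight ε k * a k * R k|
      ≤ 2 * ∑ k ∈ Q, (damp ε k * Real.sqrt (normSq k) * |a k|) * (Real.sqrt (normSq k) * |R k|) := by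
    rw [Finset.mul_sum]
    refine (Finset.abs_sum_le_sum_abs _ _).trans (Finset.sum_le_sum fun k _ => ?_)
    have h2 := weight_le_damp_sq (ε := ε) k
    have h3 := damp_le_normSq hε k
    have h4 := damp_nonneg hε k
    rw [abs_mul, abs_mul, abs_of_nonneg (weight_nonneg ε k)]
    calc weight ε k * |a k| * |R k| ≤ (2 * (damp ε k * normSq k)) * |a k| * |R k| := by
          have : weight ε k ≤ 2 * (damp ε k * normSq k) := by nlinarith
          gcongr
      _ = _ := by
          have := Real.mul_self_sqrt (normSq_nonneg k)
          linear_combination -2 * damp ε k * |a k| * |R k| * this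
  have h2 : ∑ k ∈ Q, (damp ε k * Real.sqrt (normSq k) * |a k|) * (Real.sqrt (normSq k) * |R k|)
      ≤ 2 * c * Y' := by
    refine abs_le_of_sq_le_sq' ?_ (by have := hY0.trans hYY; positivity) |>.2
    refine (Finset.sum_mul_sq_le_sq_mul_sq _ _ _).trans ?_
    have e1 : ∑ k ∈ Q, (damp ε k * Real.sqrt (normSq k) * |a k|) ^ 2 ≤ Y := by
      refine le_trans (le_of_eq (Finset.sum_congr rfl fun k _ => ?_)) hY
      simp only [mul_pow, Real.sq_sqrt (normSq_nonneg k), sq_abs]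
      ring
    have e2 : ∑ k ∈ Q, (Real.sqrt (normSq k) * |R k|) ^ 2 ≤ 4 * c ^ 2 * Y' := by
      refine le_trans (le_of_eq (Finset.sum_congr rfl fun k _ => ?_)) hR
      simp only [mul_pow, Real.sq_sqrt (normSq_nonneg k), sq_abs]
    have e3 : 0 ≤ 4 * c ^ 2 * Y' := by have := hY0.trans hYY; positivity
    calc _ ≤ Y * (4 * c ^ 2 * Y') := by
          refine mul_le_mul e1 e2 (Finset.sum_nonneg fun k _ => sq_nonneg _) hY0
      _ ≤ Y' * (4 * c ^ 2 * Y') := by gcongr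
      _ = _ := by ring
  linarith

end

/-! ### The largest eigenvalue -/

/-- `(f̄_v + ḡ_u)² / (2 |ḡ_v|) + f̄_u`, a bound of the growth rate of the activator after the inhibitor
has been absorbed. Its cube divided by `D̄₁²` is `C₂`. -/
def growthBound (S : RDSystem) : ℝ := (S.fv + S.gu) ^ 2 / (2 * |S.gv|) + S.fu

section
variable {S : RDSystem}

/-- The coupling is absorbed by the decay of the inhibitor. -/
lemma cross_le (hg : S.gv < 0) (a b : ℝ) :
    S.fu * a ^ 2 + (S.fv + S.gu) * (a * b) + S.gv * b ^ 2 ≤ growthBound S * a ^ 2 := by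
  have h1 : (S.fv + S.gu) ^ 2 / (2 * |S.gv|) * a ^ 2 - (S.fv + S.gu) * (a * b) - S.gv * b ^ 2
      = ((S.fv + S.gu) * a + S.gv * b) ^ 2 / (2 * |S.gv|) + (|S.gv| / 2) * b ^ 2 := by
    have hg0 : S.gv ≠ 0 := hg.ne
    rw [abs_of_neg hg]
    field_simp
    ring
  have h2 : 0 ≤ ((S.fv + S.gu) * a + S.gv * b) ^ 2 / (2 * |S.gv|) + (|S.gv| / 2) * b ^ 2 := by
    positivity
  rw [growthBound]
  linarith

lemma one_le_qSq {q : Fin d → ℕ} (hq : RDSystem.qSq q ≠ 0) : 1 ≤ RDSystem.qSq q := by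
  have e : RDSystem.qSq q = ((∑ i, q i ^ 2 : ℕ) : ℝ) := by
    rw [RDSystem.qSq]; push_cast; rfl
  rw [e] at hq ⊢
  have : (∑ i, q i ^ 2 : ℕ) ≠ 0 := by exact_mod_cast hq
  exact_mod_cast Nat.one_le_iff_ne_zero.2 this

/-- A positive eigenvalue belongs to a nonconstant mode and is bounded by the growth rate minus the
diffusion of the activator. -/
lemma dispersion_le (hD1 : 0 < S.Dbar₁) (hD2 : 0 < S.Dbar₂) (hT : S.TuringUnstable d)
    (hg : S.gv < 0) {q : Fin d → ℕ} {lam : ℝ} (h : S.Dispersion q lam) (hl : 0 < lam) :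
    lam ≤ growthBound S - S.Dbar₁ := by
  obtain ⟨htr, hdet, -⟩ := hT
  rw [RDSystem.Dispersion, RDSystem.symbolDet] at h
  set x := RDSystem.qSq q with hx
  have hx1 : 1 ≤ x := by
    refine one_le_qSq fun h0 => ?_
    rw [hx, h0] at h
    nlinarith
  have e : (lam - (S.fu - S.Dbar₁ * x)) * (lam - (S.gv - S.Dbar₂ * x)) = S.fv * S.gu := by
    linear_combination h
  have hp : |S.gv| ≤ lam - (S.gv - S.Dbar₂ * x) := by
    rw [abs_of_neg hg]
    nlinarith
  have hg0 : 0 < |S.gv| := abs_pos.2 hg.ne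
  have h1 : lam - (S.fu - S.Dbar₁ * x) ≤ (S.fv + S.gu) ^ 2 / (2 * |S.gv|) := by
    rw [le_div_iff₀ (by positivity)]
    rcases le_or_gt (lam - (S.fu - S.Dbar₁ * x)) 0 with h2 | h2
    · exact (mul_nonpos_of_nonpos_of_nonneg h2 (by positivity)).trans (sq_nonneg _)
    · -- `2 (λ - f̄_u + D̄₁ x) |ḡ_v| ≤ 2 f̄_v ḡ_u ≤ (f̄_v + ḡ_u)²`
      nlinarith [mul_le_mul_of_nonneg_left hp h2.le, sq_nonneg (S.fv - S.gu),
        sq_nonneg (S.fv + S.gu)]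
  rw [growthBound]
  nlinarith

lemma exists_pos_dispersion (hT : S.TuringUnstable d) :
    ∃ lam, 0 < lam ∧ ∃ q : Fin d → ℕ, S.Dispersion q lam := by
  obtain ⟨-, -, q, hq⟩ := hT
  set B := -S.fu + S.Dbar₁ * RDSystem.qSq q - S.gv + S.Dbar₂ * RDSystem.qSq q with hB
  have hdisc : 0 ≤ B ^ 2 - 4 * S.symbolDet q := by nlinarith [sq_nonneg B]
  have hs := Real.sq_sqrt hdisc
  have hlt : |B| < Real.sqrt (B ^ 2 - 4 * S.symbolDet q) := by
    rw [← Real.sqrt_sq_eq_abs]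
    exact Real.sqrt_lt_sqrt (sq_nonneg _) (by linarith)
  refine ⟨(-B + Real.sqrt (B ^ 2 - 4 * S.symbolDet q)) / 2, ?_, q, ?_⟩
  · linarith [le_abs_self B]
  · rw [RDSystem.Dispersion, ← hB]
    linear_combination hs / 4

/-- The set of eigenvalues contains a positive number and is bounded above, so that `λ_max` is its
supremum and not a default value. -/
lemma lamMax_bounds (hD1 : 0 < S.Dbar₁) (hD2 : 0 < S.Dbar₂) (hT : S.TuringUnstable d)
    (hg : S.gv < 0) : 0 < S.lamMax d ∧ S.lamMax d ≤ growthBound S - S.Dbar₁ := by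
  obtain ⟨l0, hl0, q0, hq0⟩ := exists_pos_dispersion hT
  have h0 := dispersion_le hD1 hD2 hT hg hq0 hl0
  have hub : ∀ lam ∈ {lam : ℝ | ∃ q : Fin d → ℕ, S.Dispersion q lam},
      lam ≤ growthBound S - S.Dbar₁ := by
    rintro lam ⟨q, hq⟩
    rcases le_or_gt lam 0 with h | h
    · linarith
    · exact dispersion_le hD1 hD2 hT hg hq h
  exact ⟨hl0.trans_le (le_csSup ⟨_, hub⟩ ⟨q0, hq0⟩), csSup_le ⟨l0, q0, hq0⟩ hub⟩

lemma C2_eq (S : RDSystem) : S.C2 = growthBound S ^ 3 / S.Dbar₁ ^ 2 := rfl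

/-- Interpolation between the `L²` norm and the dissipation, one mode at a time. -/
lemma two_mul_sq_mul_le {K D x : ℝ} (hK : 0 < K) (hD : 0 < D) (hx : 0 ≤ x) :
    2 * x ^ 2 * (K - 3 / 4 * D * x) ≤ 2 / 3 * (K ^ 3 / D ^ 2) := by
  rw [← mul_div_assoc, le_div_iff₀ (by positivity)]
  have hX : 0 ≤ D * x := by positivity
  have key : ∀ X : ℝ, 0 ≤ X → 2 * X ^ 2 * K - 3 / 2 * X ^ 3 ≤ 2 / 3 * K ^ 3 := by
    intro X hX
    nlinarith [mul_nonneg hX (sq_nonneg (X - 8 / 9 * K)), mul_nonneg hK.le (sq_nonneg (X - 8 / 9 * K)),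
      mul_nonneg hK.le (sq_nonneg X), pow_pos hK 3, mul_nonneg (mul_nonneg hX hK.le) hK.le]
  nlinarith [key (D * x) hX]

/-- This is `3 (K - D̄₁) ≤ K³ / D̄₁²` for `K = growthBound S`. -/
lemma lamMax_le_C2 (hD1 : 0 < S.Dbar₁) (hD2 : 0 < S.Dbar₂) (hT : S.TuringUnstable d)
    (hg : S.gv < 0) : 0 < growthBound S ∧ S.lamMax d ≤ S.C2 / 3 := by
  obtain ⟨h1, h2⟩ := lamMax_bounds hD1 hD2 hT hg
  have hK : 0 < growthBound S := by linarith
  refine ⟨hK, h2.trans ?_⟩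
  rw [C2_eq, div_div, le_div_iff₀ (by positivity)]
  nlinarith [mul_nonneg hD1.le (sq_nonneg (S.Dbar₁ - 2 / 3 * growthBound S)),
    mul_nonneg hK.le (sq_nonneg (S.Dbar₁ - 2 / 3 * growthBound S)), pow_pos hK 3,
    mul_nonneg hK.le (sq_nonneg S.Dbar₁), mul_pos (mul_pos hD1 hK) hK]

/-- The linear part of the energy inequality for a single mode. -/
lemma weight_mul_linear_le (hD1 : 0 < S.Dbar₁) (hK : 0 < growthBound S) {ε : ℝ} (hε : 0 ≤ ε)
    (k : Fin d → ℤ) :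
    weight ε k * (growthBound S - 3 / 4 * S.Dbar₁ * normSq k) ≤ 2 / 3 * S.C2 := by
  have h0 := two_mul_sq_mul_le hK hD1 (normSq_nonneg k)
  have hC : 0 < S.C2 := by rw [C2_eq]; positivity
  rw [← C2_eq] at h0
  rcases le_or_gt (growthBound S - 3 / 4 * S.Dbar₁ * normSq k) 0 with h | h
  · exact (mul_nonpos_of_nonneg_of_nonpos (weight_nonneg ε k) h).trans (by positivity)
  · refine le_trans ?_ h0
    exact mul_le_mul_of_nonneg_right ((weight_le hε k).trans (normSq_add_quartic_le k)) h.le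

end

/-! ### The energy inequality -/

lemma one_le_pi_pow : 1 ≤ Real.pi ^ d := one_le_pow₀ (by linarith [Real.pi_gt_three])

lemma hasSum_h2NormSq_sub {u : (Fin d → ℝ) → ℝ} (hu : MemH2 u) (hn : NeumannBC u) :
    HasSum (fun k => Real.pi ^ d * ((normSq k + quartic k) * cosCoef u k ^ 2))
      (h2NormSq u - l2NormSq u) := by
  refine ((hasSum_h2NormSq hu hn).sub (hasSum_coef_sq (fun _ => false) hu.1)).congr_fun ?_
  intro k
  ring

section
variable {ε : ℝ} {u v z : (Fin d → ℝ) → ℝ}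

/-- The dissipation outside a large cube of frequencies is negligible, because the damped multiplier
is bounded. -/
lemma sum_dissipation_le (hu : MemH2 u) (hn : NeumannBC u) (hε : 0 < ε) {N : ℕ} (hN : 1 ≤ N)
    (F : Finset (Fin d → ℤ)) :
    ∑ k ∈ F, normSq k * damp ε k ^ 2 * cosCoef u k ^ 2
      ≤ ∑ k ∈ cube d N, normSq k * damp ε k ^ 2 * cosCoef u k ^ 2
        + 2 * h2NormSq u / (ε ^ 2 * (N : ℝ) ^ 2) := by
  classical
  have hN0 : (1 : ℝ) ≤ N := by exact_mod_cast hN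
  have hterm0 : ∀ k : Fin d → ℤ, 0 ≤ normSq k * damp ε k ^ 2 * cosCoef u k ^ 2 := fun k => by
    have := normSq_nonneg k
    positivity
  have h1 : ∑ k ∈ F, normSq k * damp ε k ^ 2 * cosCoef u k ^ 2
      ≤ ∑ k ∈ cube d N, normSq k * damp ε k ^ 2 * cosCoef u k ^ 2
        + ∑ k ∈ F \ cube d N, normSq k * damp ε k ^ 2 * cosCoef u k ^ 2 := by
    rw [← Finset.sum_union Finset.disjoint_sdiff, Finset.union_sdiff_self_eq_union]
    exact Finset.sum_le_sum_of_subset_of_nonneg Finset.subset_union_right fun k _ _ => hterm0 k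
  refine h1.trans (add_le_add le_rfl ?_)
  rw [le_div_iff₀ (by positivity), Finset.sum_mul]
  have h2 : ∀ k ∈ F \ cube d N, normSq k * damp ε k ^ 2 * cosCoef u k ^ 2 * (ε ^ 2 * (N : ℝ) ^ 2)
      ≤ 2 * (h2Symbol k * cosCoef u k ^ 2) := by
    intro k hk
    have hx := normSq_nonneg k
    have hx2 : (N : ℝ) ^ 2 ≤ normSq k := by
      have hk' := (Finset.mem_sdiff.1 hk).2
      rw [mem_cube] at hk'
      push Not at hk'
      obtain ⟨j, hj⟩ := hk'
      refine le_trans ?_ (sq_le_normSq k j)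
      rw [sq_le_sq, Nat.abs_cast]
      have : (N : ℤ) ≤ |k j| := by
        by_cases h : -(N : ℤ) ≤ k j
        · exact (hj h).le.trans (le_abs_self _)
        · exact le_trans (by omega) (neg_le_abs _)
      exact_mod_cast this
    have hd : ε ^ 2 * damp ε k ^ 2 ≤ 1 := by
      rw [← mul_pow]
      refine pow_le_one₀ (mul_nonneg hε.le (damp_nonneg hε.le k)) ?_
      have h3 := one_le_denom hε.le k
      rw [damp, ← mul_div_assoc, div_le_one (by linarith)]
      linarith
    have hs : normSq k ^ 2 ≤ 2 * h2Symbol k := by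
      have := normSq_sq_le k
      rw [h2Symbol]
      linarith
    calc normSq k * damp ε k ^ 2 * cosCoef u k ^ 2 * (ε ^ 2 * (N : ℝ) ^ 2)
        = (ε ^ 2 * damp ε k ^ 2) * (normSq k * (N : ℝ) ^ 2) * cosCoef u k ^ 2 := by ring
      _ ≤ 1 * (normSq k * normSq k) * cosCoef u k ^ 2 := by gcongr
      _ = normSq k ^ 2 * cosCoef u k ^ 2 := by ring
      _ ≤ (2 * h2Symbol k) * cosCoef u k ^ 2 := by gcongr
      _ = _ := by ring
  refine (Finset.sum_le_sum h2).trans ?_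
  rw [← Finset.mul_sum]
  refine mul_le_mul_of_nonneg_left (le_trans ?_ (sum_h2Symbol_mul_sq_le hu hn (F \ cube d N)))
    zero_le_two
  refine le_mul_of_one_le_left (Finset.sum_nonneg fun k _ => ?_) one_le_pi_pow
  have := normSq_nonneg k
  have := quartic_nonneg k
  rw [h2Symbol]
  positivity

/-- The gradient is controlled by the damped dissipation, since `damp ε k ≥ 1/2` for `ε ≤ 1` and
`k ≠ 0`. -/
lemma sum_l2NormSq_weakPartial_le (hu : MemH2 u) (hε : 0 ≤ ε) (hε1 : ε ≤ 1) {Y : ℝ}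
    (hY : ∀ F : Finset (Fin d → ℤ), ∑ k ∈ F, normSq k * damp ε k ^ 2 * cosCoef u k ^ 2 ≤ Y) :
    ∑ i, l2NormSq (weakPartial i u) ≤ Real.pi ^ d * (4 * Y) := by
  have h := hasSum_sum (s := Finset.univ) fun i _ => hasSum_l2NormSq_weakPartial hu i
  refine hasSum_le_of_sum_le h fun F => ?_
  refine le_trans ?_ (mul_le_mul_of_nonneg_left
    (mul_le_mul_of_nonneg_left (hY F) (by norm_num : (0 : ℝ) ≤ 4)) (by positivity))
  rw [Finset.mul_sum, Finset.mul_sum]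
  refine Finset.sum_le_sum fun k _ => ?_
  rw [← Finset.mul_sum, ← Finset.sum_mul]
  refine mul_le_mul_of_nonneg_left ?_ (by positivity)
  change normSq k * _ ≤ _
  by_cases hk : k = 0
  · subst hk; simp [normSq_zero]
  · have h1 := one_le_normSq hk
    have h2 : 1 / 2 ≤ damp ε k := by
      rw [damp, div_le_div_iff₀ two_pos (by linarith [one_le_denom hε k])]
      nlinarith
    have h3 : 1 ≤ 4 * damp ε k ^ 2 := by nlinarith
    calc normSq k * cosCoef u k ^ 2 = normSq k * cosCoef u k ^ 2 * 1 := by ring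
      _ ≤ normSq k * cosCoef u k ^ 2 * (4 * damp ε k ^ 2) := by gcongr
      _ = _ := by ring

variable {S : RDSystem} {η r C : ℝ} {h : ℝ × ℝ → ℝ}

/-- The contribution of the nonlinear part of the diffusion to the energy. The constant is
`4 (73 + 9 · 8)`. -/
lemma SmallState.abs_flux_le (H : SmallState η r u v) (hη : 0 < η) (hh : C2BoundOn (S.disc η) h C)
    (hz : MemH2 z) (hε : 0 ≤ ε) {Y : ℝ}
    (hY : ∀ F : Finset (Fin d → ℤ), ∑ k ∈ F, normSq k * damp ε k ^ 2 * cosCoef z k ^ 2 ≤ Y)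
    (Q : Finset (Fin d → ℤ)) :
    |∑ k ∈ Q, weight ε k * cosCoef z k *
        fluxCoef (fun x => h (state S (rep u) (rep v) x) - h S.Wbar) z k|
      ≤ 580 * (C * (1 + η) * r) * Y := by
  have hC : 0 ≤ C := hh.nonneg
  have hr := H.nonneg
  set b := fun x => h (state S (rep u) (rep v) x) - h S.Wbar with hb
  have hbc : Continuous b := (H.continuous_comp hh.continuousOn).sub continuous_const
  have hlim : Tendsto (fun N => ∑ k ∈ Q, weight ε k * cosCoef z k *
      -∑ p ∈ cube d N, cosCoef b p * (∑ i, (k i : ℝ) * ((k + p) i : ℤ)) * cosCoef z (k + p))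
      atTop (𝓝 (∑ k ∈ Q, weight ε k * cosCoef z k * fluxCoef b z k)) :=
    tendsto_finsetSum _ fun k _ => (tendsto_fluxCoef hbc hz k).const_mul _
  refine le_of_tendsto hlim.abs (Eventually.of_forall fun N => ?_)
  have h1 := abs_flux_sum_le H.one_le_dim H.dim_le hε (a := cosCoef z) (b := cosCoef b)
    (A := 73 * (C * (1 + η) * r)) (B := 8 * (C * (1 + η) * r)) (by positivity) Q (cube d N)
    (H.sum_abs_cosCoef_comp_le hη hh _) (H.sum_normSq_sq_mul_cosCoef_sq_le hη hh _) hY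
  simp only [mul_neg, Finset.sum_neg_distrib, abs_neg]
  refine h1.trans (le_of_eq ?_)
  ring

/-- The contribution of the nonlinear part of the reaction to the energy. -/
lemma SmallState.abs_rem_le (H : SmallState η r u v) (hη : 0 < η) (hh : C2BoundOn (S.disc η) h C)
    (hε : 0 ≤ ε) (hε1 : ε ≤ 1) {Y₁ Y₂ Y : ℝ}
    (hY₁ : ∀ F : Finset (Fin d → ℤ), ∑ k ∈ F, normSq k * damp ε k ^ 2 * cosCoef u k ^ 2 ≤ Y₁)
    (hY₂ : ∀ F : Finset (Fin d → ℤ), ∑ k ∈ F, normSq k * damp ε k ^ 2 * cosCoef v k ^ 2 ≤ Y₂)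
    (hY : ∀ F : Finset (Fin d → ℤ), ∑ k ∈ F, normSq k * damp ε k ^ 2 * cosCoef z k ^ 2 ≤ Y)
    (hle : Y ≤ Y₁ + Y₂) (Q : Finset (Fin d → ℤ)) :
    |∑ k ∈ Q, weight ε k * cosCoef z k *
        cosCoef (fun x => taylorRem S h (state S (rep u) (rep v) x)) k|
      ≤ 4 * (C * (1 + η) * r) * (Y₁ + Y₂) := by
  have hC : 0 ≤ C := hh.nonneg
  have hr := H.nonneg
  have hY₁0 : 0 ≤ Y₁ := by simpa using hY₁ ∅
  have hY₂0 : 0 ≤ Y₂ := by simpa using hY₂ ∅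
  refine abs_rem_sum_le hε (by positivity) hle Q (hY Q) ?_
  have h1 := H.sum_normSq_mul_taylorRem_sq_le hη hh Q
  rw [Finset.sum_add_distrib] at h1
  have h2 := sum_l2NormSq_weakPartial_le H.memH2_fst hε hε1 hY₁
  have h3 := sum_l2NormSq_weakPartial_le H.memH2_snd hε hε1 hY₂
  have h4 : C * r ≤ C * (1 + η) * r := by nlinarith [mul_nonneg hC hr]
  have hpi : 0 < Real.pi ^ d := by positivity
  refine le_of_mul_le_mul_left ?_ hpi
  calc _ ≤ (C * r) ^ 2 * (Real.pi ^ d * (4 * Y₁) + Real.pi ^ d * (4 * Y₂)) := by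
        refine h1.trans ?_
        gcongr
    _ ≤ (C * (1 + η) * r) ^ 2 * (Real.pi ^ d * (4 * Y₁) + Real.pi ^ d * (4 * Y₂)) := by
        gcongr
    _ = _ := by ring

end

/-! ### Evolution of the damped energy -/

/-- The right-hand side of the equation for the cosine coefficients of the component `z` with
diffusion coefficient `D` and reaction term `F`, at the state `[u, v]`. -/
def coefRate (S : RDSystem) (D F : ℝ × ℝ → ℝ) (u v z : (Fin d → ℝ) → ℝ) (k : Fin d → ℤ) : ℝ :=
  -(D S.Wbar * normSq k * cosCoef z k)
    + fluxCoef (fun x => D (state S (rep u) (rep v) x) - D S.Wbar) z k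
    + (fderiv ℝ F S.Wbar (1, 0) * cosCoef u k + fderiv ℝ F S.Wbar (0, 1) * cosCoef v k
      + cosCoef (fun x => taylorRem S F (state S (rep u) (rep v) x)) k)

/-- The damped energy of the frequencies in `Q`: up to the damping, it is the part of the squared
`H²` norm that comes from the derivatives of order one and two. -/
def energy (ε : ℝ) (Q : Finset (Fin d → ℤ)) (u v : (Fin d → ℝ) → ℝ) : ℝ :=
  Real.pi ^ d * ∑ k ∈ Q, weight ε k * (cosCoef u k ^ 2 + cosCoef v k ^ 2)

section
variable {S : RDSystem} {η r ε : ℝ} {u v : (Fin d → ℝ) → ℝ}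

/-- For small states the nonlinearity is dominated by the dissipation, up to the dissipation `τ₁, τ₂`
of the frequencies outside `Q`; what remains of the linear part is controlled by the `L²` norm. The
dissipation of the inhibitor is used up completely, that of the activator to a quarter. -/
lemma SmallState.sum_weight_mul_rate_le (H : SmallState η r u v) (hη : 0 < η)
    (hS : S.SmoothNear η) (hD1 : 0 < S.Dbar₁) (hg : S.gv < 0) (hK : 0 < growthBound S)
    (hc1 : 4704 * (S.Ceta η * (1 + η) * r) ≤ S.Dbar₁)
    (hc2 : 1176 * (S.Ceta η * (1 + η) * r) ≤ S.Dbar₂)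
    (hε : 0 ≤ ε) (hε1 : ε ≤ 1) (Q : Finset (Fin d → ℤ)) {τ₁ τ₂ : ℝ}
    (hτ₁ : ∀ F : Finset (Fin d → ℤ), ∑ k ∈ F, normSq k * damp ε k ^ 2 * cosCoef u k ^ 2
      ≤ ∑ k ∈ Q, normSq k * damp ε k ^ 2 * cosCoef u k ^ 2 + τ₁)
    (hτ₂ : ∀ F : Finset (Fin d → ℤ), ∑ k ∈ F, normSq k * damp ε k ^ 2 * cosCoef v k ^ 2
      ≤ ∑ k ∈ Q, normSq k * damp ε k ^ 2 * cosCoef v k ^ 2 + τ₂) :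
    ∑ k ∈ Q, weight ε k * (cosCoef u k * coefRate S S.D₁ S.f u v u k
        + cosCoef v k * coefRate S S.D₂ S.g u v v k)
      ≤ 2 / 3 * S.C2 * ∑ k ∈ Q, cosCoef u k ^ 2
        + 588 * (S.Ceta η * (1 + η) * r) * (τ₁ + τ₂) := by
  obtain ⟨bD1, bD2, bf, bg⟩ := c2BoundOn_Ceta S hη hS
  have hC : 0 ≤ S.Ceta η := bD1.nonneg
  have hr := H.nonneg
  set c := S.Ceta η * (1 + η) * r with hcdef
  have hc : 0 ≤ c := by positivity
  set a := cosCoef u with ha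
  set b := cosCoef v with hb
  have hY₁0 := (by simpa using hτ₁ ∅ :
    0 ≤ ∑ k ∈ Q, normSq k * damp ε k ^ 2 * a k ^ 2 + τ₁)
  have hY₂0 := (by simpa using hτ₂ ∅ :
    0 ≤ ∑ k ∈ Q, normSq k * damp ε k ^ 2 * b k ^ 2 + τ₂)
  have f1 := (le_abs_self _).trans (H.abs_flux_le hη bD1 H.memH2_fst hε hτ₁ Q)
  have f2 := (le_abs_self _).trans (H.abs_flux_le hη bD2 H.memH2_snd hε hτ₂ Q)
  have r1 := (le_abs_self _).trans
    (H.abs_rem_le hη bf hε hε1 hτ₁ hτ₂ hτ₁ (by linarith) Q)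
  have r2 := (le_abs_self _).trans
    (H.abs_rem_le hη bg hε hε1 hτ₁ hτ₂ hτ₂ (by linarith) Q)
  rw [← hcdef, ← ha, ← hb] at *
  set Y₁ := ∑ k ∈ Q, normSq k * damp ε k ^ 2 * a k ^ 2
  set Y₂ := ∑ k ∈ Q, normSq k * damp ε k ^ 2 * b k ^ 2
  have hY : Y₁ + Y₂ ≤ 2 * ∑ k ∈ Q, normSq k * weight ε k * (a k ^ 2 + b k ^ 2) := by
    rw [← Finset.sum_add_distrib, Finset.mul_sum]
    refine Finset.sum_le_sum fun k _ => ?_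
    have h1 := damp_sq_le_weight (ε := ε) k
    have h2 := normSq_nonneg k
    calc _ = normSq k * damp ε k ^ 2 * (a k ^ 2 + b k ^ 2) := by ring
      _ ≤ normSq k * (2 * weight ε k) * (a k ^ 2 + b k ^ 2) := by gcongr
      _ = _ := by ring
  have hsplit : ∑ k ∈ Q, weight ε k * (a k * coefRate S S.D₁ S.f u v u k
        + b k * coefRate S S.D₂ S.g u v v k)
      = ∑ k ∈ Q, weight ε k * (-(S.Dbar₁ * normSq k * a k ^ 2) - S.Dbar₂ * normSq k * b k ^ 2
          + (S.fu * a k ^ 2 + (S.fv + S.gu) * (a k * b k) + S.gv * b k ^ 2))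
        + ∑ k ∈ Q, weight ε k * a k *
            fluxCoef (fun x => S.D₁ (state S (rep u) (rep v) x) - S.D₁ S.Wbar) u k
        + ∑ k ∈ Q, weight ε k * b k *
            fluxCoef (fun x => S.D₂ (state S (rep u) (rep v) x) - S.D₂ S.Wbar) v k
        + ∑ k ∈ Q, weight ε k * a k *
            cosCoef (fun x => taylorRem S S.f (state S (rep u) (rep v) x)) k
        + ∑ k ∈ Q, weight ε k * b k *
            cosCoef (fun x => taylorRem S S.g (state S (rep u) (rep v) x)) k := by
    simp_rw [← Finset.sum_add_distrib]
    refine Finset.sum_congr rfl fun k _ => ?_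
    simp only [coefRate, RDSystem.Dbar₁, RDSystem.Dbar₂, RDSystem.fu, RDSystem.fv, RDSystem.gu,
      RDSystem.gv]
    ring
  have hlin : ∑ k ∈ Q, weight ε k * (-(S.Dbar₁ * normSq k * a k ^ 2) - S.Dbar₂ * normSq k * b k ^ 2
          + (S.fu * a k ^ 2 + (S.fv + S.gu) * (a k * b k) + S.gv * b k ^ 2))
        + 1176 * c * ∑ k ∈ Q, normSq k * weight ε k * (a k ^ 2 + b k ^ 2)
      ≤ 2 / 3 * S.C2 * ∑ k ∈ Q, a k ^ 2 := by
    rw [Finset.mul_sum, Finset.mul_sum, ← Finset.sum_add_distrib]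
    refine Finset.sum_le_sum fun k _ => ?_
    have h1 := cross_le hg (a k) (b k)
    have h2 := weight_mul_linear_le hD1 hK hε k
    have h3 := normSq_nonneg k
    have h4 := weight_nonneg ε k
    have h5 : -(S.Dbar₁ * normSq k * a k ^ 2) - S.Dbar₂ * normSq k * b k ^ 2
        + (S.fu * a k ^ 2 + (S.fv + S.gu) * (a k * b k) + S.gv * b k ^ 2)
        + 1176 * c * (normSq k * (a k ^ 2 + b k ^ 2))
        ≤ (growthBound S - 3 / 4 * S.Dbar₁ * normSq k) * a k ^ 2 := by
      have h6 : 0 ≤ normSq k * a k ^ 2 := by positivity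
      have h7 : 0 ≤ normSq k * b k ^ 2 := by positivity
      have h8 : 1176 * c * (normSq k * a k ^ 2) ≤ S.Dbar₁ / 4 * (normSq k * a k ^ 2) :=
        mul_le_mul_of_nonneg_right (by linarith) h6
      have h9 := mul_le_mul_of_nonneg_right hc2 h7
      linarith
    calc _ = weight ε k * (-(S.Dbar₁ * normSq k * a k ^ 2) - S.Dbar₂ * normSq k * b k ^ 2
          + (S.fu * a k ^ 2 + (S.fv + S.gu) * (a k * b k) + S.gv * b k ^ 2)
          + 1176 * c * (normSq k * (a k ^ 2 + b k ^ 2))) := by ring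
      _ ≤ weight ε k * ((growthBound S - 3 / 4 * S.Dbar₁ * normSq k) * a k ^ 2) :=
          mul_le_mul_of_nonneg_left h5 h4
      _ = weight ε k * (growthBound S - 3 / 4 * S.Dbar₁ * normSq k) * a k ^ 2 := by ring
      _ ≤ 2 / 3 * S.C2 * a k ^ 2 := mul_le_mul_of_nonneg_right h2 (sq_nonneg _)
  have hcY := mul_le_mul_of_nonneg_left hY (by positivity : 0 ≤ 588 * c)
  rw [hsplit]
  linarith

lemma energy_le (hu : MemH2 u) (hv : MemH2 v) (nu : NeumannBC u) (nv : NeumannBC v) (hε : 0 ≤ ε)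
    (Q : Finset (Fin d → ℤ)) :
    energy ε Q u v ≤ h2NormSq u + h2NormSq v - (l2NormSq u + l2NormSq v) := by
  have h := (hasSum_h2NormSq_sub hu nu).add (hasSum_h2NormSq_sub hv nv)
  have h0 : ∀ k : Fin d → ℤ, 0 ≤ normSq k + quartic k := fun k =>
    add_nonneg (normSq_nonneg k) (quartic_nonneg k)
  have h1 := sum_le_hasSum Q (fun k _ => by have := h0 k; positivity) h
  refine le_trans ?_ (h1.trans (by linarith))
  rw [energy, Finset.mul_sum]
  refine Finset.sum_le_sum fun k _ => ?_
  rw [← mul_add, ← mul_add]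
  have := weight_le hε k
  gcongr

/-- Bounds of the damped energies that are uniform in `ε` bound the `H²` norm. -/
lemma h2NormSq_le_of_energy_le (hu : MemH2 u) (hv : MemH2 v) (nu : NeumannBC u)
    (nv : NeumannBC v) {B : ℝ}
    (hB : ∀ ε : ℝ, 0 < ε → ε ≤ 1 → ∀ F : Finset (Fin d → ℤ), energy ε F u v ≤ B) :
    h2NormSq u + h2NormSq v ≤ l2NormSq u + l2NormSq v + B := by
  have h := (hasSum_h2NormSq_sub hu nu).add (hasSum_h2NormSq_sub hv nv)
  have key := hasSum_le_of_sum_le (c := B) h fun F => ?_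
  · linarith
  have e : ∑ k ∈ F, (Real.pi ^ d * ((normSq k + quartic k) * cosCoef u k ^ 2)
      + Real.pi ^ d * ((normSq k + quartic k) * cosCoef v k ^ 2)) = energy 0 F u v := by
    rw [energy, Finset.mul_sum]
    refine Finset.sum_congr rfl fun k _ => ?_
    simp only [weight, zero_mul, add_zero, one_pow, div_one]
    ring
  rw [e]
  have hw : ∀ k : Fin d → ℤ, Tendsto (fun ε => weight ε k) (𝓝[>] 0) (𝓝 (weight 0 k)) := fun k => by
    refine tendsto_nhdsWithin_of_tendsto_nhds (ContinuousAt.tendsto ?_)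
    have : (1 + 0 * normSq k) ^ 2 ≠ 0 := by simp
    exact ContinuousAt.div (by fun_prop) (by fun_prop) this
  have hlim : Tendsto (fun ε => energy ε F u v) (𝓝[>] 0) (𝓝 (energy 0 F u v)) :=
    (tendsto_finsetSum _ fun k _ => (hw k).mul_const _).const_mul _
  refine le_of_tendsto hlim ?_
  filter_upwards [Ioc_mem_nhdsGT (zero_lt_one' ℝ)] with ε hε using hB ε hε.1 hε.2 F

end

/-- Integration of a differential inequality with an exponential and a constant forcing. -/
lemma le_add_of_deriv_le_exp {E E' : ℝ → ℝ} {T B err lam : ℝ} (hlam : 0 < lam) (hB : 0 ≤ B)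
    (hc : ContinuousOn E (Icc 0 T)) (hd : ∀ t ∈ Ioo 0 T, HasDerivAt E (E' t) t)
    (hle : ∀ t ∈ Ioo 0 T, E' t ≤ B * Real.exp (2 * lam * t) + err) {t : ℝ} (ht : t ∈ Icc 0 T) :
    E t ≤ E 0 + B / (2 * lam) * Real.exp (2 * lam * t) + err * t := by
  let G : ℝ → ℝ := fun s => E s - B / (2 * lam) * Real.exp (2 * lam * s) - err * s
  have hexp : ∀ s, HasDerivAt (fun s => B / (2 * lam) * Real.exp (2 * lam * s))
      (B * Real.exp (2 * lam * s)) s := fun s => by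
    have h := ((((hasDerivAt_id s).const_mul (2 * lam)).exp).const_mul (B / (2 * lam)))
    refine h.congr_deriv ?_
    simp only [id]
    field_simp
  have hG : ∀ s ∈ Ioo 0 T, HasDerivAt G (E' s - B * Real.exp (2 * lam * s) - err) s :=
    fun s hs => ((hd s hs).sub (hexp s)).sub (by simpa using (hasDerivAt_id s).const_mul err)
  have hanti : AntitoneOn G (Icc 0 T) := by
    refine antitoneOn_of_deriv_nonpos (convex_Icc 0 T) ?_ ?_ ?_
    · exact (hc.sub (by fun_prop)).sub (by fun_prop)
    · rw [interior_Icc]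
      exact fun s hs => (hG s hs).differentiableAt.differentiableWithinAt
    · rw [interior_Icc]
      intro s hs
      rw [(hG s hs).deriv]
      linarith [hle s hs]
  have h0 : (0 : ℝ) ∈ Icc 0 T := ⟨le_rfl, ht.1.trans ht.2⟩
  have h := hanti h0 ht ht.1
  simp only [G, mul_zero, Real.exp_zero, mul_one, sub_zero] at h
  have : 0 ≤ B / (2 * lam) := by positivity
  linarith

lemma abs_cosCoef_sub_le {u w : (Fin d → ℝ) → ℝ} (hu : MemL2 u) (hw : MemL2 w) (k : Fin d → ℤ) :
    |cosCoef u k - cosCoef w k| ≤ Real.sqrt (l2NormSq (u - w)) := by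
  have e : cosCoef (u - w) k = cosCoef u k - cosCoef w k := by
    simp only [cosCoef, coef, Pi.sub_apply, sub_mul]
    rw [integral_sub (hu.mul_integrable (memL2_mode _ k)) (hw.mul_integrable (memL2_mode _ k)),
      mul_sub]
  refine Real.abs_le_sqrt ?_
  have h := sum_coef_sq_le (τ := fun _ => false) (hu.sub' hw) {k}
  rw [Finset.sum_singleton] at h
  rw [← e]
  exact (le_mul_of_one_le_left (sq_nonneg _) one_le_pi_pow).trans h

/-! ### The a priori estimate -/

lemma h2Norm_sq (u v : (Fin d → ℝ) → ℝ) : h2Norm u v ^ 2 = h2NormSq u + h2NormSq v :=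
  Real.sq_sqrt (add_nonneg (h2NormSq_nonneg u) (h2NormSq_nonneg v))

lemma l2Norm_sq (u v : (Fin d → ℝ) → ℝ) : l2Norm u v ^ 2 = l2NormSq u + l2NormSq v :=
  Real.sq_sqrt (add_nonneg (l2NormSq_nonneg u) (l2NormSq_nonneg v))

lemma h2Norm_nonneg (u v : (Fin d → ℝ) → ℝ) : 0 ≤ h2Norm u v := Real.sqrt_nonneg _

section
variable {S : RDSystem} {η T : ℝ} {u v : ℝ → (Fin d → ℝ) → ℝ}

lemma smallState_of_isSolution (hd1 : 1 ≤ d) (hd3 : d ≤ 3) (hsol : S.IsSolution d T u v) {t r : ℝ}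
    (ht : t ∈ Icc 0 T) (hr : h2Norm (u t) (v t) ≤ r) (hrη : r ≤ η) :
    SmallState η r (u t) (v t) := by
  obtain ⟨h1, h2, h3, h4⟩ := hsol.1 t ht
  have h0 := h2Norm_nonneg (u t) (v t)
  refine ⟨hd1, hd3, h1, h2, h3, h4, h0.trans hr, ?_, hrη⟩
  rw [← h2Norm_sq]
  gcongr

lemma continuousOn_cosCoef (hsol : S.IsSolution d T u v) (k : Fin d → ℤ) :
    ContinuousOn (fun t => cosCoef (u t) k) (Icc 0 T) ∧
      ContinuousOn (fun t => cosCoef (v t) k) (Icc 0 T) := by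
  have key : ∀ z : ℝ → (Fin d → ℝ) → ℝ, (∀ t ∈ Icc 0 T, MemL2 (z t)) →
      (∀ s t, l2NormSq (z s - z t) ≤ h2NormSq (u s - u t) + h2NormSq (v s - v t)) →
      ContinuousOn (fun t => cosCoef (z t) k) (Icc 0 T) := by
    intro z hz hle t ht
    rw [ContinuousWithinAt, tendsto_iff_dist_tendsto_zero]
    refine squeeze_zero' (Eventually.of_forall fun _ => dist_nonneg) ?_ (hsol.2.1 t ht)
    filter_upwards [self_mem_nhdsWithin] with s hs
    rw [Real.dist_eq]
    exact (abs_cosCoef_sub_le (hz s hs) (hz t ht) k).trans (Real.sqrt_le_sqrt (hle s t))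
  constructor
  · refine key u (fun t ht => (hsol.1 t ht).1.1) fun s t => ?_
    linarith [l2NormSq_le_h2NormSq (u s - u t), h2NormSq_nonneg (v s - v t)]
  · refine key v (fun t ht => (hsol.1 t ht).2.1.1) fun s t => ?_
    linarith [l2NormSq_le_h2NormSq (v s - v t), h2NormSq_nonneg (u s - u t)]

lemma hasDerivAt_energy (hd1 : 1 ≤ d) (hd3 : d ≤ 3) (hη : 0 < η) (hS : S.SmoothNear η)
    (hf : S.f S.Wbar = 0) (hg : S.g S.Wbar = 0) (hsol : S.IsSolution d T u v)
    (hr : ∀ t ∈ Icc 0 T, h2Norm (u t) (v t) ≤ η) (ε : ℝ) (Q : Finset (Fin d → ℤ)) {t : ℝ}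
    (ht : t ∈ Ioo 0 T) :
    HasDerivAt (fun s => energy ε Q (u s) (v s))
      (2 * Real.pi ^ d * ∑ k ∈ Q, weight ε k *
        (cosCoef (u t) k * coefRate S S.D₁ S.f (u t) (v t) (u t) k
          + cosCoef (v t) k * coefRate S S.D₂ S.g (u t) (v t) (v t) k)) t := by
  obtain ⟨bD1, bD2, bf, bg⟩ := c2BoundOn_Ceta S hη hS
  have H : ∀ s ∈ Icc 0 T, SmallState η η (u s) (v s) := fun s hs =>
    smallState_of_isSolution hd1 hd3 hsol hs (hr s hs) le_rfl
  have hu : ∀ s ∈ Icc 0 T, MemH2 (u s) ∧ NeumannBC (u s) ∧ h2NormSq (u s) ≤ η ^ 2 := fun s hs =>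
    ⟨(H s hs).memH2_fst, (H s hs).neumann_fst,
      by linarith [(H s hs).h2_le, h2NormSq_nonneg (v s)]⟩
  have hv : ∀ s ∈ Icc 0 T, MemH2 (v s) ∧ NeumannBC (v s) ∧ h2NormSq (v s) ≤ η ^ 2 := fun s hs =>
    ⟨(H s hs).memH2_snd, (H s hs).neumann_snd,
      by linarith [(H s hs).h2_le, h2NormSq_nonneg (u s)]⟩
  have h := (HasDerivAt.fun_sum (u := Q) fun k _ =>
    (((hasDerivAt_cosCoef hη bD1 bf hf H hu hsol.2.2.1 k ht).pow 2).add
      ((hasDerivAt_cosCoef hη bD2 bg hg H hv hsol.2.2.2 k ht).pow 2)).const_mul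
        (weight ε k)).const_mul (Real.pi ^ d)
  refine h.congr_deriv ?_
  rw [mul_comm 2, mul_assoc, Finset.mul_sum (a := (2 : ℝ))]
  congr 1
  refine Finset.sum_congr rfl fun k _ => ?_
  simp only [coefRate]
  push_cast
  ring

/-- The energy estimate, with the growth of the `L²` norm as an input. -/
lemma h2NormSq_le_of_isSolution (hd1 : 1 ≤ d) (hd3 : d ≤ 3) (hη : 0 < η) (hS : S.SmoothNear η)
    (hf : S.f S.Wbar = 0) (hg : S.g S.Wbar = 0) (hD1 : 0 < S.Dbar₁) (hgv : S.gv < 0)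
    (hK : 0 < growthBound S) (hsol : S.IsSolution d T u v)
    (hr : ∀ t ∈ Icc 0 T, h2Norm (u t) (v t) ≤ η)
    (hc1 : ∀ t ∈ Icc 0 T, 4704 * (S.Ceta η * (1 + η) * h2Norm (u t) (v t)) ≤ S.Dbar₁)
    (hc2 : ∀ t ∈ Icc 0 T, 1176 * (S.Ceta η * (1 + η) * h2Norm (u t) (v t)) ≤ S.Dbar₂)
    {lam L : ℝ} (hlam : 0 < lam) (hL0 : 0 ≤ L)
    (hL : ∀ t ∈ Icc 0 T, l2NormSq (u t) + l2NormSq (v t) ≤ L * Real.exp (2 * lam * t))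
    {t : ℝ} (ht : t ∈ Icc 0 T) :
    h2NormSq (u t) + h2NormSq (v t) ≤ l2NormSq (u t) + l2NormSq (v t)
      + (h2NormSq (u 0) + h2NormSq (v 0) - (l2NormSq (u 0) + l2NormSq (v 0))
        + 2 / 3 * S.C2 * L / lam * Real.exp (2 * lam * t)) := by
  have hC2 : 0 < S.C2 := by rw [C2_eq]; positivity
  have hC : 0 ≤ S.Ceta η := (c2BoundOn_Ceta S hη hS).1.nonneg
  have h0T : (0 : ℝ) ∈ Icc 0 T := ⟨le_rfl, ht.1.trans ht.2⟩
  obtain ⟨mu, mv, nu, nv⟩ := hsol.1 t ht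
  obtain ⟨mu0, mv0, nu0, nv0⟩ := hsol.1 0 h0T
  refine h2NormSq_le_of_energy_le mu mv nu nv fun ε hε hε1 F => ?_
  obtain ⟨N₀, hN₀⟩ := exists_subset_cube F
  -- The constant in the contribution of the frequencies outside the cube of size `N`.
  set κ := 2 * Real.pi ^ d * (588 * (S.Ceta η * (1 + η) * η) * (2 * η ^ 2 / ε ^ 2)) with hκ
  have hN : ∀ N : ℕ, 1 ≤ N → N₀ ≤ N → energy ε F (u t) (v t)
      ≤ h2NormSq (u 0) + h2NormSq (v 0) - (l2NormSq (u 0) + l2NormSq (v 0))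
        + 2 / 3 * S.C2 * L / lam * Real.exp (2 * lam * t) + κ / (N : ℝ) ^ 2 * t := by
    intro N hN1 hNN
    have hNpos : (0 : ℝ) < N := by exact_mod_cast hN1
    have hmono : energy ε F (u t) (v t) ≤ energy ε (cube d N) (u t) (v t) := by
      refine mul_le_mul_of_nonneg_left ?_ (by positivity)
      refine Finset.sum_le_sum_of_subset_of_nonneg (hN₀.trans (cube_mono hNN)) fun k _ _ => ?_
      exact mul_nonneg (weight_nonneg ε k) (by positivity)
    have hcont : ContinuousOn (fun s => energy ε (cube d N) (u s) (v s)) (Icc 0 T) := by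
      refine continuousOn_const.mul (continuousOn_finsetSum _ fun k _ =>
        continuousOn_const.mul ?_)
      exact ((continuousOn_cosCoef hsol k).1.pow 2).add ((continuousOn_cosCoef hsol k).2.pow 2)
    have hrate : ∀ s ∈ Ioo 0 T, 2 * Real.pi ^ d * ∑ k ∈ cube d N, weight ε k *
        (cosCoef (u s) k * coefRate S S.D₁ S.f (u s) (v s) (u s) k
          + cosCoef (v s) k * coefRate S S.D₂ S.g (u s) (v s) (v s) k)
        ≤ 4 / 3 * S.C2 * L * Real.exp (2 * lam * s) + κ / (N : ℝ) ^ 2 := by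
      intro s hs
      have hs' := Ioo_subset_Icc_self hs
      have H := smallState_of_isSolution hd1 hd3 hsol hs' le_rfl (hr s hs')
      have h1 := H.sum_weight_mul_rate_le hη hS hD1 hgv hK (hc1 s hs') (hc2 s hs') hε.le hε1
        (cube d N) (sum_dissipation_le H.memH2_fst H.neumann_fst hε hN1)
        (sum_dissipation_le H.memH2_snd H.neumann_snd hε hN1)
      have h2 := sum_coef_sq_le (τ := fun _ => false) H.memH2_fst.1 (cube d N)
      have h3 : l2NormSq (u s) ≤ L * Real.exp (2 * lam * s) := by
        linarith [hL s hs', l2NormSq_nonneg (v s)]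
      have h4 : h2NormSq (u s) + h2NormSq (v s) ≤ η ^ 2 := by
        rw [← h2Norm_sq]
        have := h2Norm_nonneg (u s) (v s)
        have := hr s hs'
        gcongr
      have h5 : 588 * (S.Ceta η * (1 + η) * h2Norm (u s) (v s)) *
          (2 * h2NormSq (u s) / (ε ^ 2 * (N : ℝ) ^ 2) + 2 * h2NormSq (v s) / (ε ^ 2 * (N : ℝ) ^ 2))
          ≤ 588 * (S.Ceta η * (1 + η) * η) * (2 * η ^ 2 / (ε ^ 2 * (N : ℝ) ^ 2)) := by
        rw [← add_div, ← mul_add]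
        have h6 := hr s hs'
        have h7 := h2NormSq_nonneg (u s)
        have h8 := h2NormSq_nonneg (v s)
        gcongr
      have hpi : 0 < Real.pi ^ d := by positivity
      calc _ ≤ 2 * Real.pi ^ d * (2 / 3 * S.C2 * ∑ k ∈ cube d N, cosCoef (u s) k ^ 2
            + 588 * (S.Ceta η * (1 + η) * η) * (2 * η ^ 2 / (ε ^ 2 * (N : ℝ) ^ 2))) :=
            mul_le_mul_of_nonneg_left (h1.trans (by linarith)) (by positivity)
        _ = 4 / 3 * S.C2 * (Real.pi ^ d * ∑ k ∈ cube d N, cosCoef (u s) k ^ 2)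
            + κ / (N : ℝ) ^ 2 := by
            rw [hκ]
            field_simp
            ring
        _ ≤ 4 / 3 * S.C2 * (L * Real.exp (2 * lam * s)) + κ / (N : ℝ) ^ 2 := by
            have := h2.trans h3
            gcongr
        _ = _ := by ring
    have h := le_add_of_deriv_le_exp hlam (by positivity) hcont
      (fun s hs => hasDerivAt_energy hd1 hd3 hη hS hf hg hsol hr ε (cube d N) hs) hrate ht
    have h0 := energy_le mu0 mv0 nu0 nv0 hε.le (cube d N)
    have e : 4 / 3 * S.C2 * L / (2 * lam) = 2 / 3 * S.C2 * L / lam := by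
      field_simp
      ring
    rw [e] at h
    linarith
  have hlim : Tendsto (fun N : ℕ => h2NormSq (u 0) + h2NormSq (v 0) - (l2NormSq (u 0) + l2NormSq (v 0))
        + 2 / 3 * S.C2 * L / lam * Real.exp (2 * lam * t) + κ / (N : ℝ) ^ 2 * t) atTop
      (𝓝 (h2NormSq (u 0) + h2NormSq (v 0) - (l2NormSq (u 0) + l2NormSq (v 0))
        + 2 / 3 * S.C2 * L / lam * Real.exp (2 * lam * t) + 0 * t)) := by
    refine tendsto_const_nhds.add (Tendsto.mul_const t ?_)
    exact tendsto_const_nhds.div_atTop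
      ((tendsto_pow_atTop two_ne_zero).comp tendsto_natCast_atTop_atTop)
  rw [zero_mul, add_zero] at hlim
  refine ge_of_tendsto hlim ?_
  filter_upwards [eventually_ge_atTop 1, eventually_ge_atTop N₀] with N h1 h2 using hN N h1 h2

/-- A function that vanishes in `L²` has vanishing `H²` norm. -/
lemma h2NormSq_eq_zero {w : (Fin d → ℝ) → ℝ} (hw : MemH2 w) (hn : NeumannBC w)
    (h0 : l2NormSq w = 0) : h2NormSq w = 0 := by
  have hz : ∀ k, cosCoef w k = 0 := by
    intro k
    have h := sum_coef_sq_le (τ := fun _ => false) hw.1 {k}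
    rw [Finset.sum_singleton, h0] at h
    have hpi : 0 < Real.pi ^ d := by positivity
    have : cosCoef w k ^ 2 ≤ 0 := nonpos_of_mul_nonpos_right h hpi
    exact pow_eq_zero_iff two_ne_zero |>.1 (le_antisymm this (sq_nonneg _))
  have h := hasSum_h2NormSq hw hn
  simp only [hz, ne_eq, OfNat.ofNat_ne_zero, not_false_eq_true, zero_pow, mul_zero] at h
  exact h.unique hasSum_zero

end

end NeumannBox

end

open NeumannBox

theorem lemma4 :
    ∃ C₀ : ℝ, 0 < C₀ ∧
      ∀ (d : ℕ), 1 ≤ d → d ≤ 3 →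
      ∀ (S : RDSystem),
        S.f S.Wbar = 0 → S.g S.Wbar = 0 →
        0 < S.Dbar₁ → 0 < S.Dbar₂ →
        S.TuringUnstable d → S.gv < 0 →
      ∀ (η : ℝ), 0 < η → S.SmoothNear η →
      ∀ (M : ℝ), 0 < M →
      ∀ (T : ℝ) (u v : ℝ → (Fin d → ℝ) → ℝ),
        S.IsSolution d T u v →
        (∀ t ∈ Set.Icc 0 T, h2Norm (u t) (v t) ≤
          min η (min (S.Dbar₁ / (2 * C₀ * S.C1 C₀ η)) (S.Dbar₂ / (C₀ * S.C1 C₀ η)))) →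
        (∀ t ∈ Set.Icc 0 T,
          l2Norm (u t) (v t) ≤ 2 * M * Real.exp (S.lamMax d * t) * l2Norm (u 0) (v 0)) →
        (1 ≤ M → 1 ≤ S.C3 d M) ∧
        ∀ t ∈ Set.Icc 0 T,
          h2Norm (u t) (v t) ^ 2 ≤
            S.C3 d M * (h2Norm (u 0) (v 0) ^ 2
              + Real.exp (2 * S.lamMax d * t) * l2Norm (u 0) (v 0) ^ 2) := by
  -- The nonlinear terms amount to at most `1176 C_η (1 + η) ‖w‖_{H²}` times the dissipation, of which
  -- `D̄₁ / 4` and `D̄₂` are available; `C₀ = 50` suffices as `4 · 1176 ≤ 2 C₀²`.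
  refine ⟨50, by norm_num, fun d hd1 hd3 S hf hg hD1 hD2 hT hgv η hη hS M hM T u v hsol hsmall
    hgrow => ⟨fun h1M => ?_, fun t ht => ?_⟩⟩
  · rw [RDSystem.C3]
    exact one_le_mul_of_one_le_of_one_le (one_le_pow₀ h1M) (le_max_right _ _)
  obtain ⟨hlam, -⟩ := lamMax_bounds hD1 hD2 hT hgv
  obtain ⟨hK, hlamC⟩ := lamMax_le_C2 hD1 hD2 hT hgv
  set lam := S.lamMax d with hlamdef
  have hC2 : 0 < S.C2 := by rw [C2_eq]; positivity
  -- In particular the divisions by `C₁` in the smallness condition are genuine.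
  have hC : 0 < S.Ceta η := hD1.trans_le ((le_abs_self _).trans
    ((c2BoundOn_Ceta S hη hS).1.bound₀ _ (Wbar_mem_disc S η)))
  have h0T : (0 : ℝ) ∈ Icc 0 T := ⟨le_rfl, ht.1.trans ht.2⟩
  have hC3 : 0 ≤ S.C3 d M :=
    mul_nonneg (sq_nonneg M) (zero_le_one.trans (le_max_right _ _))
  have hgrow2 : ∀ s ∈ Icc 0 T, l2NormSq (u s) + l2NormSq (v s)
      ≤ 4 * M ^ 2 * l2Norm (u 0) (v 0) ^ 2 * Real.exp (2 * lam * s) := by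
    intro s hs
    rw [← l2Norm_sq]
    have hexp : Real.exp (2 * lam * s) = Real.exp (lam * s) ^ 2 := by
      rw [← Real.exp_nat_mul]; ring_nf
    calc l2Norm (u s) (v s) ^ 2 ≤ (2 * M * Real.exp (lam * s) * l2Norm (u 0) (v 0)) ^ 2 :=
          pow_le_pow_left₀ (Real.sqrt_nonneg _) (hgrow s hs) 2
      _ = _ := by rw [hexp]; ring
  have hl0 : 0 ≤ l2Norm (u 0) (v 0) := Real.sqrt_nonneg _
  rcases hl0.eq_or_lt with h0 | h0
  · -- If the perturbation vanishes initially, the growth bound makes it vanish for all times.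
    obtain ⟨mu, mv, nu, nv⟩ := hsol.1 t ht
    have h1 := hgrow2 t ht
    rw [← h0] at h1
    have h2 := l2NormSq_nonneg (u t)
    have h3 := l2NormSq_nonneg (v t)
    have hu0 := h2NormSq_eq_zero mu nu (by linarith)
    have hv0 := h2NormSq_eq_zero mv nv (by linarith)
    rw [h2Norm_sq, hu0, hv0, add_zero]
    positivity
  -- At time `0` the growth bound reads `1 ≤ 2 M`.
  have hM1 : 1 ≤ 2 * M := by
    have h := hgrow 0 h0T
    rw [mul_zero, Real.exp_zero, mul_one] at h
    exact le_of_mul_le_mul_right (by linarith) h0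
  have hr : ∀ s ∈ Icc 0 T, h2Norm (u s) (v s) ≤ η := fun s hs =>
    (hsmall s hs).trans (min_le_left _ _)
  have hc1 : ∀ s ∈ Icc 0 T, 4704 * (S.Ceta η * (1 + η) * h2Norm (u s) (v s)) ≤ S.Dbar₁ := by
    intro s hs
    have h := (hsmall s hs).trans ((min_le_right _ _).trans (min_le_left _ _))
    rw [RDSystem.C1, le_div_iff₀ (by positivity)] at h
    have : 0 ≤ S.Ceta η * (1 + η) * h2Norm (u s) (v s) :=
      mul_nonneg (by positivity) (h2Norm_nonneg _ _)
    linarith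
  have hc2 : ∀ s ∈ Icc 0 T, 1176 * (S.Ceta η * (1 + η) * h2Norm (u s) (v s)) ≤ S.Dbar₂ := by
    intro s hs
    have h := (hsmall s hs).trans ((min_le_right _ _).trans (min_le_right _ _))
    rw [RDSystem.C1, le_div_iff₀ (by positivity)] at h
    have : 0 ≤ S.Ceta η * (1 + η) * h2Norm (u s) (v s) :=
      mul_nonneg (by positivity) (h2Norm_nonneg _ _)
    linarith
  have key := h2NormSq_le_of_isSolution hd1 hd3 hη hS hf hg hD1 hgv hK hsol hr hc1 hc2 hlam
    (by positivity) hgrow2 ht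
  have hl2 := hgrow2 t ht
  have hexp0 := Real.exp_pos (2 * lam * t)
  set l := l2Norm (u 0) (v 0) with hl
  set e := Real.exp (2 * lam * t)
  -- `λ_max ≤ C₂ / 3` lets the constant `4 M²` of the `L²` bound be absorbed into `C₃`.
  have hq : 3 ≤ S.C2 / lam := by rw [le_div_iff₀ hlam]; linarith
  have hA : M ^ 2 * (4 * (S.C2 / lam)) ≤ S.C3 d M := by
    rw [RDSystem.C3, ← hlamdef, ← mul_div_assoc]
    exact mul_le_mul_of_nonneg_left (le_max_left _ _) (sq_nonneg M)
  have hM2 : 1 ≤ 4 * M ^ 2 := by nlinarith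
  have hC31 : 1 ≤ S.C3 d M := by nlinarith
  have hle : 0 ≤ l ^ 2 * e := by positivity
  have hh0 : 0 ≤ h2Norm (u 0) (v 0) ^ 2 := sq_nonneg _
  rw [← h2Norm_sq, ← h2Norm_sq] at key
  have hfin : 4 * M ^ 2 * l ^ 2 * e + 2 / 3 * S.C2 * (4 * M ^ 2 * l ^ 2) / lam * e
      ≤ S.C3 d M * (e * l ^ 2) := by
    have e1 : 4 * M ^ 2 * l ^ 2 * e + 2 / 3 * S.C2 * (4 * M ^ 2 * l ^ 2) / lam * e
        = (4 * M ^ 2 + 2 / 3 * (M ^ 2 * (4 * (S.C2 / lam)))) * (e * l ^ 2) := by ring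
    rw [e1]
    refine mul_le_mul_of_nonneg_right ?_ (by positivity)
    nlinarith [sq_nonneg M]
  have hl00 : 0 ≤ l2NormSq (u 0) + l2NormSq (v 0) :=
    add_nonneg (l2NormSq_nonneg _) (l2NormSq_nonneg _)
  have hC3h := le_mul_of_one_le_left hh0 hC31
  linarith
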